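/- Let $F\in\mathbb{R}[x_0,x_1,x_2,x_3]$ be homogeneous of degree $3$, let $X_0=\{F=0\}\subset P^3$ be the corresponding real cubic surface (identified with its set of complex points), and let $p\in X_0$. Suppose that $X_0$ is one-nodal with node $p$, that is: (i) $p$ is a node of $X_0$, meaning that in suitable complex linear coordinates $(x_0:x_1:x_2:x_3)$ with $p=(1:0:0:0)$ the equation of $X_0$ is $x_0f_2(x_1,x_2,x_3)+f_3(x_1,x_2,x_3)=0$, where $f_2,f_3$ are homogeneous of degrees $2$ and $3$ and the conic $\{f_2=0\}\subset P^2$ is non-singular; and (ii) $X_0$ has no singular (complex) point other than $p$. Then the group $H_1(X_0(\mathbb{R})\smallsetminus p;\mathbb{Z}/2)$ is generated by the real lines lying on $X_0$ and not passing through $p$; that is, it is spanned over $\mathbb{Z}/2$ by the classes $[l(\mathbb{R})]$, where $l\subset X_0\smallsetminus p$ runs over the complex projective lines invariant under complex conjugation, and $[l(\mathbb{R})]$ denotes the image of the fundamental class of the circle $l(\mathbb{R})$ (the non-zero element of $H_1(l(\mathbb{R});\mathbb{Z}/2)\cong\mathbb{Z}/2$) under the inclusion $l(\mathbb{R})\subset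 X_0(\mathbb{R})\smallsetminus p$. Here $X(\mathbb{R})$ denotes the real locus of $X$ with its usual (Euclidean) topology and homology is singular homology. -/

import Mathlib

open CategoryTheory

noncomputable section

namespace RealCubic

/-- The complex projective space `P³`, the ambient space of all varieties below. A variety is
identified with its set of complex points. -/
abbrev P3 : Type := Projectivization ℂ (Fin 4 → ℂ)

/-- The real projective space `P³(ℝ)`. -/
abbrev RP3 : Type := Projectivization ℝ (Fin 4 → ℝ)

/-- The usual topology of `P³(ℝ)`: the quotient topology from `ℝ⁴ ∖ {0}`. -/
instance : TopologicalSpace RP3 :=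
  TopologicalSpace.coinduced (Projectivization.mk' ℝ) inferInstance

/-- The coordinatewise inclusion `ℝ⁴ → ℂ⁴`. -/
def complexify : (Fin 4 → ℝ) →ₛₗ[algebraMap ℝ ℂ] (Fin 4 → ℂ) where
  toFun v := fun i => (v i : ℂ)
  map_add' v w := by ext i; simp
  map_smul' c v := by ext i; simp

theorem complexify_injective : Function.Injective complexify := by
  intro v w h
  ext i
  exact Complex.ofReal_injective (congrFun h i)

/-- The inclusion `P³(ℝ) → P³`. -/
def toComplex : RP3 → P3 := Projectivization.map complexify complexify_injective

/-- The real locus `S(ℝ)` of a set `S` of points of `P³`. It carries the subspace topology. -/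
def realLocus (S : Set P3) : Set RP3 := toComplex ⁻¹' S

/-- The hypersurface in `P³` with (homogeneous) real equation `F = 0`. -/
def hypersurface (F : MvPolynomial (Fin 4) ℝ) : Set P3 :=
  {x | ∀ v ∈ x.submodule, MvPolynomial.aeval v F = 0}

/-- The singular points of the hypersurface `F = 0`: its points at which all first partial
derivatives of `F` vanish. -/
def IsSingularPoint (F : MvPolynomial (Fin 4) ℝ) (x : P3) : Prop :=
  x ∈ hypersurface F ∧
    ∀ v ∈ x.submodule, ∀ i, MvPolynomial.aeval v (MvPolynomial.pderiv i F) = 0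

/-- The projective hypersurface `f = 0` in `P²` is non-singular: it has no point at which all
first partial derivatives of `f` vanish. -/
def IsNonsingularPlaneCurve (f : MvPolynomial (Fin 3) ℂ) : Prop :=
  ∀ w : Fin 3 → ℂ, w ≠ 0 → MvPolynomial.eval w f = 0 →
    ∃ i, MvPolynomial.eval w (MvPolynomial.pderiv i f) ≠ 0

/-- `p` is a node of the cubic surface `F = 0`: in suitable linear coordinates `(x₀ : w)`, in
which `p = (1 : 0 : 0 : 0)`, the equation reads `x₀ f₂(w) + f₃(w) = 0` (that is, `f₂ + f₃ = 0` in
the affine coordinates `x₀ = 1` centred at `p`) with `f₂`, `f₃` homogeneous of degrees `2` and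
`3`, and the conic `f₂ = 0` is non-singular. -/
def IsNode (F : MvPolynomial (Fin 4) ℝ) (p : P3) : Prop :=
  ∃ (e : (Fin 4 → ℂ) ≃ₗ[ℂ] (Fin 4 → ℂ)) (f₂ f₃ : MvPolynomial (Fin 3) ℂ),
    e (Pi.single 0 1) ∈ p.submodule ∧
    f₂.IsHomogeneous 2 ∧ f₃.IsHomogeneous 3 ∧
    (∀ (x₀ : ℂ) (w : Fin 3 → ℂ), MvPolynomial.aeval (e (Fin.cons x₀ w)) F =
      x₀ * MvPolynomial.eval w f₂ + MvPolynomial.eval w f₃) ∧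
    IsNonsingularPlaneCurve f₂

/-- `F = 0` is a real cubic surface which has a node at `p` and no other singular point. -/
structure IsOneNodalCubic (F : MvPolynomial (Fin 4) ℝ) (p : P3) : Prop where
  homogeneous : F.IsHomogeneous 3
  node : IsNode F p
  singular : ∀ x, IsSingularPoint F x → x = p

/-- The real lines in `P³`: the projectivizations of the two-dimensional subspaces of `ℂ⁴` that
are invariant under complex conjugation. -/
def IsRealLine (l : Set P3) : Prop :=
  ∃ W : Submodule ℂ (Fin 4 → ℂ), Module.finrank ℂ W = 2 ∧ (∀ v ∈ W, star v ∈ W) ∧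
    l = {x | x.submodule ≤ W}

/-- `H₁(S; ℤ/2)` for a subspace `S` of `P³(ℝ)`: singular homology. -/
def H1 (S : Set RP3) : ModuleCat.{0} (ZMod 2) :=
  ((AlgebraicTopology.singularHomologyFunctor (ModuleCat.{0} (ZMod 2)) 1).obj
    (ModuleCat.of (ZMod 2) (ZMod 2))).obj (TopCat.of S)

/-- The homomorphism `H₁(S; ℤ/2) → H₁(T; ℤ/2)` induced by an inclusion `S ⊆ T`. -/
def H1map {S T : Set RP3} (h : S ⊆ T) : H1 S ⟶ H1 T :=
  ((AlgebraicTopology.singularHomologyFunctor (ModuleCat.{0} (ZMod 2)) 1).obj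
    (ModuleCat.of (ZMod 2) (ZMod 2))).map
      (TopCat.ofHom ⟨Set.inclusion h, continuous_inclusion h⟩)

/-- The classes in `H₁(T(ℝ); ℤ/2)` of the real lines contained in `T`. The real locus of a real
line is a circle, so its first homology is `ℤ/2`, and its fundamental class is the non-zero
element; the class of the line is the image of the fundamental class under the inclusion. -/
def realLineClasses (T : Set P3) : Set (H1 (realLocus T)) :=
  {a | ∃ (l : Set P3) (_ : IsRealLine l) (h : l ⊆ T) (c : H1 (realLocus l)),
    c ≠ 0 ∧ a = (H1map (Set.preimage_mono h : realLocus l ⊆ realLocus T)).hom c}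

end RealCubic

end

/-!
The span of the classes of real lines is shown to be everything by duality. A linear form on
`H₁(X₀(ℝ) ∖ p; ℤ/2)` that kills these classes is represented by a singular cocycle that vanishes
on every loop in a real line, and it remains to prove that such a cocycle is a coboundary
(`eq_top_of_forall_cocycle_exact`, `Coordinates.span_realLineClasses_eq_top`). A cocycle is a
coboundary on every set with a simply connected parametrization. Potentials on two open sets can
be glued if each component of the intersection can be reached from a fixed point, and for two
components it suffices that a line runs through both of them
(`PathCocycle.IsPotentialOn.exists_eqOn_inter`). So the task is to cover `X₀(ℝ) ∖ p` by cells
whose intersections are connected by lines.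

Since `p` is the only singular point, it is real, and in real coordinates `(u : x : y : z)` with
`p = (1 : 0 : 0 : 0)` the surface has the equation `u Q(x, y, z) + K(x, y, z) = 0` with a
non-degenerate quadratic form `Q` (`exists_coordinates`). The lines through `p` are the common
points of the conic `Q = 0` and the cubic curve `K = 0`.

If a common point is real, `Q` is brought to the form `x z - y²` with the common point `(1 : 0 :
0)` (`exists_splitCubic`). The planes `y = s z` through the corresponding line cut out a pencil of
conics through `p`. Projection from `p` parametrizes each conic by the lines through `p`, which
gives a cell `mainChart` fibred over `s ∈ ℝ`. The points missed by it lie over the roots of a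
quintic, where the conic degenerates into a line through `p` and a line that avoids `p`; they are
covered by strips, and the latter line makes the gluing possible, simplicity of the roots being
equivalent to smoothness of the surface at the points in question (`exists_isPotentialOn_strip`).
The plane `z = 0` is covered by the cell `tangentChart`. It meets the rest in two components, `s >
0` and `s < 0`. They are joined by a real line that meets every plane of the pencil: a real
quadratic factor `s² - m s - n` of the quintic yields the line `x = m y + n z`
(`exists_isPotentialOn_univ_of_split`).

If there is no real common point, there is still a pair of conjugate ones (`exists_common_zero`).
The third line in the plane of the two corresponding lines through `p` is real, and in suitable
coordinates it is `u = z = 0`, while `Q = x² + y² + τ z²` (`exists_pointlessCubic`). Projection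
from `p` identifies `X₀(ℝ) ∖ p` with the complement of the conic in the projective plane: a disc,
and a Möbius band whose core is that line, or the whole plane if the conic has no real points
(`exists_isPotentialOn_univ_of_pointless`).
-/

noncomputable section

namespace RealCubic

/-! ### Homology and cocycles -/

section Cocycles

open scoped unitInterval Simplicial
open AlgebraicTopology Limits

/-- A singular `1`-cocycle of `X` with values in `ℤ/2`, as a function on paths. A singular
`2`-simplex is replaced by a map of the square, restricted to the triangle above the diagonal; as
the triangle is a retract of the square, no generality is lost. -/
structure PathCocycle (X : Type) [TopologicalSpace X] where
  /-- The value of the cocycle on a path. -/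
  val : C(I, X) → ZMod 2
  /-- The sum of the values on the three edges of a triangle vanishes. -/
  triangle : ∀ K : C(I × I, X),
    val (K.comp ⟨fun t => (0, t), by fun_prop⟩) + val (K.comp ⟨fun t => (t, 1), by fun_prop⟩) +
      val (K.comp ⟨fun t => (t, t), by fun_prop⟩) = 0

/-- The coefficient group `ℤ/2` of the homology. -/
abbrev Coeff : ModuleCat.{0} (ZMod 2) := ModuleCat.of (ZMod 2) (ZMod 2)

/-- The singular chain complex of `X` with coefficients in `ℤ/2`. -/
abbrev chains (X : TopCat.{0}) : ChainComplex (ModuleCat.{0} (ZMod 2)) ℕ :=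
  (TopCat.toSSet.obj X).chainComplex Coeff

/-- The singular `1`-simplex with the given parametrization by the unit interval. -/
def pathSimplex {X : TopCat.{0}} (p : C(I, X)) : (TopCat.toSSet.obj X) _⦋1⦌ :=
  (X.toSSetObjEquiv (.op ⦋1⦌)).symm (p.comp (toContinuousMap stdSimplexHomeomorphUnitInterval))

/-- The singular `2`-simplex obtained from a map of the square by restriction to the triangle
`{(s, t) | s ≤ t}`, whose vertices are taken in the order `(0, 0)`, `(0, 1)`, `(1, 1)`. -/
def squareSimplex {X : TopCat.{0}} (K : C(I × I, X)) : (TopCat.toSSet.obj X) _⦋2⦌ :=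
  (X.toSSetObjEquiv (.op ⦋2⦌)).symm (K.comp ⟨fun a : stdSimplex ℝ (Fin 3) =>
    (⟨a 2, stdSimplex.zero_le a 2, stdSimplex.le_one a 2⟩,
      ⟨a 1 + a 2, add_nonneg (stdSimplex.zero_le a 1) (stdSimplex.zero_le a 2), by
        have := stdSimplex.sum_eq_one a
        rw [Fin.sum_univ_three] at this
        linarith [stdSimplex.zero_le a 0]⟩), by
      have h : ∀ i, Continuous fun a : stdSimplex ℝ (Fin 3) => a i := fun i =>
        (continuous_apply i).comp continuous_subtype_val
      exact ((h 2).subtype_mk _).prodMk (((h 1).add (h 2)).subtype_mk _)⟩)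

theorem pathSimplex_surjective {X : TopCat.{0}} :
    Function.Surjective (pathSimplex : C(I, X) → (TopCat.toSSet.obj X) _⦋1⦌) := by
  intro x
  refine ⟨(X.toSSetObjEquiv (.op ⦋1⦌) x).comp
    (toContinuousMap stdSimplexHomeomorphUnitInterval.symm), ?_⟩
  apply (X.toSSetObjEquiv (.op ⦋1⦌)).injective
  rw [pathSimplex, Equiv.apply_symm_apply]
  ext a
  simp

theorem delta_pathSimplex_one {X : TopCat.{0}} (p : C(I, X)) :
    (TopCat.toSSet.obj X).δ 1 (pathSimplex p) = TopCat.toSSetObj₀Equiv.symm (p 0) := by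
  apply TopCat.toSSetObj₀Equiv.injective
  rw [← TopCat.toSSetObj₁Equiv_apply_zero, Equiv.apply_symm_apply]
  simp [TopCat.toSSetObj₁Equiv, pathSimplex]
  rfl

theorem delta_pathSimplex_zero {X : TopCat.{0}} (p : C(I, X)) :
    (TopCat.toSSet.obj X).δ 0 (pathSimplex p) = TopCat.toSSetObj₀Equiv.symm (p 1) := by
  apply TopCat.toSSetObj₀Equiv.injective
  rw [← TopCat.toSSetObj₁Equiv_apply_one, Equiv.apply_symm_apply]
  simp [TopCat.toSSetObj₁Equiv, pathSimplex]
  rfl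

theorem delta_squareSimplex {X : TopCat.{0}} (K : C(I × I, X)) :
    (TopCat.toSSet.obj X).δ 2 (squareSimplex K) =
        pathSimplex (K.comp ⟨fun t => (0, t), by fun_prop⟩) ∧
      (TopCat.toSSet.obj X).δ 0 (squareSimplex K) =
        pathSimplex (K.comp ⟨fun t => (t, 1), by fun_prop⟩) ∧
      (TopCat.toSSet.obj X).δ 1 (squareSimplex K) =
        pathSimplex (K.comp ⟨fun t => (t, t), by fun_prop⟩) := by
  -- the barycentric coordinates of a point on the `i`-th face
  have key : ∀ (i : Fin 3) (a : stdSimplex ℝ (Fin 2)) (j : Fin 3),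
      stdSimplex.map i.succAbove a j = ∑ k with i.succAbove k = j, a k := by
    intro i a j
    rw [stdSimplex.map_coe, FunOnFinite.linearMap_apply_apply]
  have e : ∀ a : stdSimplex ℝ (Fin 2), a 0 + a 1 = 1 := fun a => stdSimplex.add_eq_one a
  have h21 : ∀ a : stdSimplex ℝ (Fin 2), stdSimplex.map (Fin.succAbove (2 : Fin 3)) a 1 = a 1 := by
    intro a
    rw [key, show ({k | (2 : Fin 3).succAbove k = 1} : Finset (Fin 2)) = {1} by decide]
    simp
  have h22 : ∀ a : stdSimplex ℝ (Fin 2), stdSimplex.map (Fin.succAbove (2 : Fin 3)) a 2 = 0 := by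
    intro a
    rw [key, show ({k | (2 : Fin 3).succAbove k = 2} : Finset (Fin 2)) = ∅ by decide]
    simp
  have h01 : ∀ a : stdSimplex ℝ (Fin 2), stdSimplex.map (Fin.succAbove (0 : Fin 3)) a 1 = a 0 := by
    intro a
    rw [key, show ({k | (0 : Fin 3).succAbove k = 1} : Finset (Fin 2)) = {0} by decide]
    simp
  have h02 : ∀ a : stdSimplex ℝ (Fin 2), stdSimplex.map (Fin.succAbove (0 : Fin 3)) a 2 = a 1 := by
    intro a
    rw [key, show ({k | (0 : Fin 3).succAbove k = 2} : Finset (Fin 2)) = {1} by decide]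
    simp
  have h11 : ∀ a : stdSimplex ℝ (Fin 2), stdSimplex.map (Fin.succAbove (1 : Fin 3)) a 1 = 0 := by
    intro a
    rw [key, show ({k | (1 : Fin 3).succAbove k = 1} : Finset (Fin 2)) = ∅ by decide]
    simp
  have h12 : ∀ a : stdSimplex ℝ (Fin 2), stdSimplex.map (Fin.succAbove (1 : Fin 3)) a 2 = a 1 := by
    intro a
    rw [key, show ({k | (1 : Fin 3).succAbove k = 2} : Finset (Fin 2)) = {1} by decide]
    simp
  refine ⟨?_, ?_, ?_⟩
  · apply (X.toSSetObjEquiv (.op ⦋1⦌)).injective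
    ext a
    refine congrArg K (Prod.ext (Subtype.ext (h22 a)) (Subtype.ext ?_))
    exact (congrArg₂ (· + ·) (h21 a) (h22 a)).trans (add_zero _)
  · apply (X.toSSetObjEquiv (.op ⦋1⦌)).injective
    ext a
    refine congrArg K (Prod.ext (Subtype.ext (h02 a)) (Subtype.ext ?_))
    exact (congrArg₂ (· + ·) (h01 a) (h02 a)).trans (e a)
  · apply (X.toSSetObjEquiv (.op ⦋1⦌)).injective
    ext a
    refine congrArg K (Prod.ext (Subtype.ext (h12 a)) (Subtype.ext ?_))
    exact (congrArg₂ (· + ·) (h11 a) (h12 a)).trans (zero_add _)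

/-- Over a field, a linear form on homology is represented by a linear form on all chains. -/
theorem exists_functional_lift (K : ChainComplex (ModuleCat.{0} (ZMod 2)) ℕ)
    (f : K.homology 1 ⟶ Coeff) :
    ∃ ψ : K.X 1 ⟶ Coeff, K.iCycles 1 ≫ ψ = K.homologyπ 1 ≫ f := by
  have hi : Function.Injective (K.iCycles 1).hom := (ModuleCat.mono_iff_injective _).1 inferInstance
  obtain ⟨r, hr⟩ := (K.iCycles 1).hom.exists_leftInverse_of_injective (LinearMap.ker_eq_bot.2 hi)
  refine ⟨ModuleCat.ofHom r ≫ K.homologyπ 1 ≫ f, ?_⟩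
  rw [← Category.assoc]
  have : K.iCycles 1 ≫ ModuleCat.ofHom r = 𝟙 _ := by
    ext x
    exact LinearMap.congr_fun hr x
  rw [this, Category.id_comp]

/-- The value of a linear form on the singular `n`-chains at a singular simplex. -/
def evalSimplex {X : TopCat.{0}} {n : ℕ} (ψ : (chains X).X n ⟶ Coeff)
    (s : (TopCat.toSSet.obj X) _⦋n⦌) : ZMod 2 :=
  ((TopCat.toSSet.obj X).ιChainComplex s ≫ ψ).hom (1 : ZMod 2)

theorem evalSimplex_ext {X : TopCat.{0}} {n : ℕ} {ψ ψ' : (chains X).X n ⟶ Coeff}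
    (h : ∀ s, evalSimplex ψ s = evalSimplex ψ' s) : ψ = ψ' := by
  apply SSet.chainComplex_hom_ext
  intro s
  ext
  exact h s

theorem evalSimplex_d {X : TopCat.{0}} {n : ℕ} (ψ : (chains X).X n ⟶ Coeff)
    (s : (TopCat.toSSet.obj X) _⦋n + 1⦌) :
    evalSimplex ((chains X).d (n + 1) n ≫ ψ) s =
      ∑ i : Fin (n + 2), evalSimplex ψ ((TopCat.toSSet.obj X).δ i s) := by
  rw [evalSimplex, SSet.ιChainComplex_d_assoc]
  simp only [Preadditive.sum_comp, evalSimplex, Linear.smul_comp, ModuleCat.hom_sum,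
    ModuleCat.hom_smul, LinearMap.sum_apply, LinearMap.smul_apply]
  refine Finset.sum_congr rfl fun i _ => ?_
  rcases neg_one_pow_eq_or ℤ i.val with h | h <;> rw [h] <;> simp [ZMod.neg_eq_self_mod_two]

theorem exists_functional_of_values {X : TopCat.{0}} {n : ℕ}
    (g : (TopCat.toSSet.obj X) _⦋n⦌ → ZMod 2) :
    ∃ ψ : (chains X).X n ⟶ Coeff, ∀ s, evalSimplex ψ s = g s := by
  refine ⟨((TopCat.toSSet.obj X).isColimitChainComplexXCofan Coeff n).desc
    (Cofan.mk Coeff fun s => g s • 𝟙 Coeff), fun s => ?_⟩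
  have := ((TopCat.toSSet.obj X).isColimitChainComplexXCofan Coeff n).fac
    (Cofan.mk Coeff fun s => g s • 𝟙 Coeff) ⟨s⟩
  have h2 := congrArg (fun f => f.hom (1 : ZMod 2)) this
  refine h2.trans ?_
  simp

/-- A loop in `S` is a cycle, and the form `φ` on `H₁(X)` represented by `ψ` takes at the image of
its class the value of `ψ` at the loop. -/
theorem exists_class_of_loop {S X : TopCat.{0}} (f : S ⟶ X) {φ : (chains X).homology 1 ⟶ Coeff}
    {ψ : (chains X).X 1 ⟶ Coeff} (hψ : (chains X).iCycles 1 ≫ ψ = (chains X).homologyπ 1 ≫ φ)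
    (p : C(I, S)) (hp : p 0 = p 1) :
    ∃ c : (chains S).homology 1,
      φ.hom ((HomologicalComplex.homologyMap
        (SSet.chainComplexMap (TopCat.toSSet.map f) Coeff) 1).hom c) =
        evalSimplex ψ (pathSimplex (f.hom.comp p)) := by
  have hz : (TopCat.toSSet.obj S).ιChainComplex (pathSimplex p) ≫ (chains S).d 1 0 = 0 := by
    rw [SSet.ιChainComplex_d]
    simp [Fin.sum_univ_two, delta_pathSimplex_zero, delta_pathSimplex_one, hp]
  have hm : (TopCat.toSSet.map f).app _ (pathSimplex p) = pathSimplex (f.hom.comp p) := rfl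
  let z := (chains S).liftCycles
    ((TopCat.toSSet.obj S).ιChainComplex (R := Coeff) (pathSimplex p)) 0 (by simp) hz
  refine ⟨(z ≫ (chains S).homologyπ 1).hom (1 : ZMod 2), ?_⟩
  have key : z ≫ (chains S).homologyπ 1 ≫ HomologicalComplex.homologyMap
        (SSet.chainComplexMap (TopCat.toSSet.map f) Coeff) 1 ≫ φ =
      (TopCat.toSSet.obj X).ιChainComplex (pathSimplex (f.hom.comp p)) ≫ ψ := by
    rw [HomologicalComplex.homologyπ_naturality_assoc, ← hψ, HomologicalComplex.cyclesMap_i_assoc,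
      HomologicalComplex.liftCycles_i_assoc, SSet.ι_chainComplexMap_f_assoc, hm]
  exact congrArg (fun f => f.hom (1 : ZMod 2)) key

/-- A subspace `N` of `H₁(X; ℤ/2)` is everything if each cocycle that vanishes on the loops of all
spaces `S` over `X` whose homology has image in `N` is a coboundary: a linear form on `H₁` killing
`N` is represented by such a cocycle, and a coboundary represents the zero form. -/
theorem eq_top_of_forall_cocycle_exact {X : TopCat.{0}}
    (N : Submodule (ZMod 2) ((chains X).homology 1))
    (h : ∀ c : PathCocycle X,
      (∀ (S : TopCat.{0}) (f : S ⟶ X), (∀ a, (HomologicalComplex.homologyMap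
        (SSet.chainComplexMap (TopCat.toSSet.map f) Coeff) 1).hom a ∈ N) →
        ∀ p : C(I, S), p 0 = p 1 → c.val (f.hom.comp p) = 0) →
      ∃ g : X → ZMod 2, ∀ p, c.val p = g (p 0) + g (p 1)) : N = ⊤ := by
  by_contra hN
  obtain ⟨φ₀, hφ₀, hker⟩ := N.exists_le_ker_of_lt_top (lt_top_iff_ne_top.2 hN)
  let φ : (chains X).homology 1 ⟶ Coeff := ModuleCat.ofHom φ₀
  obtain ⟨ψ, hψ⟩ := exists_functional_lift (chains X) φ
  have hd : (chains X).d 2 1 ≫ ψ = 0 := by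
    rw [← (chains X).toCycles_i, Category.assoc, hψ]
    simp
  let c : PathCocycle X :=
    { val := fun p => evalSimplex ψ (pathSimplex p)
      triangle := fun K => by
        obtain ⟨h2, h0, h1⟩ := delta_squareSimplex K
        have := evalSimplex_d ψ (squareSimplex K)
        rw [hd, Fin.sum_univ_three, h0, h1, h2] at this
        simp only [evalSimplex, Limits.comp_zero, ModuleCat.hom_zero, LinearMap.zero_apply]
          at this ⊢
        rw [this]
        ring }
  obtain ⟨g, hg⟩ := h c fun S f hf p hp => by
    obtain ⟨a, ha⟩ := exists_class_of_loop f hψ p hp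
    exact ha.symm.trans (hker (hf a))
  obtain ⟨θ, hθ⟩ := exists_functional_of_values (X := X) (n := 0) fun s =>
    g (TopCat.toSSetObj₀Equiv s)
  have hψθ : ψ = (chains X).d 1 0 ≫ θ := by
    apply evalSimplex_ext
    intro s
    obtain ⟨p, rfl⟩ := pathSimplex_surjective s
    rw [evalSimplex_d, Fin.sum_univ_two, hθ, hθ, delta_pathSimplex_zero, delta_pathSimplex_one]
    simpa [add_comm] using hg p
  apply hφ₀
  have : φ = 0 := by
    rw [← cancel_epi ((chains X).homologyπ 1), ← hψ, hψθ]
    simp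
  exact congrArg ModuleCat.Hom.hom this

end Cocycles

/-! ### Potentials of cocycles -/

section Potentials

open scoped unitInterval

namespace PathCocycle

variable {X : Type} [TopologicalSpace X] (c : PathCocycle X)

theorem add_self (a : ZMod 2) : a + a = 0 := CharTwo.add_self_eq_zero a

theorem val_const (x : X) : c.val (ContinuousMap.const I x) = 0 := by
  have := c.triangle (ContinuousMap.const (I × I) x)
  rw [ContinuousMap.const_comp, ContinuousMap.const_comp, ContinuousMap.const_comp, add_self,
    zero_add] at this
  exact this

/-- The path `t ↦ p (a + t (b - a))`, where `p` is extended by constants to the real line. -/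
def segment (p : C(I, X)) (a b : ℝ) : C(I, X) :=
  ⟨fun t => p (Set.projIcc 0 1 zero_le_one (a + t * (b - a))),
    p.continuous.comp (continuous_projIcc.comp (by fun_prop))⟩

/-- The triangle is mapped by `p` composed with an affine function of the square, so that `b` need
not lie between `a` and `d`. -/
theorem val_segment_add (p : C(I, X)) (a b d : ℝ) :
    c.val (segment p a b) + c.val (segment p b d) = c.val (segment p a d) := by
  have h := c.triangle ⟨fun st : I × I =>
    p (Set.projIcc 0 1 zero_le_one (a + st.2 * (b - a) + st.1 * (d - b))),
    p.continuous.comp (continuous_projIcc.comp (by fun_prop))⟩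
  rw [CharTwo.add_eq_iff_eq_add, zero_add] at h
  convert h using 2
  · congr 1
    ext t
    simp [segment]
  · congr 1
    ext t
    simp [segment]
  · ext t
    simp only [segment, ContinuousMap.coe_mk, ContinuousMap.comp_apply]
    congr 2
    ring

theorem segment_zero_one (p : C(I, X)) : segment p 0 1 = p := by
  ext t
  simp [segment]

/-- The square of a homotopy is cut by its diagonal into two triangles. -/
theorem val_homotopic {x y : X} {γ γ' : Path x y} (h : γ.Homotopic γ') :
    c.val γ.toContinuousMap = c.val γ'.toContinuousMap := by
  obtain ⟨H⟩ := h
  have h1 := c.triangle H.toContinuousMap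
  have h2 := c.triangle (H.toContinuousMap.comp ⟨fun st : I × I => (st.2, st.1), by fun_prop⟩)
  have e1 : H.toContinuousMap.comp ⟨fun t : I => ((0 : I), t), by fun_prop⟩ =
      γ.toContinuousMap := by
    ext t; simp
  have e2 : H.toContinuousMap.comp ⟨fun t : I => (t, (1 : I)), by fun_prop⟩ =
      ContinuousMap.const I y := by
    ext t; simp
  have e3 : (H.toContinuousMap.comp ⟨fun st : I × I => (st.2, st.1), by fun_prop⟩).comp
      ⟨fun t : I => ((0 : I), t), by fun_prop⟩ = ContinuousMap.const I x := by
    ext t; simp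
  have e4 : (H.toContinuousMap.comp ⟨fun st : I × I => (st.2, st.1), by fun_prop⟩).comp
      ⟨fun t : I => (t, (1 : I)), by fun_prop⟩ = γ'.toContinuousMap := by
    ext t; simp
  have e5 : (H.toContinuousMap.comp ⟨fun st : I × I => (st.2, st.1), by fun_prop⟩).comp
      ⟨fun t : I => (t, t), by fun_prop⟩ =
        H.toContinuousMap.comp ⟨fun t : I => (t, t), by fun_prop⟩ := by
    ext t; simp
  rw [e1, e2, val_const, add_zero] at h1
  rw [e3, e4, e5, val_const, zero_add] at h2
  exact add_right_cancel (h1.trans h2.symm)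

theorem val_trans {x y z : X} (γ : Path x y) (γ' : Path y z) :
    c.val (γ.trans γ').toContinuousMap = c.val γ.toContinuousMap + c.val γ'.toContinuousMap := by
  have h := c.val_segment_add (γ.trans γ').toContinuousMap 0 (1 / 2) 1
  rw [segment_zero_one] at h
  rw [← h]
  congr 2
  · ext t
    have h0 : (0 : ℝ) + t * (1 / 2 - 0) ∈ Set.Icc (0 : ℝ) 1 :=
      ⟨by linarith [t.2.1], by linarith [t.2.2]⟩
    simp only [segment, ContinuousMap.coe_mk]
    rw [Set.projIcc_of_mem _ h0]
    change (γ.trans γ') _ = γ t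
    rw [Path.trans_apply, dif_pos (by change (0 : ℝ) + t * (1 / 2 - 0) ≤ 1 / 2; linarith [t.2.2])]
    congr 1
    ext
    simp only
    ring
  · ext t
    have h0 : (1 / 2 : ℝ) + t * (1 - 1 / 2) ∈ Set.Icc (0 : ℝ) 1 :=
      ⟨by linarith [t.2.1], by linarith [t.2.2]⟩
    simp only [segment, ContinuousMap.coe_mk]
    rw [Set.projIcc_of_mem _ h0]
    change (γ.trans γ') _ = γ' t
    rw [Path.trans_apply]
    split_ifs with h1
    · have h2 : t = 0 := by
        ext
        change (1 / 2 : ℝ) + t * (1 - 1 / 2) ≤ 1 / 2 at h1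
        have := t.2.1
        simp only [Set.Icc.coe_zero]
        linarith
      subst h2
      have : (⟨2 * ((1 / 2 : ℝ) + ((0 : I) : ℝ) * (1 - 1 / 2)), by simp⟩ : I) = 1 := by
        ext; simp
      simp
    · congr 1
      ext
      simp only
      ring

theorem val_symm {x y : X} (γ : Path x y) :
    c.val γ.symm.toContinuousMap = c.val γ.toContinuousMap := by
  have h := c.val_homotopic (⟨Path.Homotopy.reflTransSymm γ⟩ : (Path.refl x).Homotopic _)
  rw [val_trans] at h
  have h2 : c.val (Path.refl x).toContinuousMap = 0 := c.val_const x
  rw [h2, eq_comm, CharTwo.add_eq_iff_eq_add, zero_add] at h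
  exact h.symm

/-- If a cocycle vanishes on the loops in `L`, its value on a path in `L` depends only on the
endpoints. -/
theorem val_eq_of_loops {L : Set X} (hL : ∀ p : C(I, X), (∀ t, p t ∈ L) → p 0 = p 1 → c.val p = 0)
    {α β : C(I, X)} (hα : ∀ t, α t ∈ L) (hβ : ∀ t, β t ∈ L) (h0 : α 0 = β 0) (h1 : α 1 = β 1) :
    c.val α = c.val β := by
  let γ : Path (α 0) (α 1) := ⟨α, rfl, rfl⟩
  let γ' : Path (α 0) (α 1) := ⟨β, h0.symm, h1.symm⟩
  have h := hL (γ.trans γ'.symm).toContinuousMap (fun t => by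
    have : (γ.trans γ'.symm) t ∈ Set.range (γ.trans γ'.symm) := ⟨t, rfl⟩
    rw [Path.trans_range, Path.symm_range] at this
    rcases this with ⟨s, hs⟩ | ⟨s, hs⟩
    · exact hs ▸ hα s
    · exact hs ▸ hβ s) (by
    change (γ.trans γ'.symm) 0 = (γ.trans γ'.symm) 1
    simp)
  rw [val_trans, val_symm, CharTwo.add_eq_iff_eq_add, zero_add] at h
  exact h

/-- The pullback of a cocycle under a continuous map. -/
def comap {Y : Type} [TopologicalSpace Y] (f : C(Y, X)) : PathCocycle Y where
  val p := c.val (f.comp p)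
  triangle K := c.triangle (f.comp K)

/-- The cocycle `c` is on `U` the coboundary of the function `g`. -/
def IsPotentialOn (U : Set X) (g : X → ZMod 2) : Prop :=
  ∀ p : C(I, X), (∀ t, p t ∈ U) → c.val p = g (p 0) + g (p 1)

variable {c}

theorem IsPotentialOn.mono {U V : Set X} {g : X → ZMod 2} (h : c.IsPotentialOn V g) (hUV : U ⊆ V) :
    c.IsPotentialOn U g := fun p hp => h p fun t => hUV (hp t)

/-- A potential for each member of an open cover is a potential for the union, by subdivision of
paths. -/
theorem IsPotentialOn.iUnion {ι : Sort*} {U : ι → Set X} (hU : ∀ i, IsOpen (U i)) {g : X → ZMod 2}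
    (h : ∀ i, c.IsPotentialOn (U i) g) : c.IsPotentialOn (⋃ i, U i) g := by
  intro p hp
  obtain ⟨t, ht0, htm, ⟨n, hn⟩, ht⟩ := exists_monotone_Icc_subset_open_cover_unitInterval
    (c := fun i => p ⁻¹' U i) (fun i => (hU i).preimage p.continuous) (fun s _ => by
      obtain ⟨i, hi⟩ := Set.mem_iUnion.1 (hp s)
      exact Set.mem_iUnion.2 ⟨i, hi⟩)
  have step : ∀ m, c.val (segment p 0 (t m)) = g (p 0) + g (p (t m)) := by
    intro m
    induction m with
    | zero =>
      have : segment p 0 (t 0) = ContinuousMap.const I (p 0) := by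
        ext s
        simp [segment, ht0]
      rw [this, val_const, ht0, add_self]
    | succ m ih =>
      rw [← val_segment_add c p 0 (t m) (t (m + 1)), ih]
      obtain ⟨i, hi⟩ := ht m
      have hle : (t m : ℝ) ≤ t (m + 1) := htm (Nat.le_succ m)
      have hs := h i (segment p (t m) (t (m + 1))) fun s => by
        have hm : (t m : ℝ) + s * (t (m + 1) - t m) ∈ Set.Icc (t m : ℝ) (t (m + 1)) :=
          ⟨by nlinarith [s.2.1], by nlinarith [s.2.2]⟩
        have hI : (t m : ℝ) + s * (t (m + 1) - t m) ∈ Set.Icc (0 : ℝ) 1 :=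
          ⟨(t m).2.1.trans hm.1, hm.2.trans (t (m + 1)).2.2⟩
        apply hi
        rw [Set.projIcc_of_mem _ hI]
        exact ⟨hm.1, hm.2⟩
      have e0 : segment p (t m) (t (m + 1)) 0 = p (t m) := by simp [segment]
      have e1 : segment p (t m) (t (m + 1)) 1 = p (t (m + 1)) := by simp [segment]
      rw [hs, e0, e1, add_assoc, ← add_assoc (g (p (t m))), add_self, zero_add]
  have := step n
  rw [hn n le_rfl] at this
  simpa [segment_zero_one] using this

theorem exists_isPotentialOn_univ [SimplyConnectedSpace X] (c : PathCocycle X) :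
    ∃ g, c.IsPotentialOn Set.univ g := by
  obtain ⟨b⟩ : Nonempty X := PathConnectedSpace.nonempty
  refine ⟨fun x => c.val (PathConnectedSpace.somePath b x).toContinuousMap, fun p _ => ?_⟩
  let γ : Path (p 0) (p 1) := ⟨p, rfl, rfl⟩
  have h := c.val_homotopic (SimplyConnectedSpace.paths_homotopic γ
    ((PathConnectedSpace.somePath b (p 0)).symm.trans (PathConnectedSpace.somePath b (p 1))))
  rw [val_trans, val_symm] at h
  exact h

/-- A set parametrized by a simply connected space, with continuous inverse, carries a potential. -/
theorem exists_isPotentialOn_of_chart (c : PathCocycle X) {E : Type} [TopologicalSpace E]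
    [SimplyConnectedSpace E] (φ : C(E, X)) {U : Set X} (ψ : X → E) (hψ : ContinuousOn ψ U)
    (hφψ : ∀ x ∈ U, φ (ψ x) = x) : ∃ g, c.IsPotentialOn U g := by
  obtain ⟨g, hg⟩ := exists_isPotentialOn_univ (c.comap φ)
  refine ⟨fun x => g (ψ x), fun p hp => ?_⟩
  let q : C(I, E) := ⟨ψ ∘ p, hψ.comp_continuous p.continuous hp⟩
  have hq : φ.comp q = p := by
    ext t
    exact hφψ _ (hp t)
  have := hg q fun _ => trivial
  change c.val (φ.comp q) = _ at this
  rw [hq] at this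
  exact this

theorem IsPotentialOn.eq_of_joinedIn {U V : Set X} {g g' : X → ZMod 2} (hg : c.IsPotentialOn U g)
    (hg' : c.IsPotentialOn V g') {x y : X} (h : JoinedIn (U ∩ V) x y) :
    g x + g' x = g y + g' y := by
  obtain ⟨γ, hγ⟩ := h
  have h1 := hg γ.toContinuousMap fun t => (hγ t).1
  have h2 := hg' γ.toContinuousMap fun t => (hγ t).2
  have e0 : γ.toContinuousMap 0 = x := γ.source
  have e1 : γ.toContinuousMap 1 = y := γ.target
  rw [e0, e1] at h1 h2
  have h3 := h1.symm.trans h2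
  grind [add_self (g y), add_self (g' x)]

/-- If each point of `U ∩ V` can be joined in `U ∩ V` to `k` or to `k'`, and the cocycle vanishes on
the loop made of a path from `k` to `k'` in `U` and one in `V`, then a potential on `V` can be
changed by a constant so as to agree with a given one on `U`. The intersection may thus have two
components, which is where the lines enter. -/
theorem IsPotentialOn.exists_eqOn_inter {U V : Set X} {g g' : X → ZMod 2}
    (hg : c.IsPotentialOn U g) (hg' : c.IsPotentialOn V g') {k k' : X}
    (hj : ∀ x ∈ U ∩ V, JoinedIn (U ∩ V) x k ∨ JoinedIn (U ∩ V) x k')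
    {α β : C(I, X)} (hα : ∀ t, α t ∈ U) (hβ : ∀ t, β t ∈ V) (hα0 : α 0 = k) (hα1 : α 1 = k')
    (hβ0 : β 0 = k) (hβ1 : β 1 = k') (hαβ : c.val α = c.val β) :
    ∃ g'', c.IsPotentialOn V g'' ∧ Set.EqOn g'' g (U ∩ V) := by
  refine ⟨fun x => g' x + (g k + g' k), fun p hp => ?_, fun x hx => ?_⟩
  · rw [hg' p hp]
    grind [add_self (g k + g' k)]
  · have hk : g k + g' k = g k' + g' k' := by
      have h1 := hg α hα
      have h2 := hg' β hβ
      rw [hα0, hα1] at h1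
      rw [hβ0, hβ1] at h2
      have h3 := h1.symm.trans (hαβ.trans h2)
      grind [add_self (g k'), add_self (g' k)]
    have : g x + g' x = g k + g' k := by
      rcases hj x hx with h | h
      · exact hg.eq_of_joinedIn hg' h
      · rw [hk]
        exact hg.eq_of_joinedIn hg' h
    change g' x + (g k + g' k) = g x
    rw [← this]
    grind [add_self (g' x)]

/-- Potentials on `A` and on sets `S j` that meet each other only inside `A` can be glued once each
of the latter agrees with the former. -/
theorem IsPotentialOn.exists_union_iUnion {ι : Type*} {A : Set X} {S : ι → Set X} (hA : IsOpen A)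
    (hS : ∀ j, IsOpen (S j)) (hSA : ∀ i j, i ≠ j → S i ∩ S j ⊆ A) {g : X → ZMod 2}
    (hg : c.IsPotentialOn A g)
    (h : ∀ j, ∃ g', c.IsPotentialOn (S j) g' ∧ Set.EqOn g' g (A ∩ S j)) :
    ∃ G, c.IsPotentialOn (A ∪ ⋃ j, S j) G := by
  classical
  choose g' hg' hgg' using h
  let G : X → ZMod 2 := fun x => if x ∈ A then g x else
    if hx : ∃ j, x ∈ S j then g' hx.choose x else 0
  have hGA : ∀ x ∈ A, G x = g x := fun x hx => if_pos hx
  have hGS : ∀ j, ∀ x ∈ S j, G x = g' j x := by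
    intro j x hx
    by_cases hxA : x ∈ A
    · rw [hGA x hxA, hgg' j ⟨hxA, hx⟩]
    · have hex : ∃ j, x ∈ S j := ⟨j, hx⟩
      have : hex.choose = j := by
        by_contra hne
        exact hxA (hSA _ _ hne ⟨hex.choose_spec, hx⟩)
      simp only [G, if_neg hxA, dif_pos hex, this]
  refine ⟨G, ?_⟩
  have : A ∪ ⋃ j, S j = ⋃ o : Option ι, Option.elim o A S := by
    ext x
    simp [Set.mem_iUnion, Option.exists]
  rw [this]
  apply IsPotentialOn.iUnion
  · rintro (_ | j)
    exacts [hA, hS j]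
  · rintro (_ | j) p hp
    · rw [hg p hp, hGA _ (hp 0), hGA _ (hp 1)]
    · rw [hg' j p hp, hGS j _ (hp 0), hGS j _ (hp 1)]

theorem IsPotentialOn.exists_union {U V : Set X} (hU : IsOpen U) (hV : IsOpen V)
    {g g' : X → ZMod 2} (hg : c.IsPotentialOn U g) (hg' : c.IsPotentialOn V g')
    (h : Set.EqOn g' g (U ∩ V)) : ∃ G, c.IsPotentialOn (U ∪ V) G := by
  have := hg.exists_union_iUnion (S := fun _ : Unit => V) hU (fun _ => hV)
    (fun i j hij => (hij rfl).elim) fun _ => ⟨g', hg', h⟩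
  simpa [Set.iUnion_const] using this

end PathCocycle

end Potentials

/-! ### Projectivizations of cones -/

section Cones

open scoped unitInterval

/-- A presentation of a space `X` as the projectivization of a cone `C ⊆ ℝ⁴ ∖ {0}`: an open
continuous surjection `C → X` whose fibres are the classes of proportional vectors. The map is
defined on all of `ℝ⁴`; its values outside `C` are irrelevant. -/
structure ConeMap (C : Set (Fin 4 → ℝ)) (X : Type) [TopologicalSpace X] where
  /-- The point of `X` with the given homogeneous coordinates. -/
  toFun : (Fin 4 → ℝ) → X
  continuousOn : ContinuousOn toFun C
  isOpen_image : ∀ U, IsOpen U → IsOpen (toFun '' (C ∩ U))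
  surjective : ∀ x, ∃ v ∈ C, toFun v = x
  eq_iff : ∀ v ∈ C, ∀ w ∈ C, toFun v = toFun w ↔ ∃ t : ℝ, t ≠ 0 ∧ w = t • v

namespace ConeMap

variable {C : Set (Fin 4 → ℝ)} {X : Type} [TopologicalSpace X] (Φ : ConeMap C X)

/-- The part `C ∩ U` of the cone carries a potential if its image in `X` is parametrized by a
star-shaped set `E` in the plane: `φ` gives homogeneous coordinates of the point with parameters
`e`, and `ψ` the parameters of a point. -/
theorem exists_isPotentialOn_image (c : PathCocycle X) {U : Set (Fin 4 → ℝ)} (hU : IsOpen U)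
    {E : Set (ℝ × ℝ)} (hE : StarConvex ℝ 0 E) (hE0 : (0 : ℝ × ℝ) ∈ E) {φ : ℝ × ℝ → Fin 4 → ℝ}
    (hφ : ContinuousOn φ E) (hφC : ∀ e ∈ E, φ e ∈ C) {ψ : (Fin 4 → ℝ) → ℝ × ℝ}
    (hψ : ContinuousOn ψ (C ∩ U)) (hψE : ∀ v ∈ C ∩ U, ψ v ∈ E)
    (hinv : ∀ v ∈ C ∩ U, ∀ t : ℝ, t ≠ 0 → t • v ∈ C ∩ U → ψ (t • v) = ψ v)
    (hφψ : ∀ v ∈ C ∩ U, ∃ t : ℝ, t ≠ 0 ∧ φ (ψ v) = t • v) :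
    ∃ g, c.IsPotentialOn (Φ.toFun '' (C ∩ U)) g := by
  classical
  have : ContractibleSpace E := hE.contractibleSpace ⟨0, hE0⟩
  let χ : X → E := fun x => if h : ∃ v ∈ C ∩ U, Φ.toFun v = x then
    ⟨ψ h.choose, hψE _ h.choose_spec.1⟩ else ⟨0, hE0⟩
  have hχ : ∀ v ∈ C ∩ U, (χ (Φ.toFun v) : ℝ × ℝ) = ψ v := by
    intro v hv
    have h : ∃ w ∈ C ∩ U, Φ.toFun w = Φ.toFun v := ⟨v, hv, rfl⟩
    simp only [χ, dif_pos h]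
    obtain ⟨hw, hwv⟩ := h.choose_spec
    obtain ⟨t, ht, e⟩ := (Φ.eq_iff _ hv.1 _ hw.1).1 hwv.symm
    rw [e] at hw ⊢
    exact hinv v hv t ht hw
  refine PathCocycle.exists_isPotentialOn_of_chart c
    (⟨fun e => Φ.toFun (φ e), ?_⟩ : C(E, X)) χ ?_ ?_
  · exact Φ.continuousOn.comp_continuous hφ.domRestrict fun e => hφC e e.2
  · rintro _ ⟨v, hv, rfl⟩
    apply ContinuousAt.continuousWithinAt
    rw [ContinuousAt, tendsto_subtype_rng]
    intro W hW
    rw [hχ v hv] at hW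
    have h1 := hψ v hv hW
    rw [Filter.mem_map, mem_nhdsWithin] at h1
    obtain ⟨O, hO, hvO, hOW⟩ := h1
    rw [Filter.mem_map]
    refine Filter.mem_of_superset ((Φ.isOpen_image (O ∩ U) (hO.inter hU)).mem_nhds
      ⟨v, ⟨hv.1, hvO, hv.2⟩, rfl⟩) ?_
    rintro _ ⟨w, ⟨hwC, hwO, hwU⟩, rfl⟩
    change (χ (Φ.toFun w) : ℝ × ℝ) ∈ W
    rw [hχ w ⟨hwC, hwU⟩]
    exact hOW ⟨hwO, hwC, hwU⟩
  · rintro _ ⟨v, hv, rfl⟩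
    change Φ.toFun (φ (χ (Φ.toFun v))) = _
    rw [hχ v hv]
    obtain ⟨t, ht, e⟩ := hφψ v hv
    exact ((Φ.eq_iff v hv.1 _ (hφC _ (hψE v hv))).2 ⟨t, ht, e⟩).symm

/-- The cocycle `c` vanishes on all loops that run in a projective line spanned by two vectors
`v₁`, `v₂` and contained in `X`. -/
def KillsLines (c : PathCocycle X) : Prop :=
  ∀ v₁ v₂ : Fin 4 → ℝ, (∀ a b : ℝ, a ≠ 0 ∨ b ≠ 0 → a • v₁ + b • v₂ ∈ C) →
    ∀ p : C(I, X), (∀ t, ∃ a b : ℝ, a • v₁ + b • v₂ ∈ C ∧ p t = Φ.toFun (a • v₁ + b • v₂)) →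
      p 0 = p 1 → c.val p = 0

variable {Φ}

theorem KillsLines.val_eq {c : PathCocycle X} (hc : Φ.KillsLines c) {v₁ v₂ : Fin 4 → ℝ}
    (h : ∀ a b : ℝ, a ≠ 0 ∨ b ≠ 0 → a • v₁ + b • v₂ ∈ C) {p q : C(I, X)} {a b a' b' : I → ℝ}
    (hp : ∀ t, (a t ≠ 0 ∨ b t ≠ 0) ∧ p t = Φ.toFun (a t • v₁ + b t • v₂))
    (hq : ∀ t, (a' t ≠ 0 ∨ b' t ≠ 0) ∧ q t = Φ.toFun (a' t • v₁ + b' t • v₂))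
    (h0 : p 0 = q 0) (h1 : p 1 = q 1) : c.val p = c.val q :=
  c.val_eq_of_loops (L := {x | ∃ a b : ℝ, a • v₁ + b • v₂ ∈ C ∧ x = Φ.toFun (a • v₁ + b • v₂)})
    (hc v₁ v₂ h) (fun t => ⟨a t, b t, h _ _ (hp t).1, (hp t).2⟩)
    (fun t => ⟨a' t, b' t, h _ _ (hq t).1, (hq t).2⟩) h0 h1

variable (Φ) in
/-- The path in `X` given by a path of homogeneous coordinates. -/
def path {γ : I → Fin 4 → ℝ} (hγ : Continuous γ) (hC : ∀ t, γ t ∈ C) : C(I, X) :=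
  ⟨fun t => Φ.toFun (γ t), Φ.continuousOn.comp_continuous hγ hC⟩

theorem joinedIn_image {D : Set (ℝ × ℝ)} (hD : IsPathConnected D) {φ : ℝ × ℝ → Fin 4 → ℝ}
    (hφ : ContinuousOn φ D) (hφC : ∀ e ∈ D, φ e ∈ C) {W : Set X}
    (hW : ∀ e ∈ D, Φ.toFun (φ e) ∈ W) {d e : ℝ × ℝ} (hd : d ∈ D) (he : e ∈ D) :
    JoinedIn W (Φ.toFun (φ d)) (Φ.toFun (φ e)) := by
  have h := (hD.image' (f := fun e => Φ.toFun (φ e)) (Φ.continuousOn.comp hφ hφC)).joinedIn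
    _ ⟨d, hd, rfl⟩ _ ⟨e, he, rfl⟩
  exact h.mono (by rintro _ ⟨e, he, rfl⟩; exact hW e he)

end ConeMap

end Cones

/-! ### The split normal form: the main chart -/

section MainChart

open scoped unitInterval

/-- The zeros of `f` off the first coordinate axis. For the equation `f` of a cubic surface this is
the cone over the complement of the point `(1 : 0 : 0 : 0)`. -/
def puncturedCone (f : (Fin 4 → ℝ) → ℝ) : Set (Fin 4 → ℝ) :=
  {v | f v = 0 ∧ (v 1 ≠ 0 ∨ v 2 ≠ 0 ∨ v 3 ≠ 0)}

section Split

/-- The normal form of a cubic with a node at `(1 : 0 : 0 : 0)` on which a real line passes through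
the node, namely the line `y = z = 0`, in coordinates `(u, x, y, z)`. The lines through the node
correspond to the zeros of `quintic a` on the conic `(s² : s : 1)`, the line `y = z = 0` being the
one at `s = ∞`. -/
def splitCubic (a : Fin 6 → ℝ) (v : Fin 4 → ℝ) : ℝ :=
  v 0 * (v 1 * v 3 - v 2 ^ 2) + a 5 * v 1 ^ 2 * v 2 + a 4 * v 1 ^ 2 * v 3 + a 3 * v 1 * v 2 * v 3 +
    a 2 * v 1 * v 3 ^ 2 + a 1 * v 2 * v 3 ^ 2 + a 0 * v 3 ^ 3

/-- The first of the two quadrics `A`, `B` with `splitCubic a = z A + y B`. The plane `y = s z`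
through the line `y = z = 0` meets the cubic in this line and in the conic `A + s B = 0`. -/
def tangentA (a : Fin 6 → ℝ) (v : Fin 4 → ℝ) : ℝ :=
  v 0 * v 1 + a 4 * v 1 ^ 2 + a 3 * v 1 * v 2 + a 2 * v 1 * v 3 + a 1 * v 2 * v 3 + a 0 * v 3 ^ 2

/-- The second of the two quadrics `A`, `B` with `splitCubic a = z A + y B`. -/
def tangentB (a : Fin 6 → ℝ) (v : Fin 4 → ℝ) : ℝ := a 5 * v 1 ^ 2 - v 0 * v 2

/-- The restriction of the cubic `f₃` to the parametrized conic `(s² : s : 1)`. Its roots are the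
parameters of the planes `y = s z` in which the residual conic is degenerate. -/
def quintic (a : Fin 6 → ℝ) (s : ℝ) : ℝ :=
  a 5 * s ^ 5 + a 4 * s ^ 4 + a 3 * s ^ 3 + a 2 * s ^ 2 + a 1 * s + a 0

/-- The derivative `∂f₃/∂x` at the point `(s² : s : 1)` of the conic. -/
def quinticLin (a : Fin 6 → ℝ) (s : ℝ) : ℝ := 2 * a 5 * s ^ 3 + 2 * a 4 * s ^ 2 + a 3 * s + a 2

variable {a : Fin 6 → ℝ}

theorem continuous_quintic : Continuous (quintic a) := by unfold quintic; fun_prop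
theorem continuous_quinticLin : Continuous (quinticLin a) := by unfold quinticLin; fun_prop
theorem continuous_tangentA : Continuous (tangentA a) := by unfold tangentA; fun_prop
theorem continuous_tangentB : Continuous (tangentB a) := by unfold tangentB; fun_prop

theorem splitCubic_eq (v : Fin 4 → ℝ) :
    splitCubic a v = v 3 * tangentA a v + v 2 * tangentB a v := by
  simp only [splitCubic, tangentA, tangentB]; ring

/-- Parametrization of the residual conics in the planes `y = s z`. The first parameter is `s`; in
the plane, the second one is the line through the node that carries the point. It ranges over all
of these lines but the tangent `x = s² z` of the conic at the node, and vanishes for the line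
`y = z = 0`. -/
def mainChart (a : Fin 6 → ℝ) (e : ℝ × ℝ) : Fin 4 → ℝ :=
  ![-(quintic a e.1 * e.2 ^ 2 + quinticLin a e.1 * e.2 + (a 5 * e.1 + a 4)), 1 + e.1 ^ 2 * e.2,
    e.1 * e.2, e.2]

/-- The open set parametrized by `mainChart`, as a union of two sets: the parameter of the plane is
read off as `y / z` on the first one and as `-A / B` on the second one. -/
def mainDomain (a : Fin 6 → ℝ) : Set (Fin 4 → ℝ) :=
  {v | v 3 ≠ 0 ∧ v 1 * v 3 - v 2 ^ 2 ≠ 0} ∪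
    {v | tangentB a v ≠ 0 ∧ v 1 * tangentB a v + v 2 * tangentA a v ≠ 0}

/-- The parameters of a point of `mainDomain`. -/
def mainInv (a : Fin 6 → ℝ) (v : Fin 4 → ℝ) : ℝ × ℝ :=
  if v 3 ≠ 0 then (v 2 / v 3, v 3 ^ 2 / (v 1 * v 3 - v 2 ^ 2)) else
    (-tangentA a v / tangentB a v, v 3 * tangentB a v / (v 1 * tangentB a v + v 2 * tangentA a v))

theorem isOpen_mainDomain : IsOpen (mainDomain a) := by
  have := continuous_tangentA (a := a)
  have := continuous_tangentB (a := a)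
  refine IsOpen.union ?_ ?_ <;>
  exact (isOpen_ne_fun (by fun_prop) continuous_const).inter
    (isOpen_ne_fun (by fun_prop) continuous_const)

theorem mainChart_mem (e : ℝ × ℝ) : mainChart a e ∈ puncturedCone (splitCubic a) := by
  obtain ⟨s, w⟩ := e
  refine ⟨?_, ?_⟩
  · simp [splitCubic, mainChart, quintic, quinticLin]; ring
  · by_cases hw : w = 0
    · left; simp [mainChart, hw]
    · right; right; simpa [mainChart] using hw

theorem continuous_mainChart : Continuous (mainChart a) := by
  have := continuous_quintic (a := a)
  have := continuous_quinticLin (a := a)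
  unfold mainChart
  refine continuous_pi fun i => ?_
  fin_cases i <;> simp <;> fun_prop

theorem mainDomain_cases {v : Fin 4 → ℝ} (hv : v ∈ puncturedCone (splitCubic a))
    (h : v ∈ mainDomain a) :
    (v 3 ≠ 0 ∧ v 1 * v 3 - v 2 ^ 2 ≠ 0) ∨
      (v 3 = 0 ∧ v 2 = 0 ∧ tangentB a v ≠ 0 ∧ v 1 ≠ 0) := by
  have e := hv.1
  rw [splitCubic_eq] at e
  by_cases h3 : v 3 = 0
  · right
    rcases h with h | ⟨h1, h2⟩
    · exact absurd h3 h.1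
    · have : v 2 = 0 := by simpa [h3, h1] using e
      refine ⟨h3, this, h1, ?_⟩
      simpa [this, h1] using h2
  · left
    refine ⟨h3, ?_⟩
    rcases h with h | ⟨h1, h2⟩
    · exact h.2
    · have : (v 1 * tangentB a v + v 2 * tangentA a v) * v 3 =
        tangentB a v * (v 1 * v 3 - v 2 ^ 2) := by linear_combination v 2 * e
      intro h0
      rw [h0, mul_zero] at this
      exact (mul_ne_zero h2 h3) this

theorem mainInv_eq_of_tangentB {v : Fin 4 → ℝ} (hv : v ∈ puncturedCone (splitCubic a))
    (hB : tangentB a v ≠ 0) (h : v 1 * tangentB a v + v 2 * tangentA a v ≠ 0) :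
    mainInv a v = (-tangentA a v / tangentB a v,
      v 3 * tangentB a v / (v 1 * tangentB a v + v 2 * tangentA a v)) := by
  have e := hv.1
  rw [splitCubic_eq] at e
  unfold mainInv
  split_ifs with h3
  · have key : (v 1 * tangentB a v + v 2 * tangentA a v) * v 3 =
        tangentB a v * (v 1 * v 3 - v 2 ^ 2) := by linear_combination v 2 * e
    have h0 : v 1 * v 3 - v 2 ^ 2 ≠ 0 := by
      intro h0
      rw [h0, mul_zero] at key
      exact (mul_ne_zero h h3) key
    refine Prod.ext ?_ ?_
    · rw [div_eq_div_iff h3 hB]; linear_combination e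
    · rw [div_eq_div_iff h0 h]; linear_combination v 3 * key
  · rfl

theorem continuousOn_mainInv :
    ContinuousOn (mainInv a) (puncturedCone (splitCubic a) ∩ mainDomain a) := by
  have hA := continuous_tangentA (a := a)
  have hB := continuous_tangentB (a := a)
  rintro v ⟨hv, hd⟩
  rcases hd with ⟨h3, h0⟩ | ⟨h1, h0⟩
  · have : ContinuousAt (fun v : Fin 4 → ℝ => (v 2 / v 3, v 3 ^ 2 / (v 1 * v 3 - v 2 ^ 2))) v := by
      fun_prop (disch := assumption)
    refine (this.congr ?_).continuousWithinAt
    filter_upwards [(isOpen_ne_fun (f := fun v : Fin 4 → ℝ => v 3) (by fun_prop)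
      continuous_const).mem_nhds h3] with w hw
    exact (if_pos hw).symm
  · have : ContinuousAt (fun v : Fin 4 → ℝ => (-tangentA a v / tangentB a v,
        v 3 * tangentB a v / (v 1 * tangentB a v + v 2 * tangentA a v))) v := by
      fun_prop (disch := assumption)
    refine this.continuousWithinAt.congr_of_eventuallyEq ?_ (mainInv_eq_of_tangentB hv h1 h0)
    filter_upwards [self_mem_nhdsWithin, nhdsWithin_le_nhds
      ((isOpen_ne_fun hB continuous_const).mem_nhds h1), nhdsWithin_le_nhds
      ((isOpen_ne_fun (f := fun v : Fin 4 → ℝ => v 1 * tangentB a v + v 2 * tangentA a v)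
        (by fun_prop) continuous_const).mem_nhds h0)] with w hw hw1 hw0
    exact mainInv_eq_of_tangentB hw.1 hw1 hw0

theorem mainChart_mainInv {v : Fin 4 → ℝ} (hv : v ∈ puncturedCone (splitCubic a))
    (h : v ∈ mainDomain a) : ∃ t : ℝ, t ≠ 0 ∧ mainChart a (mainInv a v) = t • v := by
  rcases mainDomain_cases hv h with ⟨h3, h0⟩ | ⟨h3, h2, hB, h1⟩
  · have e := hv.1
    have h0' : v 3 * v 1 - v 2 ^ 2 ≠ 0 := by rwa [mul_comm]
    refine ⟨v 3 / (v 1 * v 3 - v 2 ^ 2), div_ne_zero h3 h0, ?_⟩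
    have : mainInv a v = (v 2 / v 3, v 3 ^ 2 / (v 1 * v 3 - v 2 ^ 2)) := if_pos h3
    rw [this]
    ext i
    fin_cases i
    · simp [mainChart, quintic, quinticLin]
      simp only [splitCubic] at e
      field_simp
      linear_combination -(v 3) ^ 2 * e
    · simp [mainChart]; field_simp; ring
    · simp [mainChart]; field_simp
    · simp [mainChart]; field_simp
  · refine ⟨(v 1)⁻¹, inv_ne_zero h1, ?_⟩
    have : mainInv a v = (-tangentA a v / tangentB a v, 0) := by
      unfold mainInv
      rw [if_neg (by simpa using h3)]
      simp [h3]
    rw [this]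
    ext i
    fin_cases i
    · simp [mainChart, tangentA, tangentB, h2, h3] at hB ⊢
      have := hB.1
      field_simp
      ring
    · simp [mainChart, h1]
    · simp [mainChart, h2]
    · simp [mainChart, h3]

theorem mainInv_smul {v : Fin 4 → ℝ} {t : ℝ} (ht : t ≠ 0) : mainInv a (t • v) = mainInv a v := by
  have hA : tangentA a (t • v) = t ^ 2 * tangentA a v := by simp [tangentA]; ring
  have hB : tangentB a (t • v) = t ^ 2 * tangentB a v := by simp [tangentB]; ring
  unfold mainInv
  rw [hA, hB]
  by_cases h3 : v 3 = 0
  · simp [h3]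
    rw [← mul_neg, mul_div_mul_left _ _ (pow_ne_zero 2 ht)]
  · simp [h3, ht]
    refine ⟨mul_div_mul_left _ _ ht, ?_⟩
    rw [show t * v 1 * (t * v 3) - (t * v 2) ^ 2 = t ^ 2 * (v 1 * v 3 - v 2 ^ 2) by ring, mul_pow,
      mul_div_mul_left _ _ (pow_ne_zero 2 ht)]

variable {X : Type} [TopologicalSpace X] (Φ : ConeMap (puncturedCone (splitCubic a)) X)
  (c : PathCocycle X)

/-- The image in `X` of a part of the cone. -/
def ConeMap.region {C : Set (Fin 4 → ℝ)} (Φ : ConeMap C X) (U : Set (Fin 4 → ℝ)) : Set X :=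
  Φ.toFun '' (C ∩ U)

theorem ConeMap.region_inter {C : Set (Fin 4 → ℝ)} (Φ : ConeMap C X) {U V : Set (Fin 4 → ℝ)}
    (hV : ∀ v ∈ C ∩ V, ∀ t : ℝ, t ≠ 0 → t • v ∈ V) :
    Φ.region U ∩ Φ.region V = Φ.region (U ∩ V) := by
  apply Set.Subset.antisymm
  · rintro _ ⟨⟨v, ⟨hv, hvU⟩, rfl⟩, w, ⟨hw, hwV⟩, e⟩
    obtain ⟨t, ht, rfl⟩ := (Φ.eq_iff w hw v hv).1 e
    exact ⟨_, ⟨hv, hvU, hV w ⟨hw, hwV⟩ t ht⟩, rfl⟩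
  · rintro _ ⟨v, ⟨hv, hvU, hvV⟩, rfl⟩
    exact ⟨⟨v, ⟨hv, hvU⟩, rfl⟩, v, ⟨hv, hvV⟩, rfl⟩

theorem ConeMap.toFun_mainChart_mainInv {v : Fin 4 → ℝ} (hv : v ∈ puncturedCone (splitCubic a))
    (h : v ∈ mainDomain a) : Φ.toFun (mainChart a (mainInv a v)) = Φ.toFun v := by
  obtain ⟨t, ht, e⟩ := mainChart_mainInv hv h
  exact ((Φ.eq_iff v hv _ (mainChart_mem _)).2 ⟨t, ht, e⟩).symm

theorem mainChart_mem_mainDomain (ha : a 5 ≠ 0) (e : ℝ × ℝ) : mainChart a e ∈ mainDomain a := by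
  obtain ⟨s, w⟩ := e
  by_cases hw : w = 0
  · right
    simp [mainChart, hw, tangentB, ha]
  · left
    refine ⟨by simpa [mainChart] using hw, ?_⟩
    have : (1 + s ^ 2 * w) * w - (s * w) ^ 2 = w := by ring
    simpa [mainChart, this] using hw

theorem exists_isPotentialOn_main : ∃ g, c.IsPotentialOn (Φ.region (mainDomain a)) g :=
  Φ.exists_isPotentialOn_image c isOpen_mainDomain (E := Set.univ) (convex_univ.starConvex trivial)
    trivial continuous_mainChart.continuousOn (fun e _ => mainChart_mem e) continuousOn_mainInv
    (fun _ _ => trivial) (fun _ _ _ ht _ => mainInv_smul ht) fun _ hv => mainChart_mainInv hv.1 hv.2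

end Split

end MainChart

/-! ### The split normal form: degenerate residual conics -/

section Strips

open scoped unitInterval

/-- The inverse function theorem at a simple zero. -/
theorem exists_local_inverse {P : ℝ → ℝ} {r d : ℝ} (hr : P r = 0) (hd : HasStrictDerivAt P d r)
    (hd0 : d ≠ 0) : ∃ (V : Set ℝ) (h : ℝ → ℝ) (δ : ℝ), 0 < δ ∧ IsOpen V ∧ r ∈ V ∧ h 0 = r ∧
      ContinuousOn h (Set.Ioo (-δ) δ) ∧ (∀ s ∈ V, P s ∈ Set.Ioo (-δ) δ ∧ h (P s) = s) ∧
      ∀ j ∈ Set.Ioo (-δ) δ, h j ∈ V ∧ P (h j) = j := by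
  have hf := hd.hasStrictFDerivAt_equiv hd0
  let e := hf.toOpenPartialHomeomorph P
  have he : ∀ s, e s = P s := fun s => rfl
  have hrs : r ∈ e.source := hf.mem_toOpenPartialHomeomorph_source
  have h0 : (0 : ℝ) ∈ e.target := hr ▸ hf.image_mem_toOpenPartialHomeomorph_target
  obtain ⟨δ, hδ, hball⟩ := Metric.isOpen_iff.1 e.open_target 0 h0
  rw [Real.ball_eq_Ioo, zero_sub, zero_add] at hball
  refine ⟨e.source ∩ e ⁻¹' Set.Ioo (-δ) δ, e.symm, δ, hδ,
    e.isOpen_inter_preimage isOpen_Ioo, ⟨hrs, ?_⟩, ?_, e.continuousOn_symm.mono hball, ?_, ?_⟩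
  · change P r ∈ Set.Ioo (-δ) δ
    rw [hr]
    exact ⟨by linarith, hδ⟩
  · have := e.left_inv hrs
    rwa [he, hr] at this
  · exact fun s hs => ⟨hs.2, e.left_inv hs.1⟩
  · intro j hj
    have hr := e.right_inv (hball hj)
    refine ⟨⟨e.map_target (hball hj), ?_⟩, hr⟩
    change e (e.symm j) ∈ Set.Ioo (-δ) δ
    rwa [hr]

variable {a : Fin 6 → ℝ}

/-- The points in the planes `y = s z` with `s ∈ V`. -/
def stripDomain (V : Set ℝ) : Set (Fin 4 → ℝ) := {v | v 3 ≠ 0 ∧ v 2 / v 3 ∈ V}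

theorem isOpen_stripDomain {V : Set ℝ} (hV : IsOpen V) : IsOpen (stripDomain V) := by
  have h : ContinuousOn (fun v : Fin 4 → ℝ => v 2 / v 3) {v | v 3 ≠ 0} :=
    ContinuousOn.div (by fun_prop) (by fun_prop) fun v hv => hv
  exact h.isOpen_inter_preimage (isOpen_ne_fun (by fun_prop) continuous_const) hV

theorem smul_mem_stripDomain {V : Set ℝ} {v : Fin 4 → ℝ} (hv : v ∈ stripDomain V) {t : ℝ}
    (ht : t ≠ 0) : t • v ∈ stripDomain V := by
  refine ⟨mul_ne_zero ht hv.1, ?_⟩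
  have : (t • v) 2 / (t • v) 3 = v 2 / v 3 := by
    simp only [Pi.smul_apply, smul_eq_mul]
    exact mul_div_mul_left _ _ ht
  rw [this]
  exact hv.2

/-- Parametrization of the points in the planes `y = s z` with `s` near a root of the quintic. In
affine coordinates `z = 1` put `w = x - s²`; the equation of the cubic then has the form
`u' w = -P(s)` with the quintic `P` and a coordinate `u'` in place of `u`. The parameters are `u'`
and `w`, and `h` is the local inverse of `P`. -/
def stripChart (a : Fin 6 → ℝ) (h : ℝ → ℝ) (e : ℝ × ℝ) : Fin 4 → ℝ :=
  ![e.1 - quinticLin a (h (-(e.1 * e.2))) - e.2 * (a 5 * h (-(e.1 * e.2)) + a 4),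
    h (-(e.1 * e.2)) ^ 2 + e.2, h (-(e.1 * e.2)), 1]

/-- The parameters `u'`, `w` of a point outside the plane `z = 0`. -/
def stripInv (a : Fin 6 → ℝ) (v : Fin 4 → ℝ) : ℝ × ℝ :=
  (v 0 / v 3 + quinticLin a (v 2 / v 3) +
    (v 1 / v 3 - (v 2 / v 3) ^ 2) * (a 5 * (v 2 / v 3) + a 4), v 1 / v 3 - (v 2 / v 3) ^ 2)

theorem stripInv_mul {v : Fin 4 → ℝ} (hv : v ∈ puncturedCone (splitCubic a)) (h3 : v 3 ≠ 0) :
    -((stripInv a v).1 * (stripInv a v).2) = quintic a (v 2 / v 3) := by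
  have e := hv.1
  simp only [splitCubic] at e
  simp only [stripInv, quintic, quinticLin]
  field_simp
  linear_combination -(v 3) ^ 2 * e

theorem continuousOn_stripInv (V : Set ℝ) :
    ContinuousOn (stripInv a) (puncturedCone (splitCubic a) ∩ stripDomain V) := by
  have hL := continuous_quinticLin (a := a)
  rintro v ⟨-, h3, -⟩
  apply ContinuousAt.continuousWithinAt
  unfold stripInv
  have h2 : ContinuousAt (fun v : Fin 4 → ℝ => v 2 / v 3) v := by fun_prop (disch := assumption)
  have h1 : ContinuousAt (fun v : Fin 4 → ℝ => v 1 / v 3) v := by fun_prop (disch := assumption)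
  have h0 : ContinuousAt (fun v : Fin 4 → ℝ => v 0 / v 3) v := by fun_prop (disch := assumption)
  have hl : ContinuousAt (fun v : Fin 4 → ℝ => quinticLin a (v 2 / v 3)) v :=
    hL.continuousAt.comp h2
  fun_prop

theorem starConvex_hyperbola (δ : ℝ) :
    StarConvex ℝ 0 {e : ℝ × ℝ | -(e.1 * e.2) ∈ Set.Ioo (-δ) δ} := by
  rw [starConvex_zero_iff]
  rintro ⟨x, y⟩ ⟨h1, h2⟩ t ht0 ht1
  simp only [Set.mem_ofPred_eq, Prod.smul_mk, smul_eq_mul, Set.mem_Ioo] at *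
  have hδ : 0 < δ := by linarith
  have ht : t * t ≤ 1 := by nlinarith
  have ht' : 0 ≤ t * t := mul_self_nonneg t
  constructor <;> nlinarith [mul_nonneg ht' hδ.le]

variable {X : Type} [TopologicalSpace X] (Φ : ConeMap (puncturedCone (splitCubic a)) X)
  {c : PathCocycle X}

/-- Near a simple root `r` of the quintic, the planes `y = s z` carry a potential that extends a
given one on `mainDomain`. The two regions meet in two components, `w > 0` and `w < 0`, which are
connected by the line of the surface in the plane `y = r z` that avoids the node. -/
theorem exists_isPotentialOn_strip (ha : a 5 ≠ 0) (hc : Φ.KillsLines c) {g : X → ZMod 2}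
    (hg : c.IsPotentialOn (Φ.region (mainDomain a)) g) {r d : ℝ} (hr : quintic a r = 0)
    (hd : HasStrictDerivAt (quintic a) d r) (hd0 : d ≠ 0) :
    ∃ V : Set ℝ, IsOpen V ∧ r ∈ V ∧ (∀ s ∈ V, quintic a s = 0 → s = r) ∧
      ∃ g', c.IsPotentialOn (Φ.region (stripDomain V)) g' ∧
        Set.EqOn g' g (Φ.region (mainDomain a) ∩ Φ.region (stripDomain V)) := by
  obtain ⟨V, h, δ, hδ, hVo, hrV, hh0, hhc, hVh, hhV⟩ := exists_local_inverse hr hd hd0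
  refine ⟨V, hVo, hrV, ?_, ?_⟩
  · intro s hs hs0
    have := (hVh s hs).2
    rwa [hs0, hh0, eq_comm] at this
  have hE : ∀ e : ℝ × ℝ, -(e.1 * e.2) ∈ Set.Ioo (-δ) δ →
      stripChart a h e ∈ puncturedCone (splitCubic a) ∩ stripDomain V := by
    intro e he
    obtain ⟨h1, h2⟩ := hhV _ he
    refine ⟨⟨?_, ?_⟩, ?_, ?_⟩
    · have : splitCubic a (stripChart a h e) = e.1 * e.2 + quintic a (h (-(e.1 * e.2))) := by
        simp [splitCubic, stripChart, quintic, quinticLin]; ring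
      rw [this, h2]
      ring
    · right; right; simp [stripChart]
    · simp [stripChart]
    · simpa [stripChart] using h1
  obtain ⟨g', hg'⟩ := Φ.exists_isPotentialOn_image c (isOpen_stripDomain hVo)
    (starConvex_hyperbola δ) (by simpa using hδ) (φ := stripChart a h) (by
      have hcomp : ContinuousOn (fun e : ℝ × ℝ => h (-(e.1 * e.2)))
          {e : ℝ × ℝ | -(e.1 * e.2) ∈ Set.Ioo (-δ) δ} :=
        hhc.comp (by fun_prop) fun e he => he
      have hL := (continuous_quinticLin (a := a)).comp_continuousOn hcomp
      simp only [Function.comp_def] at hL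
      unfold stripChart
      refine continuousOn_pi.2 fun i => ?_
      fin_cases i
      · exact (continuousOn_fst.sub hL).sub
          (continuousOn_snd.mul ((continuousOn_const.mul hcomp).add continuousOn_const))
      · exact (hcomp.pow 2).add continuousOn_snd
      · exact hcomp
      · exact continuousOn_const) (fun e he => (hE e he).1) (ψ := stripInv a)
    (continuousOn_stripInv V) (fun v hv => by
      change -((stripInv a v).1 * (stripInv a v).2) ∈ Set.Ioo (-δ) δ
      rw [stripInv_mul hv.1 hv.2.1]
      exact (hVh _ hv.2.2).1) (fun v hv t ht _ => by
      simp only [stripInv, Pi.smul_apply, smul_eq_mul, mul_div_mul_left _ _ ht]) (fun v hv => by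
      have h3 := hv.2.1
      refine ⟨(v 3)⁻¹, inv_ne_zero h3, ?_⟩
      have hs : h (-((stripInv a v).1 * (stripInv a v).2)) = v 2 / v 3 := by
        rw [stripInv_mul hv.1 h3]
        exact (hVh _ hv.2.2).2
      unfold stripChart
      rw [hs]
      ext i
      fin_cases i
      · simp [stripInv]; ring
      · simp [stripInv]; ring
      · simp; ring
      · simp [h3])
  have hVc : IsPathConnected V := by
    have : h '' Set.Ioo (-δ) δ = V := by
      apply Set.Subset.antisymm
      · rintro _ ⟨j, hj, rfl⟩
        exact (hhV j hj).1
      · intro s hs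
        exact ⟨quintic a s, hVh s hs⟩
    rw [← this]
    exact ((convex_Ioo _ _).isPathConnected ⟨0, by simpa using hδ⟩).image' hhc
  have hW : ∀ e : ℝ × ℝ, e.1 ∈ V → e.2 ≠ 0 → Φ.toFun (mainChart a e) ∈
      Φ.region (mainDomain a) ∩ Φ.region (stripDomain V) := by
    intro e he he2
    refine ⟨⟨_, ⟨mainChart_mem e, mainChart_mem_mainDomain ha e⟩, rfl⟩,
      _, ⟨mainChart_mem e, ?_⟩, rfl⟩
    refine ⟨by simpa [mainChart] using he2, ?_⟩
    simpa [mainChart, mul_div_cancel_right₀ _ he2] using he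
  -- the residual conic in the plane `y = r z` splits into a line through the node and this line
  let v₁ : Fin 4 → ℝ := ![-(a 5 * r + a 4), 1, 0, 0]
  let v₂ : Fin 4 → ℝ := ![-quinticLin a r, r ^ 2, r, 1]
  have hline : ∀ x y : ℝ, x ≠ 0 ∨ y ≠ 0 → x • v₁ + y • v₂ ∈ puncturedCone (splitCubic a) := by
    intro x y hxy
    constructor
    · have : splitCubic a (x • v₁ + y • v₂) = y ^ 3 * quintic a r := by
        simp [splitCubic, v₁, v₂, quintic, quinticLin]; ring
      rw [this, hr, mul_zero]
    · by_cases hy : y = 0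
      · left
        simpa [v₁, v₂, hy] using hxy
      · right; right
        simpa [v₁, v₂] using hy
  have hmain : ∀ w, mainChart a (r, w) = (1 : ℝ) • v₁ + w • v₂ := by
    intro w
    ext i
    fin_cases i <;> simp [mainChart, v₁, v₂, hr] <;> ring
  have hstrip : ∀ w, stripChart a h (0, w) = w • v₁ + (1 : ℝ) • v₂ := by
    intro w
    ext i
    fin_cases i <;> simp [stripChart, v₁, v₂, hh0] <;> ring
  let α : C(I, X) := ConeMap.path Φ (γ := fun t => mainChart a (r, 1 - 2 * t))
    (continuous_mainChart.comp (by fun_prop)) fun t => mainChart_mem _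
  let β : C(I, X) := ConeMap.path Φ (γ := fun t : I => (1 - 2 * (t : ℝ)) • v₁ + (1 : ℝ) • v₂)
    (by fun_prop) fun t => hline _ _ (Or.inr one_ne_zero)
  have hneg : Φ.toFun (mainChart a (r, -1)) = Φ.toFun ((-1 : ℝ) • v₁ + (1 : ℝ) • v₂) := by
    refine (Φ.eq_iff _ (mainChart_mem _) _ (hline _ _ (Or.inr one_ne_zero))).2
      ⟨-1, by norm_num, ?_⟩
    rw [hmain]
    module
  have hβ1 : β 1 = Φ.toFun (mainChart a (r, -1)) := by
    rw [hneg]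
    change Φ.toFun ((1 - 2 * ((1 : I) : ℝ)) • v₁ + (1 : ℝ) • v₂) = _
    norm_num
  have hα0 : α 0 = Φ.toFun (mainChart a (r, 1)) := by
    change Φ.toFun (mainChart a (r, 1 - 2 * ((0 : I) : ℝ))) = _
    norm_num
  have hα1 : α 1 = Φ.toFun (mainChart a (r, -1)) := by
    change Φ.toFun (mainChart a (r, 1 - 2 * ((1 : I) : ℝ))) = _
    norm_num
  have hβ0 : β 0 = Φ.toFun (mainChart a (r, 1)) := by
    rw [hmain]
    change Φ.toFun ((1 - 2 * ((0 : I) : ℝ)) • v₁ + (1 : ℝ) • v₂) = _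
    norm_num
  refine hg.exists_eqOn_inter hg' (k := Φ.toFun (mainChart a (r, 1)))
    (k' := Φ.toFun (mainChart a (r, -1))) ?_ (α := α) (β := β) ?_ ?_ hα0 hα1 hβ0 hβ1 ?_
  · intro x hx
    have hx' : x ∈ Φ.region (mainDomain a) ∩ Φ.region (stripDomain V) := hx
    rw [Φ.region_inter fun v hv t ht => smul_mem_stripDomain hv.2 ht] at hx'
    obtain ⟨v, ⟨hv, hvm, hvs⟩, rfl⟩ := hx'
    rw [← Φ.toFun_mainChart_mainInv hv hvm]
    have hvm0 : v 1 * v 3 - v 2 ^ 2 ≠ 0 := by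
      rcases mainDomain_cases hv hvm with h | h
      · exact h.2
      · exact absurd h.1 hvs.1
    have hinv : mainInv a v = (v 2 / v 3, v 3 ^ 2 / (v 1 * v 3 - v 2 ^ 2)) := if_pos hvs.1
    have h2 : (mainInv a v).2 ≠ 0 := by
      rw [hinv]
      exact div_ne_zero (pow_ne_zero 2 hvs.1) hvm0
    have h1 : (mainInv a v).1 ∈ V := by
      rw [hinv]
      exact hvs.2
    rcases lt_or_gt_of_ne h2 with hlt | hgt
    · right
      exact ConeMap.joinedIn_image (hVc.prod ((convex_Iio (0 : ℝ)).isPathConnected ⟨-1, by simp⟩))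
        continuous_mainChart.continuousOn (fun e _ => mainChart_mem e)
        (fun e he => hW e he.1 (ne_of_lt he.2)) ⟨h1, hlt⟩ ⟨hrV, by simp⟩
    · left
      exact ConeMap.joinedIn_image (hVc.prod ((convex_Ioi (0 : ℝ)).isPathConnected ⟨1, by simp⟩))
        continuous_mainChart.continuousOn (fun e _ => mainChart_mem e)
        (fun e he => hW e he.1 (ne_of_gt he.2)) ⟨h1, hgt⟩ ⟨hrV, by simp⟩
  · exact fun t => ⟨_, ⟨mainChart_mem _, mainChart_mem_mainDomain ha _⟩, rfl⟩
  · intro t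
    refine ⟨_, ⟨hline _ _ (Or.inr one_ne_zero), ?_⟩, rfl⟩
    rw [← hstrip]
    exact (hE _ (by simpa using hδ)).2
  · refine hc.val_eq hline (a := fun _ => 1) (b := fun t => 1 - 2 * (t : ℝ))
      (a' := fun t => 1 - 2 * (t : ℝ)) (b' := fun _ => 1) (fun t => ⟨Or.inl one_ne_zero, ?_⟩)
      (fun t => ⟨Or.inr one_ne_zero, rfl⟩) (hα0.trans hβ0.symm) (hα1.trans hβ1.symm)
    rw [← hmain]
    rfl

end Strips

/-! ### The split normal form: gluing -/

section SplitGluing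

open scoped unitInterval

variable {a : Fin 6 → ℝ}

/-- The analogue of `mainChart` for the planes `z = t y`, which include the plane `z = 0`. -/
def tangentChart (a : Fin 6 → ℝ) (e : ℝ × ℝ) : Fin 4 → ℝ :=
  ![a 5 * e.2 ^ 2 + a 4 * e.2 ^ 2 * e.1 + a 3 * e.2 * (1 + e.2 * e.1) * e.1 +
      a 2 * e.2 * (1 + e.2 * e.1) * e.1 ^ 2 + a 1 * (1 + e.2 * e.1) ^ 2 * e.1 ^ 2 +
      a 0 * (1 + e.2 * e.1) ^ 2 * e.1 ^ 3, e.2, 1 + e.2 * e.1, e.1 * (1 + e.2 * e.1)]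

/-- The open set parametrized by `tangentChart`, as a union of two sets: the parameter of the plane
is read off as `z / y` on the first one and as `-B / A` on the second one. -/
def tangentDomain (a : Fin 6 → ℝ) : Set (Fin 4 → ℝ) :=
  {v | v 2 ≠ 0 ∧ v 2 ^ 2 - v 1 * v 3 ≠ 0} ∪
    {v | tangentA a v ≠ 0 ∧ v 2 * tangentA a v + v 1 * tangentB a v ≠ 0}

/-- The parameters of a point of `tangentDomain`. -/
def tangentInv (a : Fin 6 → ℝ) (v : Fin 4 → ℝ) : ℝ × ℝ :=
  if v 2 ≠ 0 then (v 3 / v 2, v 1 * v 2 / (v 2 ^ 2 - v 1 * v 3)) else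
    (-tangentB a v / tangentA a v, v 1 * tangentA a v / (v 2 * tangentA a v + v 1 * tangentB a v))

theorem isOpen_tangentDomain : IsOpen (tangentDomain a) := by
  have := continuous_tangentA (a := a)
  have := continuous_tangentB (a := a)
  refine IsOpen.union ?_ ?_ <;>
  exact (isOpen_ne_fun (by fun_prop) continuous_const).inter
    (isOpen_ne_fun (by fun_prop) continuous_const)

theorem tangentChart_mem (e : ℝ × ℝ) : tangentChart a e ∈ puncturedCone (splitCubic a) := by
  obtain ⟨t, x⟩ := e
  refine ⟨?_, ?_⟩
  · simp [splitCubic, tangentChart]; ring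
  · by_cases hx : x = 0
    · right; left; simp [tangentChart, hx]
    · left; simpa [tangentChart] using hx

theorem continuous_tangentChart : Continuous (tangentChart a) := by
  unfold tangentChart
  refine continuous_pi fun i => ?_
  fin_cases i <;> simp <;> fun_prop

theorem tangentDomain_cases {v : Fin 4 → ℝ} (hv : v ∈ puncturedCone (splitCubic a))
    (h : v ∈ tangentDomain a) :
    (v 2 ≠ 0 ∧ v 2 ^ 2 - v 1 * v 3 ≠ 0) ∨
      (v 2 = 0 ∧ v 3 = 0 ∧ tangentA a v ≠ 0 ∧ tangentB a v ≠ 0 ∧ v 1 ≠ 0) := by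
  have e := hv.1
  rw [splitCubic_eq] at e
  by_cases h2 : v 2 = 0
  · right
    rcases h with h | ⟨h1, h0⟩
    · exact absurd h2 h.1
    · have h3 : v 3 = 0 := by simpa [h2, h1] using e
      have := h0
      simp only [h2, zero_mul, zero_add] at this
      exact ⟨h2, h3, h1, right_ne_zero_of_mul this, left_ne_zero_of_mul this⟩
  · left
    refine ⟨h2, ?_⟩
    rcases h with h | ⟨h1, h0⟩
    · exact h.2
    · have : (v 2 * tangentA a v + v 1 * tangentB a v) * v 2 =
        tangentA a v * (v 2 ^ 2 - v 1 * v 3) := by linear_combination v 1 * e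
      intro h00
      rw [h00, mul_zero] at this
      exact (mul_ne_zero h0 h2) this

theorem tangentInv_eq_of_tangentA {v : Fin 4 → ℝ} (hv : v ∈ puncturedCone (splitCubic a))
    (hA : tangentA a v ≠ 0) (h : v 2 * tangentA a v + v 1 * tangentB a v ≠ 0) :
    tangentInv a v = (-tangentB a v / tangentA a v,
      v 1 * tangentA a v / (v 2 * tangentA a v + v 1 * tangentB a v)) := by
  have e := hv.1
  rw [splitCubic_eq] at e
  unfold tangentInv
  split_ifs with h2
  · have key : (v 2 * tangentA a v + v 1 * tangentB a v) * v 2 =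
        tangentA a v * (v 2 ^ 2 - v 1 * v 3) := by linear_combination v 1 * e
    have h0 : v 2 ^ 2 - v 1 * v 3 ≠ 0 := by
      intro h0
      rw [h0, mul_zero] at key
      exact (mul_ne_zero h h2) key
    refine Prod.ext ?_ ?_
    · rw [div_eq_div_iff h2 hA]; linear_combination e
    · rw [div_eq_div_iff h0 h]; linear_combination v 1 * key
  · rfl

theorem continuousOn_tangentInv :
    ContinuousOn (tangentInv a) (puncturedCone (splitCubic a) ∩ tangentDomain a) := by
  have hA := continuous_tangentA (a := a)
  have hB := continuous_tangentB (a := a)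
  rintro v ⟨hv, hd⟩
  rcases hd with ⟨h2, h0⟩ | ⟨h1, h0⟩
  · have : ContinuousAt
        (fun v : Fin 4 → ℝ => (v 3 / v 2, v 1 * v 2 / (v 2 ^ 2 - v 1 * v 3))) v := by
      fun_prop (disch := assumption)
    refine (this.congr ?_).continuousWithinAt
    filter_upwards [(isOpen_ne_fun (f := fun v : Fin 4 → ℝ => v 2) (by fun_prop)
      continuous_const).mem_nhds h2] with w hw
    exact (if_pos hw).symm
  · have : ContinuousAt (fun v : Fin 4 → ℝ => (-tangentB a v / tangentA a v,
        v 1 * tangentA a v / (v 2 * tangentA a v + v 1 * tangentB a v))) v := by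
      fun_prop (disch := assumption)
    refine this.continuousWithinAt.congr_of_eventuallyEq ?_ (tangentInv_eq_of_tangentA hv h1 h0)
    filter_upwards [self_mem_nhdsWithin, nhdsWithin_le_nhds
      ((isOpen_ne_fun hA continuous_const).mem_nhds h1), nhdsWithin_le_nhds
      ((isOpen_ne_fun (f := fun v : Fin 4 → ℝ => v 2 * tangentA a v + v 1 * tangentB a v)
        (by fun_prop) continuous_const).mem_nhds h0)] with w hw hw1 hw0
    exact tangentInv_eq_of_tangentA hw.1 hw1 hw0

theorem tangentChart_tangentInv {v : Fin 4 → ℝ} (hv : v ∈ puncturedCone (splitCubic a))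
    (h : v ∈ tangentDomain a) : ∃ t : ℝ, t ≠ 0 ∧ tangentChart a (tangentInv a v) = t • v := by
  rcases tangentDomain_cases hv h with ⟨h2, h0⟩ | ⟨h2, h3, hA, hB, h1⟩
  · have e := hv.1
    refine ⟨v 2 / (v 2 ^ 2 - v 1 * v 3), div_ne_zero h2 h0, ?_⟩
    have : tangentInv a v = (v 3 / v 2, v 1 * v 2 / (v 2 ^ 2 - v 1 * v 3)) := if_pos h2
    rw [this]
    have hl : 1 + v 1 * v 2 / (v 2 ^ 2 - v 1 * v 3) * (v 3 / v 2) =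
        v 2 ^ 2 / (v 2 ^ 2 - v 1 * v 3) := by
      field_simp; ring
    ext i
    fin_cases i
    · simp [tangentChart, hl]
      simp only [splitCubic] at e
      field_simp
      linear_combination e
    · simp [tangentChart]; field_simp
    · simp [tangentChart, hl]; field_simp
    · simp [tangentChart, hl]; field_simp
  · refine ⟨tangentA a v / (v 1 * tangentB a v), div_ne_zero hA (mul_ne_zero h1 hB), ?_⟩
    have hB' : tangentB a v = a 5 * v 1 ^ 2 := by simp [tangentB, h2]
    have hA' : tangentA a v = v 0 * v 1 + a 4 * v 1 ^ 2 := by simp [tangentA, h2, h3]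
    have : tangentInv a v = (-tangentB a v / tangentA a v, tangentA a v / tangentB a v) := by
      simp [tangentInv, h2, mul_div_mul_left _ _ h1]
    rw [this]
    have hl : 1 + tangentA a v / tangentB a v * (-tangentB a v / tangentA a v) = 0 := by
      field_simp; ring
    ext i
    fin_cases i
    · simp [tangentChart, hl]
      field_simp
      rw [hA', hB']
      ring
    · simp [tangentChart]; field_simp
    · simp [tangentChart, hl, h2]
    · simp [tangentChart, hl, h3]

theorem tangentInv_smul {v : Fin 4 → ℝ} {t : ℝ} (ht : t ≠ 0) :
    tangentInv a (t • v) = tangentInv a v := by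
  have hA : tangentA a (t • v) = t ^ 2 * tangentA a v := by simp [tangentA]; ring
  have hB : tangentB a (t • v) = t ^ 2 * tangentB a v := by simp [tangentB]; ring
  unfold tangentInv
  rw [hA, hB]
  by_cases h2 : v 2 = 0
  · simp [h2]
    rw [← mul_neg, mul_div_mul_left _ _ (pow_ne_zero 2 ht)]
    rw [show t * v 1 * (t ^ 2 * tangentA a v) = t ^ 3 * (v 1 * tangentA a v) by ring,
      show t * v 1 * (t ^ 2 * tangentB a v) = t ^ 3 * (v 1 * tangentB a v) by ring,
      mul_div_mul_left _ _ (pow_ne_zero 3 ht)]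
    exact ⟨rfl, rfl⟩
  · simp [h2, ht]
    refine ⟨mul_div_mul_left _ _ ht, ?_⟩
    rw [show (t * v 2) ^ 2 - t * v 1 * (t * v 3) = t ^ 2 * (v 2 ^ 2 - v 1 * v 3) by ring,
      show t * v 1 * (t * v 2) = t ^ 2 * (v 1 * v 2) by ring,
      mul_div_mul_left _ _ (pow_ne_zero 2 ht)]

variable {X : Type} [TopologicalSpace X] (Φ : ConeMap (puncturedCone (splitCubic a)) X)
  {c : PathCocycle X}

theorem exists_isPotentialOn_tangent (c : PathCocycle X) :
    ∃ g, c.IsPotentialOn (Φ.region (tangentDomain a)) g :=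
  Φ.exists_isPotentialOn_image c isOpen_tangentDomain (E := Set.univ)
    (convex_univ.starConvex trivial) trivial continuous_tangentChart.continuousOn
    (fun e _ => tangentChart_mem e) continuousOn_tangentInv
    (fun _ _ => trivial) (fun _ _ _ ht _ => tangentInv_smul ht)
    fun _ hv => tangentChart_tangentInv hv.1 hv.2

theorem smul_mem_tangentDomain {v : Fin 4 → ℝ} (hv : v ∈ tangentDomain a) {t : ℝ} (ht : t ≠ 0) :
    t • v ∈ tangentDomain a := by
  have hA : tangentA a (t • v) = t ^ 2 * tangentA a v := by simp [tangentA]; ring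
  have hB : tangentB a (t • v) = t ^ 2 * tangentB a v := by simp [tangentB]; ring
  rcases hv with ⟨h1, h2⟩ | ⟨h1, h2⟩
  · left
    refine ⟨mul_ne_zero ht h1, ?_⟩
    have : (t • v) 2 ^ 2 - (t • v) 1 * (t • v) 3 = t ^ 2 * (v 2 ^ 2 - v 1 * v 3) := by simp; ring
    rw [this]
    exact mul_ne_zero (pow_ne_zero 2 ht) h2
  · right
    refine ⟨by rw [hA]; exact mul_ne_zero (pow_ne_zero 2 ht) h1, ?_⟩
    have : (t • v) 2 * tangentA a (t • v) + (t • v) 1 * tangentB a (t • v) =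
        t ^ 3 * (v 2 * tangentA a v + v 1 * tangentB a v) := by rw [hA, hB]; simp; ring
    rw [this]
    exact mul_ne_zero (pow_ne_zero 3 ht) h2

theorem mainInv_fst_ne_zero {v : Fin 4 → ℝ} (hv : v ∈ puncturedCone (splitCubic a))
    (hm : v ∈ mainDomain a) (ht : v ∈ tangentDomain a) : (mainInv a v).1 ≠ 0 := by
  have e := hv.1
  rw [splitCubic_eq] at e
  by_cases h3 : v 3 = 0
  · have h := (mainDomain_cases hv hm).resolve_left fun h => h.1 h3
    have h' := (tangentDomain_cases hv ht).resolve_left fun h' => h'.1 h.2.1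
    simp only [mainInv, h3, ne_eq, not_true_eq_false, if_false]
    exact div_ne_zero (neg_ne_zero.2 h'.2.2.1) h.2.2.1
  · simp only [mainInv, h3, ne_eq, not_false_eq_true, if_true]
    refine div_ne_zero ?_ h3
    intro h2
    rcases tangentDomain_cases hv ht with h | h
    · exact h.1 h2
    · exact h3 h.2.1

theorem mainChart_mem_tangentDomain (ha : a 5 ≠ 0) {e : ℝ × ℝ} (he : e.1 ≠ 0) :
    mainChart a e ∈ tangentDomain a := by
  obtain ⟨s, w⟩ := e
  by_cases hw : w = 0
  · right
    have he' : s ≠ 0 := he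
    simp [mainChart, hw, tangentA, tangentB, ha, he']
  · left
    refine ⟨by simpa [mainChart] using ⟨he, hw⟩, ?_⟩
    have : (s * w) ^ 2 - (1 + s ^ 2 * w) * w = -w := by ring
    simpa [mainChart, this] using hw

/-- The derivative of the quintic. -/
def quinticDeriv (a : Fin 6 → ℝ) (s : ℝ) : ℝ :=
  5 * a 5 * s ^ 4 + 4 * a 4 * s ^ 3 + 3 * a 3 * s ^ 2 + 2 * a 2 * s + a 1

theorem hasStrictDerivAt_quintic (s : ℝ) : HasStrictDerivAt (quintic a) (quinticDeriv a s) s := by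
  have h := ((((((hasStrictDerivAt_id s).pow 5).const_mul (a 5)).add
    (((hasStrictDerivAt_id s).pow 4).const_mul (a 4))).add
    (((hasStrictDerivAt_id s).pow 3).const_mul (a 3))).add
    (((hasStrictDerivAt_id s).pow 2).const_mul (a 2))).add
    ((hasStrictDerivAt_id s).const_mul (a 1)) |>.add_const (a 0)
  refine h.congr_deriv ?_
  simp [quinticDeriv]
  ring

/-- A cocycle on the complement of the node in the split normal form is a coboundary if it vanishes
on the loops in lines. The hypotheses `h4`, …, `h0` say that the quintic is the product of
`s² - m s - n` and `a₅ s³ + b₂ s² + b₁ s + b₀`; such a factor yields the line `x = m y + n z`, a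
section of the pencil of planes through the line `y = z = 0`. -/
theorem exists_isPotentialOn_univ_of_split (ha : a 5 ≠ 0)
    (hsimple : ∀ r, quintic a r = 0 → quinticDeriv a r ≠ 0)
    {m n b₀ b₁ b₂ : ℝ} (h4 : a 4 = b₂ - m * a 5) (h3 : a 3 = b₁ - m * b₂ - n * a 5)
    (h2 : a 2 = b₀ - m * b₁ - n * b₂) (h1 : a 1 = -m * b₀ - n * b₁) (h0 : a 0 = -n * b₀)
    (hc : Φ.KillsLines c) : ∃ G, c.IsPotentialOn Set.univ G := by
  obtain ⟨g, hg⟩ := exists_isPotentialOn_main Φ c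
  have hstrip := fun r : {r // quintic a r = 0} =>
    exists_isPotentialOn_strip Φ ha hc hg r.2 (hasStrictDerivAt_quintic r.1) (hsimple _ r.2)
  choose V hVo hrV hVr hV using hstrip
  have hopen : ∀ U, IsOpen U → IsOpen (Φ.region U) := Φ.isOpen_image
  have hroot : ∀ v ∈ puncturedCone (splitCubic a), v 3 ≠ 0 → v 1 * v 3 - v 2 ^ 2 = 0 →
      quintic a (v 2 / v 3) = 0 := by
    intro v hv hv3 hv0
    rw [← stripInv_mul hv hv3]
    have : (stripInv a v).2 = 0 := by
      simp only [stripInv]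
      field_simp
      linear_combination hv0
    rw [this]
    ring
  have hst : ∀ v ∈ puncturedCone (splitCubic a), v 3 ≠ 0 → v 1 * v 3 - v 2 ^ 2 = 0 →
      Φ.toFun v ∈ Φ.region (mainDomain a) ∪ ⋃ r, Φ.region (stripDomain (V r)) := by
    intro v hv hv3 hv0
    refine Or.inr (Set.mem_iUnion.2 ⟨⟨_, hroot v hv hv3 hv0⟩, v, ⟨hv, hv3, ?_⟩, rfl⟩)
    exact hrV ⟨_, hroot v hv hv3 hv0⟩
  have hmem : ∀ v ∈ puncturedCone (splitCubic a), v 3 ≠ 0 →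
      Φ.toFun v ∈ Φ.region (mainDomain a) ∪ ⋃ r, Φ.region (stripDomain (V r)) := by
    intro v hv hv3
    by_cases hv0 : v 1 * v 3 - v 2 ^ 2 = 0
    · exact hst v hv hv3 hv0
    · exact Or.inl ⟨v, ⟨hv, Or.inl ⟨hv3, hv0⟩⟩, rfl⟩
  obtain ⟨g₁, hg₁⟩ := hg.exists_union_iUnion (S := fun r => Φ.region (stripDomain (V r)))
    (hopen _ isOpen_mainDomain) (fun r => hopen _ (isOpen_stripDomain (hVo r)))
    (fun r r' hrr' => by
      rw [Φ.region_inter fun v hv t ht => smul_mem_stripDomain hv.2 ht]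
      rintro _ ⟨v, ⟨hv, hvr, hvr'⟩, rfl⟩
      refine ⟨v, ⟨hv, Or.inl ⟨hvr.1, fun hv0 => hrr' ?_⟩⟩, rfl⟩
      have h := hroot v hv hvr.1 hv0
      exact Subtype.ext ((hVr r _ hvr.2 h).symm.trans (hVr r' _ hvr'.2 h))) hV
  obtain ⟨g₂, hg₂⟩ := exists_isPotentialOn_tangent Φ c
  have hinter : (Φ.region (mainDomain a) ∪ ⋃ r, Φ.region (stripDomain (V r))) ∩
      Φ.region (tangentDomain a) ⊆ Φ.region (mainDomain a ∩ tangentDomain a) := by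
    rintro x ⟨hx | hx, hx'⟩
    · rw [← Φ.region_inter fun v hv t ht => smul_mem_tangentDomain hv.2 ht]
      exact ⟨hx, hx'⟩
    · obtain ⟨r, hr⟩ := Set.mem_iUnion.1 hx
      have := (Φ.region_inter fun v hv t ht => smul_mem_tangentDomain (a := a) hv.2 ht).subset
        ⟨hr, hx'⟩
      obtain ⟨v, ⟨hv, hvr, hvt⟩, rfl⟩ := this
      refine ⟨v, ⟨hv, Or.inl ⟨hvr.1, ?_⟩, hvt⟩, rfl⟩
      rcases tangentDomain_cases hv hvt with h | h
      · intro h0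
        exact h.2 (by linear_combination -h0)
      · exact absurd h.2.1 hvr.1
  have hchart : ∀ e : ℝ × ℝ, e.1 ≠ 0 → Φ.toFun (mainChart a e) ∈
      (Φ.region (mainDomain a) ∪ ⋃ r, Φ.region (stripDomain (V r))) ∩ Φ.region (tangentDomain a) :=
    fun e he => ⟨Or.inl ⟨_, ⟨mainChart_mem e, mainChart_mem_mainDomain ha e⟩, rfl⟩,
      _, ⟨mainChart_mem e, mainChart_mem_tangentDomain ha he⟩, rfl⟩
  -- a line that meets each plane of the pencil once; it connects the two components, `s > 0` and
  -- `s < 0`, of the intersection of the tangent chart with the remaining ones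
  let v₁ : Fin 4 → ℝ := ![b₁ - a 3 - n * a 5 - m * a 4, m, 1, 0]
  let v₂ : Fin 4 → ℝ := ![b₀ - a 2 - n * a 4, n, 0, 1]
  have hline : ∀ x y : ℝ, x ≠ 0 ∨ y ≠ 0 → x • v₁ + y • v₂ ∈ puncturedCone (splitCubic a) := by
    intro x y hxy
    constructor
    · simp [splitCubic, v₁, v₂, h4, h3, h2, h1, h0]; ring
    · right
      simpa [v₁, v₂] using hxy
  -- for parameters `|s| ≥ M` the section line runs both in the main and in the tangent chart
  set M : ℝ := 1 + |m| + |n| with hM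
  have hM1 : 1 ≤ M := by have := abs_nonneg m; have := abs_nonneg n; linarith
  have hM0 : M ≠ 0 := by linarith
  have hsmall : ∀ t : ℝ, |t| ≤ 1 / M → 1 - (m + n * t) * t ≠ 0 := by
    intro t ht
    have h1' : |t| * M ≤ 1 := by rwa [le_div_iff₀ (by linarith)] at ht
    have ht1 : |t| ≤ 1 := by nlinarith [abs_nonneg t]
    have h2' : |(m + n * t) * t| < 1 := by
      by_cases ht0 : t = 0
      · simp [ht0]
      have ht0' : 0 < |t| := abs_pos.2 ht0
      calc |(m + n * t) * t| = |m + n * t| * |t| := abs_mul _ _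
        _ ≤ (|m| + |n| * |t|) * |t| := by
          gcongr
          exact (abs_add_le _ _).trans (by rw [abs_mul])
        _ ≤ (|m| + |n|) * |t| := by
          gcongr
          nlinarith [abs_nonneg n]
        _ < 1 := by rw [hM] at h1'; nlinarith
    intro h0'
    have : (m + n * t) * t = 1 := by linarith
    rw [this] at h2'
    simp at h2'
  let α : C(I, X) := ConeMap.path Φ (γ := fun t : I => (M * (1 - 2 * (t : ℝ))) • v₁ + (1 : ℝ) • v₂)
    (by fun_prop) fun t => hline _ _ (Or.inr one_ne_zero)
  let β : C(I, X) := ConeMap.path Φ (γ := fun t : I => (1 : ℝ) • v₁ + ((1 - 2 * (t : ℝ)) / M) • v₂)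
    (by fun_prop) fun t => hline _ _ (Or.inl one_ne_zero)
  have hα0 : α 0 = Φ.toFun (M • v₁ + (1 : ℝ) • v₂) := by
    change Φ.toFun ((M * (1 - 2 * ((0 : I) : ℝ))) • v₁ + (1 : ℝ) • v₂) = _
    norm_num
  have hα1 : α 1 = Φ.toFun ((-M) • v₁ + (1 : ℝ) • v₂) := by
    change Φ.toFun ((M * (1 - 2 * ((1 : I) : ℝ))) • v₁ + (1 : ℝ) • v₂) = _
    congr 3
    norm_num
  have hβ0 : β 0 = Φ.toFun (M • v₁ + (1 : ℝ) • v₂) := by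
    refine (Φ.eq_iff _ (hline _ _ (Or.inl one_ne_zero)) _ (hline _ _ (Or.inr one_ne_zero))).2
      ⟨M, hM0, ?_⟩
    rw [smul_add, smul_smul, smul_smul]
    congr 2
    · simp
    · simp; field_simp
  have hβ1 : β 1 = Φ.toFun ((-M) • v₁ + (1 : ℝ) • v₂) := by
    refine (Φ.eq_iff _ (hline _ _ (Or.inl one_ne_zero)) _ (hline _ _ (Or.inr one_ne_zero))).2
      ⟨-M, neg_ne_zero.2 hM0, ?_⟩
    rw [smul_add, smul_smul, smul_smul]
    congr 2
    · simp
    · simp; field_simp; norm_num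
  have hαβ : c.val α = c.val β :=
    hc.val_eq hline (fun t => ⟨Or.inr one_ne_zero, rfl⟩) (fun t => ⟨Or.inl one_ne_zero, rfl⟩)
      (hα0.trans hβ0.symm) (hα1.trans hβ1.symm)
  have hαmem : ∀ t, α t ∈ Φ.region (mainDomain a) ∪ ⋃ r, Φ.region (stripDomain (V r)) :=
    fun t => hmem _ (hline _ _ (Or.inr one_ne_zero)) (by simp [v₁, v₂])
  have hβmem : ∀ t, β t ∈ Φ.region (tangentDomain a) := by
    intro t
    refine ⟨_, ⟨hline _ _ (Or.inl one_ne_zero), Or.inl ⟨by simp [v₁, v₂], ?_⟩⟩, rfl⟩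
    have := hsmall ((1 - 2 * (t : ℝ)) / M) (by
      rw [abs_div, abs_of_pos (show 0 < M by linarith)]
      gcongr
      rw [abs_le]
      constructor <;> linarith [t.2.1, t.2.2])
    simp [v₁, v₂]
    intro h
    exact this (by linear_combination h)
  -- the ends of these paths in the main chart
  have hend : ∀ s : ℝ, s = M ∨ s = -M → ∃ w, Φ.toFun (mainChart a (s, w)) =
      Φ.toFun (s • v₁ + (1 : ℝ) • v₂) := by
    intro s hs
    have hv := hline s 1 (Or.inr one_ne_zero)
    have hd : s • v₁ + (1 : ℝ) • v₂ ∈ mainDomain a := by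
      left
      refine ⟨by simp [v₁, v₂], ?_⟩
      have hs0 : s ≠ 0 := by
        rcases hs with h | h <;> rw [h] <;> [exact hM0; exact neg_ne_zero.2 hM0]
      have := hsmall (1 / s) (by
        rcases hs with h | h <;> rw [h]
        · rw [abs_of_pos (by positivity)]
        · rw [one_div_neg_eq_neg_one_div, abs_neg, abs_of_pos (by positivity)])
      simp [v₁, v₂]
      intro h
      apply this
      field_simp
      linear_combination -h
    refine ⟨(mainInv a (s • v₁ + (1 : ℝ) • v₂)).2, ?_⟩
    rw [← Φ.toFun_mainChart_mainInv hv hd]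
    congr 2
    refine Prod.ext ?_ rfl
    simp [mainInv, v₁, v₂]
  obtain ⟨w, hw⟩ := hend M (Or.inl rfl)
  obtain ⟨w', hw'⟩ := hend (-M) (Or.inr rfl)
  obtain ⟨g₃, hg₃, heq⟩ := hg₁.exists_eqOn_inter hg₂ (fun x hx => by
    obtain ⟨v, ⟨hv, hvm, hvt⟩, rfl⟩ := hinter hx
    rw [← Φ.toFun_mainChart_mainInv hv hvm]
    rcases lt_or_gt_of_ne (mainInv_fst_ne_zero hv hvm hvt) with hlt | hgt
    · right
      rw [← hw']
      exact ConeMap.joinedIn_image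
        (((convex_Iio (0 : ℝ)).isPathConnected ⟨-1, by simp⟩).prod isPathConnected_univ)
        continuous_mainChart.continuousOn (fun e _ => mainChart_mem e)
        (fun e he => hchart e (ne_of_lt he.1)) ⟨hlt, trivial⟩
        ⟨by simp only [Set.mem_Iio]; linarith, trivial⟩
    · left
      rw [← hw]
      exact ConeMap.joinedIn_image
        (((convex_Ioi (0 : ℝ)).isPathConnected ⟨1, by simp⟩).prod isPathConnected_univ)
        continuous_mainChart.continuousOn (fun e _ => mainChart_mem e)
        (fun e he => hchart e (ne_of_gt he.1)) ⟨hgt, trivial⟩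
        ⟨by simp only [Set.mem_Ioi]; linarith, trivial⟩) hαmem hβmem hα0 hα1 hβ0 hβ1 hαβ
  obtain ⟨G, hG⟩ := hg₁.exists_union ((hopen _ isOpen_mainDomain).union
    (isOpen_iUnion fun r => hopen _ (isOpen_stripDomain (hVo r)))) (hopen _ isOpen_tangentDomain)
    hg₃ heq
  refine ⟨G, hG.mono fun x _ => ?_⟩
  obtain ⟨v, hv, rfl⟩ := Φ.surjective x
  by_cases hv3 : v 3 = 0
  · by_cases hv2 : v 2 = 0
    · have hv1 : v 1 ≠ 0 := by simpa [hv2, hv3] using hv.2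
      refine Or.inl (Or.inl ⟨v, ⟨hv, Or.inr ?_⟩, rfl⟩)
      simp [tangentB, hv2, ha, hv1]
    · exact Or.inr ⟨v, ⟨hv, Or.inl ⟨hv2, by simpa [hv3] using hv2⟩⟩, rfl⟩
  · exact Or.inl (hmem v hv hv3)

end SplitGluing

/-! ### The pointless normal form -/

section Pointless

open scoped unitInterval

/-- The quadratic form `x² + y² + τ z²`, in coordinates `(u, x, y, z)`. -/
def coneForm (τ : ℝ) (v : Fin 4 → ℝ) : ℝ := v 1 ^ 2 + v 2 ^ 2 + τ * v 3 ^ 2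

/-- A ternary cubic form divisible by `z`, in coordinates `(u, x, y, z)`. -/
def baseForm (b : Fin 6 → ℝ) (v : Fin 4 → ℝ) : ℝ :=
  v 3 * (b 0 * v 1 ^ 2 + b 1 * v 2 ^ 2 + b 2 * v 3 ^ 2 + b 3 * v 1 * v 2 + b 4 * v 1 * v 3 +
    b 5 * v 2 * v 3)

/-- The normal form of a cubic with a node at `(1 : 0 : 0 : 0)` such that no real line of the cubic
passes through the node. The plane `z = 0` meets it in the real line `u = 0` and in two conjugate
lines through the node. -/
def pointlessCubic (τ : ℝ) (b : Fin 6 → ℝ) (v : Fin 4 → ℝ) : ℝ :=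
  v 0 * coneForm τ v + baseForm b v

variable {τ : ℝ} {b : Fin 6 → ℝ}

theorem pointlessCubic_eq (v : Fin 4 → ℝ) :
    pointlessCubic τ b v = v 0 * coneForm τ v + baseForm b v := rfl

theorem continuous_coneForm : Continuous (coneForm τ) := by unfold coneForm; fun_prop
theorem continuous_baseForm : Continuous (baseForm b) := by unfold baseForm; fun_prop

/-- The point of the cubic, other than the node, on the line that joins the node to `v`. Projection
from the node thus identifies the complement of the node with the part of the projective plane where
`coneForm τ` does not vanish. -/
def liftPoint (τ : ℝ) (b : Fin 6 → ℝ) (v : Fin 4 → ℝ) : Fin 4 → ℝ :=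
  ![-baseForm b v / coneForm τ v, v 1, v 2, v 3]

theorem liftPoint_mem {v : Fin 4 → ℝ} (h : coneForm τ v ≠ 0)
    (hv : v 1 ≠ 0 ∨ v 2 ≠ 0 ∨ v 3 ≠ 0) : liftPoint τ b v ∈ puncturedCone (pointlessCubic τ b) := by
  refine ⟨?_, by simpa [liftPoint] using hv⟩
  have : pointlessCubic τ b (liftPoint τ b v) =
      -baseForm b v / coneForm τ v * coneForm τ v + baseForm b v := by
    simp [pointlessCubic, liftPoint, coneForm, baseForm]
  rw [this, div_mul_cancel₀ _ h, neg_add_cancel]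

theorem liftPoint_eq_smul {v w : Fin 4 → ℝ} {t : ℝ} (ht : t ≠ 0) (h : coneForm τ v ≠ 0)
    (hv : v ∈ puncturedCone (pointlessCubic τ b)) (h1 : w 1 = t * v 1) (h2 : w 2 = t * v 2)
    (h3 : w 3 = t * v 3) : liftPoint τ b w = t • v := by
  have hb : baseForm b w = t ^ 3 * baseForm b v := by simp [baseForm, h1, h2, h3]; ring
  have hc : coneForm τ w = t ^ 2 * coneForm τ v := by simp [coneForm, h1, h2, h3]; ring
  have e := hv.1
  rw [pointlessCubic_eq] at e
  ext i
  fin_cases i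
  · simp [liftPoint, hb, hc]
    rw [div_eq_iff (mul_ne_zero (pow_ne_zero 2 ht) h)]
    linear_combination -t ^ 3 * e
  · simpa [liftPoint] using h1
  · simpa [liftPoint] using h2
  · simpa [liftPoint] using h3

/-- The part of the affine chart `v i ≠ 0` where `coneForm τ` has the sign of `ε`. -/
def affineDomain (τ ε : ℝ) (i : Fin 4) : Set (Fin 4 → ℝ) := {v | v i ≠ 0 ∧ 0 < ε * coneForm τ v}

theorem coneForm_smul (t : ℝ) (v : Fin 4 → ℝ) : coneForm τ (t • v) = t ^ 2 * coneForm τ v := by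
  simp [coneForm]; ring

theorem smul_mem_affineDomain {ε : ℝ} {i : Fin 4} {v : Fin 4 → ℝ} (hv : v ∈ affineDomain τ ε i)
    {t : ℝ} (ht : t ≠ 0) : t • v ∈ affineDomain τ ε i := by
  refine ⟨mul_ne_zero ht hv.1, ?_⟩
  rw [coneForm_smul, mul_left_comm]
  exact mul_pos (by positivity) hv.2

theorem isOpen_affineDomain {ε : ℝ} {i : Fin 4} : IsOpen (affineDomain τ ε i) := by
  have := continuous_coneForm (τ := τ)
  exact (isOpen_ne_fun (by fun_prop) continuous_const).inter
    (isOpen_lt continuous_const (continuous_const.mul this))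

variable {X : Type} [TopologicalSpace X] (Φ : ConeMap (puncturedCone (pointlessCubic τ b)) X)
  {c : PathCocycle X}

/-- In an affine chart, a region cut out by the sign of a diagonal quadratic form is star-shaped
with respect to the origin, once it contains it. The map `w` sends affine coordinates to
homogeneous ones. -/
theorem exists_isPotentialOn_affine (c : PathCocycle X) {ε : ℝ} {i j k : Fin 4}
    {w : ℝ × ℝ → Fin 4 → ℝ} (hw : Continuous w)
    (hwi : ∀ v : Fin 4 → ℝ, v i ≠ 0 → ∀ l ≠ 0, w (v j / v i, v k / v i) l = (v i)⁻¹ * v l)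
    (hw0 : ∀ e, w e 1 ≠ 0 ∨ w e 2 ≠ 0 ∨ w e 3 ≠ 0) (hpos : 0 < ε * coneForm τ (w 0))
    (hwt : ∀ (t : ℝ) (e : ℝ × ℝ), coneForm τ (w (t • e)) =
      (1 - t ^ 2) * coneForm τ (w 0) + t ^ 2 * coneForm τ (w e)) :
    ∃ g, c.IsPotentialOn (Φ.region (affineDomain τ ε i)) g := by
  have hne : ∀ {v : Fin 4 → ℝ}, 0 < ε * coneForm τ v → coneForm τ v ≠ 0 := by
    intro v h h0
    simp [h0] at h
  have hcw : ∀ v : Fin 4 → ℝ, v i ≠ 0 → coneForm τ (w (v j / v i, v k / v i)) =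
      ((v i)⁻¹) ^ 2 * coneForm τ v := by
    intro v hv
    simp only [coneForm, hwi v hv 1 (by decide), hwi v hv 2 (by decide), hwi v hv 3 (by decide)]
    ring
  refine Φ.exists_isPotentialOn_image c isOpen_affineDomain
    (E := {e | 0 < ε * coneForm τ (w e)}) ?_ hpos (φ := fun e => liftPoint τ b (w e)) ?_
    (fun e he => liftPoint_mem (hne he) (hw0 e)) (ψ := fun v => (v j / v i, v k / v i)) ?_ ?_ ?_ ?_
  · rw [starConvex_zero_iff]
    intro e he t ht0 ht1
    change 0 < ε * coneForm τ (w (t • e))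
    rw [hwt]
    have he' : 0 < ε * coneForm τ (w e) := he
    by_cases ht : t = 0
    · simpa [ht] using hpos
    · have h2 : 0 < t ^ 2 := by positivity
      have h3 : t ^ 2 ≤ 1 := by nlinarith
      nlinarith [mul_pos h2 he', mul_nonneg (sub_nonneg.2 h3) hpos.le]
  · have h1 := continuous_coneForm (τ := τ)
    have h2 := continuous_baseForm (b := b)
    unfold liftPoint
    refine continuousOn_pi.2 fun l => ?_
    fin_cases l
    · refine ContinuousOn.div (by fun_prop) (by fun_prop) fun e he => hne he
    all_goals simp; fun_prop
  · rintro v ⟨-, hv, -⟩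
    apply ContinuousAt.continuousWithinAt
    fun_prop (disch := assumption)
  · rintro v ⟨-, hv, hv'⟩
    change 0 < ε * coneForm τ (w (v j / v i, v k / v i))
    rw [hcw v hv, mul_left_comm]
    exact mul_pos (by positivity) hv'
  · intro v _ t ht _
    simp only [Pi.smul_apply, smul_eq_mul, mul_div_mul_left _ _ ht]
  · rintro v ⟨hv, hvi, hv'⟩
    exact ⟨(v i)⁻¹, inv_ne_zero hvi, liftPoint_eq_smul (inv_ne_zero hvi) (hne hv') hv
      (hwi v hvi 1 (by decide)) (hwi v hvi 2 (by decide)) (hwi v hvi 3 (by decide))⟩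

/-- The substitution `z = q √(1 + y²)` turns the sector into a product. -/
theorem isPathConnected_sector {s : Set ℝ} (hs : IsPathConnected s) :
    IsPathConnected {e : ℝ × ℝ | e.1 ∈ s ∧ 0 < 1 + e.1 ^ 2 + τ * e.2 ^ 2} := by
  have hT : IsPathConnected {q : ℝ | 0 < 1 + τ * q ^ 2} := by
    refine StarConvex.isPathConnected (a := 0) ?_ (by simp)
    rw [starConvex_zero_iff]
    intro q hq t ht0 ht1
    have hq' : 0 < 1 + τ * q ^ 2 := hq
    change 0 < 1 + τ * (t * q) ^ 2
    by_cases ht : t = 0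
    · simp [ht]
    · have h2 : 0 < t ^ 2 := by positivity
      have h3 : t ^ 2 ≤ 1 := by nlinarith
      nlinarith [mul_pos h2 hq']
  have hpos : ∀ y : ℝ, 0 < 1 + y ^ 2 := fun y => by positivity
  have : {e : ℝ × ℝ | e.1 ∈ s ∧ 0 < 1 + e.1 ^ 2 + τ * e.2 ^ 2} =
      (fun e : ℝ × ℝ => (e.1, e.2 * Real.sqrt (1 + e.1 ^ 2))) ''
        (s ×ˢ {q | 0 < 1 + τ * q ^ 2}) := by
    ext ⟨y, z⟩
    constructor
    · rintro ⟨hy, hz⟩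
      have hsq : Real.sqrt (1 + y ^ 2) ≠ 0 := (Real.sqrt_pos.2 (hpos y)).ne'
      refine ⟨(y, z / Real.sqrt (1 + y ^ 2)), ⟨hy, ?_⟩, ?_⟩
      · change 0 < 1 + τ * (z / Real.sqrt (1 + y ^ 2)) ^ 2
        rw [div_pow, Real.sq_sqrt (hpos y).le]
        have : 1 + τ * (z ^ 2 / (1 + y ^ 2)) = (1 + y ^ 2 + τ * z ^ 2) / (1 + y ^ 2) := by
          have := (hpos y).ne'
          field_simp
        rw [this]
        exact div_pos hz (hpos y)
      · simp [hsq]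
    · rintro ⟨⟨y', q⟩, ⟨hy, hq⟩, h⟩
      simp only [Prod.mk.injEq] at h
      obtain ⟨rfl, rfl⟩ := h
      refine ⟨hy, ?_⟩
      have hq' : 0 < 1 + τ * q ^ 2 := hq
      simp only [mul_pow, Real.sq_sqrt (hpos y').le]
      nlinarith [mul_pos (hpos y') hq']
  rw [this]
  exact (hs.prod hT).image (by fun_prop)

/-- A cocycle on the complement of the node in the pointless normal form is a coboundary if it
vanishes on the loops in lines. The complement of the node is covered by the two charts `x ≠ 0` and
`y ≠ 0` of the region where `coneForm τ` is positive, glued along the line `u = z = 0`, and by a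
disc around `x = y = 0`. -/
theorem exists_isPotentialOn_univ_of_pointless (hτ : τ ≠ 0)
    (hpt : ∀ v : Fin 4 → ℝ, (v 1 ≠ 0 ∨ v 2 ≠ 0 ∨ v 3 ≠ 0) → coneForm τ v = 0 → baseForm b v ≠ 0)
    (hc : Φ.KillsLines c) : ∃ G, c.IsPotentialOn Set.univ G := by
  have hopen : ∀ U, IsOpen U → IsOpen (Φ.region U) := Φ.isOpen_image
  have hmem : ∀ v ∈ puncturedCone (pointlessCubic τ b), coneForm τ v ≠ 0 := by
    intro v hv h0
    have e := hv.1
    rw [pointlessCubic_eq, h0, mul_zero, zero_add] at e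
    exact hpt v hv.2 h0 e
  let w₁ : ℝ × ℝ → Fin 4 → ℝ := fun e => ![0, 1, e.1, e.2]
  let w₂ : ℝ × ℝ → Fin 4 → ℝ := fun e => ![0, e.1, 1, e.2]
  let w₃ : ℝ × ℝ → Fin 4 → ℝ := fun e => ![0, e.1, e.2, 1]
  obtain ⟨g₁, hg₁⟩ := exists_isPotentialOn_affine Φ c (ε := 1) (i := 1) (j := 2) (k := 3) (w := w₁)
    (by fun_prop) (by
      intro v hv l hl
      fin_cases l <;> simp [w₁, hv] at hl ⊢ <;> ring) (by simp [w₁]) (by simp [w₁, coneForm])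
    (by intro t e; simp [w₁, coneForm]; ring)
  obtain ⟨g₂, hg₂⟩ := exists_isPotentialOn_affine Φ c (ε := 1) (i := 2) (j := 1) (k := 3) (w := w₂)
    (by fun_prop) (by
      intro v hv l hl
      fin_cases l <;> simp [w₂, hv] at hl ⊢ <;> ring) (by simp [w₂]) (by simp [w₂, coneForm])
    (by intro t e; simp [w₂, coneForm]; ring)
  obtain ⟨g₃, hg₃⟩ := exists_isPotentialOn_affine Φ c (ε := τ) (i := 3) (j := 1) (k := 2) (w := w₃)
    (by fun_prop) (by
      intro v hv l hl
      fin_cases l <;> simp [w₃, hv] at hl ⊢ <;> ring) (by simp [w₃]) (by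
      simp only [w₃, coneForm]; simp; positivity)
    (by intro t e; simp [w₃, coneForm]; ring)
  -- the line `u = z = 0`
  let v₁ : Fin 4 → ℝ := ![0, 1, 0, 0]
  let v₂ : Fin 4 → ℝ := ![0, 0, 1, 0]
  have hline : ∀ x y : ℝ, x ≠ 0 ∨ y ≠ 0 →
      x • v₁ + y • v₂ ∈ puncturedCone (pointlessCubic τ b) := by
    intro x y hxy
    refine ⟨by simp [pointlessCubic, baseForm, v₁, v₂], ?_⟩
    rw [← or_assoc]
    left
    simpa [v₁, v₂] using hxy
  let α : C(I, X) := ConeMap.path Φ (γ := fun t : I => (1 : ℝ) • v₁ + (1 - 2 * (t : ℝ)) • v₂)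
    (by fun_prop) fun t => hline _ _ (Or.inl one_ne_zero)
  let β : C(I, X) := ConeMap.path Φ (γ := fun t : I => (1 - 2 * (t : ℝ)) • v₁ + (1 : ℝ) • v₂)
    (by fun_prop) fun t => hline _ _ (Or.inr one_ne_zero)
  have hlift : ∀ y : ℝ, liftPoint τ b (w₁ (y, 0)) = (1 : ℝ) • v₁ + y • v₂ := by
    intro y
    ext i
    fin_cases i <;> simp [liftPoint, w₁, v₁, v₂, baseForm]
  have hα0 : α 0 = Φ.toFun (liftPoint τ b (w₁ (1, 0))) := by
    rw [hlift]
    change Φ.toFun ((1 : ℝ) • v₁ + (1 - 2 * ((0 : I) : ℝ)) • v₂) = _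
    norm_num
  have hα1 : α 1 = Φ.toFun (liftPoint τ b (w₁ (-1, 0))) := by
    rw [hlift]
    change Φ.toFun ((1 : ℝ) • v₁ + (1 - 2 * ((1 : I) : ℝ)) • v₂) = _
    norm_num
  have hβ0 : β 0 = Φ.toFun (liftPoint τ b (w₁ (1, 0))) := by
    rw [hlift]
    change Φ.toFun ((1 - 2 * ((0 : I) : ℝ)) • v₁ + (1 : ℝ) • v₂) = _
    norm_num
  have hβ1 : β 1 = Φ.toFun (liftPoint τ b (w₁ (-1, 0))) := by
    rw [hlift]
    refine (Φ.eq_iff _ (hline _ _ (Or.inr one_ne_zero)) _ (hline _ _ (Or.inl one_ne_zero))).2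
      ⟨-1, by norm_num, ?_⟩
    simp only [Set.Icc.coe_one]
    module
  have hcone1 : ∀ e, coneForm τ (w₁ e) = 1 + e.1 ^ 2 + τ * e.2 ^ 2 := by
    intro e; simp [coneForm, w₁]
  have hcone3 : ∀ e, coneForm τ (w₃ e) = e.1 ^ 2 + e.2 ^ 2 + τ := by
    intro e; simp [coneForm, w₃]
  have hw₁c : ∀ s : Set ℝ, ContinuousOn (fun e : ℝ × ℝ => liftPoint τ b (w₁ e))
      {e : ℝ × ℝ | e.1 ∈ s ∧ 0 < 1 + e.1 ^ 2 + τ * e.2 ^ 2} := by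
    intro s
    have h1 := continuous_coneForm (τ := τ)
    have h2 := continuous_baseForm (b := b)
    have h3 : Continuous w₁ := by fun_prop
    unfold liftPoint
    refine continuousOn_pi.2 fun l => ?_
    fin_cases l
    · exact ContinuousOn.div (by fun_prop) (by fun_prop) fun e he => by
        rw [hcone1]; exact he.2.ne'
    all_goals simp; fun_prop
  have hlmem : ∀ e : ℝ × ℝ, 0 < 1 + e.1 ^ 2 + τ * e.2 ^ 2 →
      liftPoint τ b (w₁ e) ∈ puncturedCone (pointlessCubic τ b) := fun e he =>
    liftPoint_mem (by rw [hcone1]; exact he.ne') (by simp [w₁])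
  have hcl : ∀ v, coneForm τ (liftPoint τ b v) = coneForm τ v := by
    intro v; simp [coneForm, liftPoint]
  have hlW : ∀ e : ℝ × ℝ, e.1 ≠ 0 → 0 < 1 + e.1 ^ 2 + τ * e.2 ^ 2 →
      Φ.toFun (liftPoint τ b (w₁ e)) ∈
        Φ.region (affineDomain τ 1 1) ∩ Φ.region (affineDomain τ 1 2) := by
    intro e he he'
    have h : 0 < 1 * coneForm τ (liftPoint τ b (w₁ e)) := by rwa [hcl, hcone1, one_mul]
    exact ⟨⟨_, ⟨hlmem e he', by simp [liftPoint, w₁], h⟩, rfl⟩,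
      _, ⟨hlmem e he', by simpa [liftPoint, w₁] using he, h⟩, rfl⟩
  obtain ⟨g₂', hg₂', heq⟩ := hg₁.exists_eqOn_inter hg₂
    (k := Φ.toFun (liftPoint τ b (w₁ (1, 0)))) (k' := Φ.toFun (liftPoint τ b (w₁ (-1, 0))))
    (fun x hx => by
      rw [Φ.region_inter fun v hv t ht => smul_mem_affineDomain hv.2 ht] at hx
      obtain ⟨v, ⟨hv, ⟨hv1, hvc⟩, hv2, -⟩, rfl⟩ := hx
      have hrep : Φ.toFun v = Φ.toFun (liftPoint τ b (w₁ (v 2 / v 1, v 3 / v 1))) := by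
        have e := liftPoint_eq_smul (w := w₁ (v 2 / v 1, v 3 / v 1)) (inv_ne_zero hv1) (hmem v hv)
          hv (by simp [w₁, hv1]) (by simp [w₁]; ring) (by simp [w₁]; ring)
        have hm : (v 1)⁻¹ • v ∈ puncturedCone (pointlessCubic τ b) := by
          rw [← e]
          refine liftPoint_mem ?_ (by simp [w₁])
          rw [← hcl, e, coneForm_smul]
          exact mul_ne_zero (by positivity) (hmem v hv)
        rw [e]
        exact (Φ.eq_iff _ hv _ hm).2 ⟨_, inv_ne_zero hv1, rfl⟩
      have hpos : 0 < 1 + (v 2 / v 1) ^ 2 + τ * (v 3 / v 1) ^ 2 := by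
        have : 1 + (v 2 / v 1) ^ 2 + τ * (v 3 / v 1) ^ 2 = ((v 1)⁻¹) ^ 2 * (1 * coneForm τ v) := by
          simp only [coneForm]; field_simp
        rw [this]
        exact mul_pos (by positivity) hvc
      rw [hrep]
      rcases lt_or_gt_of_ne (div_ne_zero hv2 hv1) with hlt | hgt
      · right
        exact ConeMap.joinedIn_image
          (isPathConnected_sector ((convex_Iio (0 : ℝ)).isPathConnected ⟨-1, by simp⟩))
          (φ := fun e => liftPoint τ b (w₁ e)) (hw₁c _)
          (fun e he => hlmem e he.2) (fun e he => hlW e (ne_of_lt he.1) he.2) ⟨hlt, hpos⟩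
          ⟨by simp, by norm_num⟩
      · left
        exact ConeMap.joinedIn_image
          (isPathConnected_sector ((convex_Ioi (0 : ℝ)).isPathConnected ⟨1, by simp⟩))
          (φ := fun e => liftPoint τ b (w₁ e)) (hw₁c _)
          (fun e he => hlmem e he.2) (fun e he => hlW e (ne_of_gt he.1) he.2) ⟨hgt, hpos⟩
          ⟨by simp, by norm_num⟩)
    (α := α) (β := β)
    (fun t => ⟨_, ⟨hline _ _ (Or.inl one_ne_zero), by simp [v₁, v₂], by
      simp [v₁, v₂, coneForm]; positivity⟩, rfl⟩)
    (fun t => ⟨_, ⟨hline _ _ (Or.inr one_ne_zero), by simp [v₁, v₂], by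
      simp [v₁, v₂, coneForm]; positivity⟩, rfl⟩) hα0 hα1 hβ0 hβ1
    (hc.val_eq hline (fun t => ⟨Or.inl one_ne_zero, rfl⟩) (fun t => ⟨Or.inr one_ne_zero, rfl⟩)
      (hα0.trans hβ0.symm) (hα1.trans hβ1.symm))
  obtain ⟨g, hg⟩ := hg₁.exists_union (hopen _ isOpen_affineDomain) (hopen _ isOpen_affineDomain)
    hg₂' heq
  have hM : IsOpen (Φ.region (affineDomain τ 1 1) ∪ Φ.region (affineDomain τ 1 2)) :=
    (hopen _ isOpen_affineDomain).union (hopen _ isOpen_affineDomain)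
  have hD : IsOpen (Φ.region (affineDomain τ τ 3)) := hopen _ isOpen_affineDomain
  have hcover : ∀ x, x ∈ (Φ.region (affineDomain τ 1 1) ∪ Φ.region (affineDomain τ 1 2)) ∪
      Φ.region (affineDomain τ τ 3) := by
    intro x
    obtain ⟨v, hv, rfl⟩ := Φ.surjective x
    by_cases h12 : v 1 = 0 ∧ v 2 = 0
    · refine Or.inr ⟨v, ⟨hv, ?_, ?_⟩, rfl⟩
      · simpa [h12] using hv.2
      · have h3 : v 3 ≠ 0 := by simpa [h12] using hv.2
        have : τ * coneForm τ v = (τ * v 3) ^ 2 := by simp [coneForm, h12]; ring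
        rw [this]
        positivity
    · rcases lt_or_gt_of_ne (hmem v hv) with hlt | hgt
      · refine Or.inr ⟨v, ⟨hv, ?_, ?_⟩, rfl⟩
        · intro h3
          simp only [coneForm, h3] at hlt
          nlinarith [sq_nonneg (v 1), sq_nonneg (v 2)]
        · have : τ < 0 := by
            by_contra h
            have := not_lt.1 h
            simp only [coneForm] at hlt
            nlinarith [sq_nonneg (v 1), sq_nonneg (v 2), mul_nonneg this (sq_nonneg (v 3))]
          exact mul_pos_of_neg_of_neg this hlt
      · rw [not_and_or] at h12
        have hgt' : 0 < 1 * coneForm τ v := by rwa [one_mul]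
        rcases h12 with h | h
        · exact Or.inl (Or.inl ⟨v, ⟨hv, h, hgt'⟩, rfl⟩)
        · exact Or.inl (Or.inr ⟨v, ⟨hv, h, hgt'⟩, rfl⟩)
  have hinter : ∀ x ∈ (Φ.region (affineDomain τ 1 1) ∪ Φ.region (affineDomain τ 1 2)) ∩
      Φ.region (affineDomain τ τ 3), ∃ v ∈ puncturedCone (pointlessCubic τ b), Φ.toFun v = x ∧
        (v 1 ≠ 0 ∨ v 2 ≠ 0) ∧ v 3 ≠ 0 ∧ 0 < coneForm τ v ∧ 0 < τ * coneForm τ v := by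
    rintro x ⟨hx | hx, hx'⟩
    all_goals
      obtain ⟨v, ⟨hv, h1, h3⟩, rfl⟩ := (Φ.region_inter fun v hv t ht =>
        smul_mem_affineDomain hv.2 ht).subset ⟨hx, hx'⟩
      refine ⟨v, hv, rfl, ?_, h3.1, by simpa using h1.2, h3.2⟩
    · exact Or.inl h1.1
    · exact Or.inr h1.1
  obtain ⟨g₃', hg₃', heq'⟩ : ∃ g₃', c.IsPotentialOn (Φ.region (affineDomain τ τ 3)) g₃' ∧
      Set.EqOn g₃' g ((Φ.region (affineDomain τ 1 1) ∪ Φ.region (affineDomain τ 1 2)) ∩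
        Φ.region (affineDomain τ τ 3)) := by
    rcases lt_or_gt_of_ne hτ with hneg | hpos
    · -- for `τ < 0` the form is negative on the disc, which is disjoint from the other charts
      refine ⟨g₃, hg₃, fun x hx => ?_⟩
      obtain ⟨v, -, -, -, -, h, h'⟩ := hinter x hx
      exact absurd h' (not_lt.2 (mul_nonpos_of_nonpos_of_nonneg hneg.le h.le))
    · -- for `τ > 0` the disc is an affine plane, which the other charts meet in the complement of
      -- its origin
      have hconn : IsPathConnected ({(0 : ℝ × ℝ)}ᶜ : Set (ℝ × ℝ)) :=
        isPathConnected_compl_singleton_of_one_lt_rank (by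
          rw [rank_prod', Module.rank_self]; norm_num) 0
      have hc3 : ∀ e, 0 < coneForm τ (w₃ e) := fun e => by rw [hcone3]; positivity
      have hl3 : ∀ e, liftPoint τ b (w₃ e) ∈ puncturedCone (pointlessCubic τ b) := fun e =>
        liftPoint_mem (hc3 e).ne' (by simp [w₃])
      have hk : ∀ e ∈ ({(0 : ℝ × ℝ)}ᶜ : Set (ℝ × ℝ)), Φ.toFun (liftPoint τ b (w₃ e)) ∈
          (Φ.region (affineDomain τ 1 1) ∪ Φ.region (affineDomain τ 1 2)) ∩
            Φ.region (affineDomain τ τ 3) := by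
        intro e he
        refine ⟨?_, _, ⟨hl3 e, by simp [liftPoint, w₃], by rw [hcl]; exact mul_pos hpos (hc3 e)⟩,
          rfl⟩
        have h : 0 < 1 * coneForm τ (liftPoint τ b (w₃ e)) := by
          rw [hcl, one_mul]; exact hc3 e
        by_cases h1 : e.1 = 0
        · have h2 : e.2 ≠ 0 := fun h2 => he (Prod.ext h1 h2)
          exact Or.inr ⟨_, ⟨hl3 e, by simpa [liftPoint, w₃] using h2, h⟩, rfl⟩
        · exact Or.inl ⟨_, ⟨hl3 e, by simpa [liftPoint, w₃] using h1, h⟩, rfl⟩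
      have hcont : Continuous fun e : ℝ × ℝ => liftPoint τ b (w₃ e) := by
        have h1 := continuous_coneForm (τ := τ)
        have h2 := continuous_baseForm (b := b)
        have h3 : Continuous w₃ := by fun_prop
        unfold liftPoint
        refine continuous_pi fun l => ?_
        fin_cases l
        · exact Continuous.div (by fun_prop) (by fun_prop) fun e => (hc3 e).ne'
        all_goals simp; fun_prop
      have hone : ((1, 0) : ℝ × ℝ) ∈ ({(0 : ℝ × ℝ)}ᶜ : Set (ℝ × ℝ)) := by simp
      refine hg.exists_eqOn_inter hg₃ (k := Φ.toFun (liftPoint τ b (w₃ (1, 0))))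
        (k' := Φ.toFun (liftPoint τ b (w₃ (1, 0)))) (fun x hx => Or.inl ?_)
        (α := ContinuousMap.const I _) (β := ContinuousMap.const I _) (fun _ => (hk _ hone).1)
        (fun _ => (hk _ hone).2) rfl rfl rfl rfl rfl
      obtain ⟨v, hv, rfl, h12, h3, -, -⟩ := hinter x hx
      have hrep : Φ.toFun v = Φ.toFun (liftPoint τ b (w₃ (v 1 / v 3, v 2 / v 3))) := by
        have e := liftPoint_eq_smul (w := w₃ (v 1 / v 3, v 2 / v 3)) (inv_ne_zero h3) (hmem v hv)
          hv (by simp [w₃]; ring) (by simp [w₃]; ring) (by simp [w₃, h3])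
        exact (Φ.eq_iff _ hv _ (hl3 _)).2 ⟨_, inv_ne_zero h3, e⟩
      rw [hrep]
      refine ConeMap.joinedIn_image hconn (φ := fun e => liftPoint τ b (w₃ e)) hcont.continuousOn
        (fun e _ => hl3 e) hk ?_ hone
      intro h0
      have h0' : (v 1 / v 3, v 2 / v 3) = (0 : ℝ × ℝ) := h0
      simp only [Prod.mk_eq_zero, div_eq_zero_iff, h3, or_false] at h0'
      exact h12.elim (fun h => h h0'.1) fun h => h h0'.2
  obtain ⟨G, hG⟩ := hg.exists_union hM hD hg₃' heq'
  exact ⟨G, hG.mono fun x _ => hcover x⟩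

end Pointless

/-! ### Real coordinates on the surface -/

section RealCoordinates

open scoped unitInterval

theorem complexify_apply (v : Fin 4 → ℝ) (i : Fin 4) : complexify v i = (v i : ℂ) := rfl

theorem complexify_ne_zero {v : Fin 4 → ℝ} (hv : v ≠ 0) : complexify v ≠ 0 := fun h =>
  hv (complexify_injective (h.trans (map_zero complexify).symm))

theorem toComplex_mk {v : Fin 4 → ℝ} (hv : v ≠ 0) :
    toComplex (Projectivization.mk ℝ v hv) =
      Projectivization.mk ℂ (complexify v) (complexify_ne_zero hv) :=
  Projectivization.map_mk _ _ _ _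

/-- A complex combination of two real vectors, split into real and imaginary part. -/
theorem re_smul_add_smul_complexify {α β : ℂ} {v w u : Fin 4 → ℝ}
    (h : α • complexify v + β • complexify w = complexify u) :
    α.re • v + β.re • w = u ∧ α.im • v + β.im • w = 0 := by
  constructor
  · ext i
    simpa [complexify_apply] using congrArg Complex.re (congrFun h i)
  · ext i
    simpa [complexify_apply] using congrArg Complex.im (congrFun h i)

variable {F : MvPolynomial (Fin 4) ℝ}

theorem aeval_smul_of_isHomogeneous {ι R A : Type*} [CommRing R] [CommRing A] [Algebra R A]
    {n : ℕ} {F : MvPolynomial ι R} (hF : F.IsHomogeneous n) (c : A) (v : ι → A) :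
    MvPolynomial.aeval (c • v) F = c ^ n * MvPolynomial.aeval v F := by
  rw [MvPolynomial.aeval_def, MvPolynomial.aeval_def, MvPolynomial.eval₂_eq,
    MvPolynomial.eval₂_eq, Finset.mul_sum]
  refine Finset.sum_congr rfl fun d hd => ?_
  have h1 : ∑ i ∈ d.support, d i = n := by
    rw [← hF (MvPolynomial.mem_support_iff.1 hd), Finsupp.weight_apply, Finsupp.sum]
    simp
  simp only [Pi.smul_apply, smul_eq_mul, mul_pow, Finset.prod_mul_distrib,
    Finset.prod_pow_eq_pow_sum, h1]
  ring

theorem mk_mem_hypersurface (hF : F.IsHomogeneous 3) {v : Fin 4 → ℂ} (hv : v ≠ 0) :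
    Projectivization.mk ℂ v hv ∈ hypersurface F ↔ MvPolynomial.aeval v F = 0 := by
  rw [hypersurface, Set.mem_ofPred_eq, Projectivization.submodule_mk]
  constructor
  · exact fun h => h v (Submodule.mem_span_singleton_self v)
  · intro h w hw
    obtain ⟨c, rfl⟩ := Submodule.mem_span_singleton.1 hw
    rw [aeval_smul_of_isHomogeneous hF, h, mul_zero]

/-- The projection `ℝ⁴ ∖ {0} → P³(ℝ)` is open. -/
theorem isOpen_image_mk {U : Set (Fin 4 → ℝ)} (hU : IsOpen U) :
    IsOpen {x : RP3 | ∃ (v : Fin 4 → ℝ) (hv : v ≠ 0), v ∈ U ∧ x = Projectivization.mk ℝ v hv} := by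
  rw [isOpen_coinduced]
  have : Projectivization.mk' ℝ ⁻¹' {x : RP3 | ∃ (v : Fin 4 → ℝ) (hv : v ≠ 0), v ∈ U ∧
      x = Projectivization.mk ℝ v hv} =
      ⋃ t : ℝˣ, {w : {w : Fin 4 → ℝ // w ≠ 0} | (t : ℝ) • (w : Fin 4 → ℝ) ∈ U} := by
    ext ⟨w, hw⟩
    simp only [Set.mem_preimage, Set.mem_ofPred_eq, Set.mem_iUnion]
    constructor
    · rintro ⟨v, hv, hvU, h⟩
      rw [Projectivization.mk'_eq_mk, Projectivization.mk_eq_mk_iff'] at h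
      obtain ⟨a, ha⟩ := h
      have ha0 : a ≠ 0 := by
        rintro rfl
        exact hw (by simpa using ha.symm)
      refine ⟨(Units.mk0 a ha0)⁻¹, ?_⟩
      change a • v = w at ha
      simpa [← ha, smul_smul, ha0] using hvU
    · rintro ⟨t, ht⟩
      refine ⟨(t : ℝ) • w, smul_ne_zero t.ne_zero hw, ht, ?_⟩
      rw [Projectivization.mk'_eq_mk, Projectivization.mk_eq_mk_iff']
      exact ⟨(t : ℝ)⁻¹, by simp [smul_smul]⟩
  rw [this]
  refine isOpen_iUnion fun t => hU.preimage ?_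
  fun_prop

theorem continuous_mk {Y : Type*} [TopologicalSpace Y] {k : Y → Fin 4 → ℝ} (hk : Continuous k)
    (h0 : ∀ y, k y ≠ 0) : Continuous fun y => (Projectivization.mk ℝ (k y) (h0 y) : RP3) :=
  (continuous_coinduced_rng (f := Projectivization.mk' ℝ)).comp
    (hk.subtype_mk h0 : Continuous fun y => (⟨k y, h0 y⟩ : {w : Fin 4 → ℝ // w ≠ 0}))

theorem ne_zero_of_mem_puncturedCone {f : (Fin 4 → ℝ) → ℝ} {v : Fin 4 → ℝ}
    (hv : v ∈ puncturedCone f) : v ≠ 0 := by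
  rintro rfl
  simp [puncturedCone] at hv

/-- Real linear coordinates in which the surface `F = 0` has the equation `f = 0` and the point `p`
is `(1 : 0 : 0 : 0)`. -/
structure Coordinates (F : MvPolynomial (Fin 4) ℝ) (p : P3) (f : (Fin 4 → ℝ) → ℝ) where
  /-- The map from the new coordinates to the original ones. -/
  equiv : (Fin 4 → ℝ) ≃ₗ[ℝ] (Fin 4 → ℝ)
  aeval_complexify : ∀ v, MvPolynomial.aeval (complexify (equiv v)) F = (f v : ℂ)
  basepoint : p.submodule = ℂ ∙ complexify (equiv (Pi.single 0 1))

namespace Coordinates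

variable {p : P3} {f : (Fin 4 → ℝ) → ℝ} (E : Coordinates F p f)

theorem equiv_ne_zero {v : Fin 4 → ℝ} (hv : v ≠ 0) : E.equiv v ≠ 0 :=
  E.equiv.map_ne_zero_iff.2 hv

theorem mk_mem_iff (hF : F.IsHomogeneous 3) {v : Fin 4 → ℝ} (hv : v ≠ 0) :
    Projectivization.mk ℝ (E.equiv v) (E.equiv_ne_zero hv) ∈ realLocus (hypersurface F \ {p}) ↔
      v ∈ puncturedCone f := by
  rw [realLocus, Set.mem_preimage, toComplex_mk, Set.mem_sdiff, mk_mem_hypersurface hF,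
    E.aeval_complexify, Complex.ofReal_eq_zero, puncturedCone, Set.mem_ofPred_eq,
    Set.mem_singleton_iff]
  refine and_congr_right fun _ => ?_
  rw [← not_iff_not, not_not]
  rw [← Projectivization.submodule_injective.eq_iff, E.basepoint, Projectivization.submodule_mk]
  constructor
  · intro h
    have h1 : complexify (E.equiv v) ∈ ℂ ∙ complexify (E.equiv (Pi.single 0 1)) := by
      rw [← h]; exact Submodule.mem_span_singleton_self _
    obtain ⟨c, hc⟩ := Submodule.mem_span_singleton.1 h1
    have h2 := (re_smul_add_smul_complexify (β := 0) (w := 0) (by simpa using hc)).1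
    rw [smul_zero, add_zero, ← map_smul] at h2
    rw [← E.equiv.injective h2]
    simp
  · intro h
    push Not at h
    have h1 : v = v 0 • Pi.single 0 1 := by
      ext i
      fin_cases i <;> simp [h.1, h.2.1, h.2.2]
    have h0 : v 0 ≠ 0 := by
      intro h0
      apply hv
      rw [h1, h0, zero_smul]
    rw [h1, map_smul, map_smulₛₗ]
    exact Submodule.span_singleton_smul_eq (by simpa using h0) _

open Classical in
/-- The real locus of the complement of `p` as a quotient of the cone over it. -/
def coneMap (hF : F.IsHomogeneous 3) (hne : (puncturedCone f).Nonempty) :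
    ConeMap (puncturedCone f) (realLocus (hypersurface F \ {p})) where
  toFun v := if hv : v ∈ puncturedCone f then
      ⟨_, (E.mk_mem_iff hF (ne_zero_of_mem_puncturedCone hv)).2 hv⟩
    else ⟨_, (E.mk_mem_iff hF (ne_zero_of_mem_puncturedCone hne.some_mem)).2 hne.some_mem⟩
  continuousOn := by
    rw [continuousOn_iff_continuous_domRestrict]
    refine Continuous.congr (f := fun v : puncturedCone f => (⟨_, (E.mk_mem_iff hF
      (ne_zero_of_mem_puncturedCone v.2)).2 v.2⟩ : realLocus (hypersurface F \ {p}))) ?_ ?_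
    · refine Continuous.subtype_mk (continuous_mk ?_ _) _
      exact (LinearMap.continuous_of_finiteDimensional E.equiv.toLinearMap).comp
        continuous_subtype_val
    · intro v
      rw [Set.domRestrict_apply, dif_pos v.2]
  isOpen_image U hU := by
    have hU' : IsOpen (E.equiv.symm ⁻¹' U) :=
      hU.preimage (LinearMap.continuous_of_finiteDimensional E.equiv.symm.toLinearMap)
    refine ⟨_, isOpen_image_mk hU', ?_⟩
    ext ⟨x, hx⟩
    constructor
    · rintro ⟨w, hw, hwU, rfl : x = _⟩
      have h0 : E.equiv.symm w ≠ 0 := E.equiv.symm.map_ne_zero_iff.2 hw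
      have h1 : E.equiv.symm w ∈ puncturedCone f := by
        rw [← E.mk_mem_iff hF h0]
        simpa using hx
      refine ⟨E.equiv.symm w, ⟨h1, hwU⟩, ?_⟩
      dsimp only
      rw [dif_pos h1]
      simp
    · rintro ⟨v, ⟨hv, hvU⟩, h⟩
      dsimp only at h
      rw [dif_pos hv] at h
      refine ⟨E.equiv v, E.equiv_ne_zero (ne_zero_of_mem_puncturedCone hv), by simpa using hvU,
        (congrArg Subtype.val h).symm⟩
  surjective := by
    rintro ⟨x, hx⟩
    induction x using Projectivization.ind with
    | h w hw =>
      have h0 : E.equiv.symm w ≠ 0 := E.equiv.symm.map_ne_zero_iff.2 hw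
      have h1 : E.equiv.symm w ∈ puncturedCone f := by
        rw [← E.mk_mem_iff hF h0]
        simpa using hx
      refine ⟨E.equiv.symm w, h1, ?_⟩
      rw [dif_pos h1]
      simp
  eq_iff v hv w hw := by
    rw [dif_pos hv, dif_pos hw, Subtype.mk.injEq, Projectivization.mk_eq_mk_iff']
    constructor
    · rintro ⟨a, ha⟩
      rw [← map_smul] at ha
      have ha := E.equiv.injective ha
      have ha0 : a ≠ 0 := by
        rintro rfl
        exact ne_zero_of_mem_puncturedCone hv (by simpa using ha.symm)
      exact ⟨a⁻¹, inv_ne_zero ha0, by rw [← ha, smul_smul, inv_mul_cancel₀ ha0, one_smul]⟩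
    · rintro ⟨t, ht, rfl⟩
      exact ⟨t⁻¹, by rw [map_smul, smul_smul, inv_mul_cancel₀ ht, one_smul]⟩

theorem coe_coneMap (hF : F.IsHomogeneous 3) (hne : (puncturedCone f).Nonempty) {v : Fin 4 → ℝ}
    (hv : v ∈ puncturedCone f) :
    ((E.coneMap hF hne).toFun v : RP3) = Projectivization.mk ℝ (E.equiv v)
      (E.equiv_ne_zero (ne_zero_of_mem_puncturedCone hv)) := by
  simp only [coneMap, dif_pos hv]

theorem isRealLine_of_linearIndependent {w₁ w₂ : Fin 4 → ℝ}
    (h : LinearIndependent ℝ ![w₁, w₂]) :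
    IsRealLine {x | x.submodule ≤ Submodule.span ℂ {complexify w₁, complexify w₂}} := by
  refine ⟨_, ?_, ?_, rfl⟩
  · have h1 : LinearIndependent ℂ ![complexify w₁, complexify w₂] := by
      rw [LinearIndependent.pair_iff] at h ⊢
      intro α β hαβ
      have h2 := re_smul_add_smul_complexify (u := 0) (by simpa using hαβ)
      exact ⟨Complex.ext (h _ _ h2.1).1 (h _ _ h2.2).1, Complex.ext (h _ _ h2.1).2 (h _ _ h2.2).2⟩
    have h2 := finrank_span_eq_card h1
    rwa [Matrix.range_cons_cons_empty, Fintype.card_fin] at h2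
  · intro v hv
    obtain ⟨α, β, rfl⟩ := Submodule.mem_span_pair.1 hv
    refine Submodule.mem_span_pair.2 ⟨star α, star β, ?_⟩
    ext i
    simp [complexify_apply]

/-- A real form that vanishes on the real points of a real line vanishes on its complex points. -/
theorem aeval_eq_zero_of_real {w₁ w₂ : Fin 4 → ℝ}
    (h : ∀ a b : ℝ, MvPolynomial.aeval (complexify (a • w₁ + b • w₂)) F = 0) (α β : ℂ) :
    MvPolynomial.aeval (α • complexify w₁ + β • complexify w₂) F = 0 := by
  let φ : Fin 4 → MvPolynomial (Fin 2) ℝ := fun i =>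
    .C (w₁ i) * .X 0 + .C (w₂ i) * .X 1
  have key : ∀ α β : ℂ, MvPolynomial.aeval ![α, β] (MvPolynomial.aeval φ F) =
      MvPolynomial.aeval (α • complexify w₁ + β • complexify w₂) F := by
    intro α β
    rw [← AlgHom.comp_apply, MvPolynomial.comp_aeval]
    congr 2
    ext i
    simp [φ, complexify_apply, mul_comm]
  have h0 : MvPolynomial.aeval φ F = 0 := by
    apply MvPolynomial.funext
    intro x
    have h1 := key (x 0) (x 1)
    have h2 : (x 0 : ℂ) • complexify w₁ + (x 1 : ℂ) • complexify w₂ =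
        complexify (x 0 • w₁ + x 1 • w₂) := by
      rw [map_add, map_smulₛₗ, map_smulₛₗ]; rfl
    rw [h2, h] at h1
    have h3 : (![(x 0 : ℂ), x 1] : Fin 2 → ℂ) = fun i => algebraMap ℝ ℂ (x i) := by
      ext i; fin_cases i <;> rfl
    have h4 := MvPolynomial.aeval_algebraMap_apply ℂ x (MvPolynomial.aeval φ F)
    rw [h3] at h1
    rw [map_zero, ← MvPolynomial.coe_aeval_eq_eval]
    exact (algebraMap ℝ ℂ).injective (h4.symm.trans (h1.trans (map_zero _).symm))
  rw [← key, h0, map_zero]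

/-- The reduction of the theorem to cocycles: the classes of the real lines span if each cocycle
that vanishes on the loops in lines is a coboundary. It does not matter here that the homology of a
line has only one non-zero element. -/
theorem span_realLineClasses_eq_top (E : Coordinates F p f) (hF : F.IsHomogeneous 3)
    (hne : (puncturedCone f).Nonempty)
    (h : ∀ (Φ : ConeMap (puncturedCone f) (realLocus (hypersurface F \ {p})))
      (c : PathCocycle (realLocus (hypersurface F \ {p}))),
      Φ.KillsLines c → ∃ G, c.IsPotentialOn Set.univ G) :
    Submodule.span (ZMod 2) (realLineClasses (hypersurface F \ {p})) = ⊤ := by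
  refine eq_top_of_forall_cocycle_exact (X := TopCat.of (realLocus (hypersurface F \ {p}))) _ ?_
  intro c hc
  suffices hkill : (E.coneMap hF hne).KillsLines c by
    obtain ⟨G, hG⟩ := h (E.coneMap hF hne) c hkill
    exact ⟨G, fun q => hG q fun t => Set.mem_univ _⟩
  intro v₁ v₂ hv q hq hq01
  set w₁ := E.equiv v₁ with hw₁
  set w₂ := E.equiv v₂ with hw₂
  have hE : ∀ a b : ℝ, E.equiv (a • v₁ + b • v₂) = a • w₁ + b • w₂ := by
    intro a b
    rw [map_add, map_smul, map_smul]
  have hv' : ∀ a b : ℝ, a • v₁ + b • v₂ = 0 → a = 0 ∧ b = 0 := by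
    intro a b hab
    by_contra hne
    rw [not_and_or] at hne
    exact ne_zero_of_mem_puncturedCone (hv a b hne) hab
  have hind : LinearIndependent ℝ ![w₁, w₂] := by
    rw [LinearIndependent.pair_iff]
    intro a b hab
    rw [← hE, E.equiv.map_eq_zero_iff] at hab
    exact hv' a b hab
  set l : Set P3 := {x | x.submodule ≤ Submodule.span ℂ {complexify w₁, complexify w₂}} with hl
  have hreal : ∀ a b : ℝ, MvPolynomial.aeval (complexify (a • w₁ + b • w₂)) F = 0 := by
    intro a b
    by_cases hab : a ≠ 0 ∨ b ≠ 0
    · rw [← hE, E.aeval_complexify, (hv a b hab).1, Complex.ofReal_zero]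
    · push Not at hab
      have := aeval_smul_of_isHomogeneous (A := ℂ) hF 0 0
      simpa [hab.1, hab.2] using this
  have hsub : l ⊆ hypersurface F \ {p} := by
    intro x hx
    refine ⟨fun u hu => ?_, ?_⟩
    · obtain ⟨α, β, rfl⟩ := Submodule.mem_span_pair.1 (hx hu)
      exact aeval_eq_zero_of_real hreal α β
    · rintro rfl
      have h1 : complexify (E.equiv (Pi.single 0 1)) ∈ x.submodule := by
        rw [E.basepoint]; exact Submodule.mem_span_singleton_self _
      obtain ⟨α, β, hαβ⟩ := Submodule.mem_span_pair.1 (hx h1)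
      have h2 := (re_smul_add_smul_complexify hαβ).1
      rw [← hE] at h2
      have h3 := E.equiv.injective h2
      by_cases hab : α.re ≠ 0 ∨ β.re ≠ 0
      · have h4 := (hv _ _ hab).2
        rw [h3] at h4
        simp at h4
      · push Not at hab
        rw [hab.1, hab.2, zero_smul, zero_smul, add_zero] at h3
        simpa using congrFun h3 0
  have hsub' : realLocus l ⊆ realLocus (hypersurface F \ {p}) := Set.preimage_mono hsub
  have hql : ∀ t, (q t : RP3) ∈ realLocus l := by
    intro t
    obtain ⟨a, b, hab, ht⟩ := hq t
    rw [ht, E.coe_coneMap hF hne hab, realLocus, Set.mem_preimage, toComplex_mk, hl,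
      Set.mem_ofPred_eq, Projectivization.submodule_mk, Submodule.span_singleton_le_iff_mem, hE,
      map_add, map_smulₛₗ, map_smulₛₗ]
    exact Submodule.mem_span_pair.2 ⟨_, _, rfl⟩
  let q' : C(I, TopCat.of (realLocus l)) :=
    ⟨fun t => ⟨q t, hql t⟩, (continuous_subtype_val.comp q.continuous).subtype_mk _⟩
  have hq' : q' 0 = q' 1 := Subtype.ext (congrArg Subtype.val hq01 : (q 0 : RP3) = q 1)
  have hspan : ∀ a : H1 (realLocus l), (H1map hsub').hom a ∈
      Submodule.span (ZMod 2) (realLineClasses (hypersurface F \ {p})) := by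
    intro a
    by_cases ha : a = 0
    · rw [ha, map_zero]
      exact zero_mem _
    · exact Submodule.subset_span
        ⟨l, isRealLine_of_linearIndependent hind, hsub, a, ha, rfl⟩
  exact hc (TopCat.of (realLocus l))
    (TopCat.ofHom ⟨Set.inclusion hsub', continuous_inclusion hsub'⟩) hspan q' hq'

end Coordinates

end RealCoordinates

/-! ### Cubic forms and their derivatives -/

section CubicForms

theorem eval_aeval_polynomial {ι R A : Type*} [CommRing R] [CommRing A] [Algebra R A]
    (F : MvPolynomial ι R) (φ : ι → Polynomial A) (t : A) :
    (MvPolynomial.aeval φ F).eval t = MvPolynomial.aeval (fun j => (φ j).eval t) F := by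
  induction F using MvPolynomial.induction_on with
  | C a =>
    rw [MvPolynomial.algHom_C, MvPolynomial.algHom_C, Polynomial.algebraMap_apply,
      Polynomial.eval_C]
  | add p q hp hq => simp only [map_add, Polynomial.eval_add, hp, hq]
  | mul_X p j hp => simp only [map_mul, MvPolynomial.aeval_X, Polynomial.eval_mul, hp]

theorem eval_derivative_aeval_polynomial {ι R A : Type*} [DecidableEq ι] [CommRing R]
    [CommRing A] [Algebra R A] (F : MvPolynomial ι R) (φ : ι → Polynomial A) (t : A) (i : ι)
    (hφ : ∀ j, (Polynomial.derivative (φ j)).eval t = Pi.single (M := fun _ => A) i 1 j) :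
    (Polynomial.derivative (MvPolynomial.aeval φ F)).eval t =
      MvPolynomial.aeval (fun j => (φ j).eval t) (MvPolynomial.pderiv i F) := by
  induction F using MvPolynomial.induction_on with
  | C a =>
    rw [MvPolynomial.algHom_C, Polynomial.algebraMap_apply, Polynomial.derivative_C,
      MvPolynomial.pderiv_C, Polynomial.eval_zero, map_zero]
  | add p q hp hq => simp only [map_add, Polynomial.eval_add, hp, hq]
  | mul_X p j hp =>
    rw [map_mul, Polynomial.derivative_mul, Polynomial.eval_add, Polynomial.eval_mul, hp,
      Polynomial.eval_mul, eval_aeval_polynomial, Derivation.leibniz, map_add,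
      MvPolynomial.pderiv_X, MvPolynomial.aeval_X, MvPolynomial.aeval_X, hφ]
    by_cases hij : i = j
    · subst hij
      simp [eval_aeval_polynomial]
      ring
    · simp [Ne.symm hij]
      ring

/-- A partial derivative vanishes at `v` if the polynomial vanishes to second order at `v` along the
corresponding coordinate direction. The polynomials that occur have degree three. -/
theorem aeval_pderiv_eq_zero {ι R A : Type*} [DecidableEq ι] [CommRing R] [CommRing A]
    [IsDomain A] [Infinite A] [Algebra R A] (F : MvPolynomial ι R) (v : ι → A) (i : ι)
    (h : ∃ g₀ g₁ : A, ∀ t : A,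
      MvPolynomial.aeval (v + t • Pi.single i 1) F = t ^ 2 * (g₀ + g₁ * t)) :
    MvPolynomial.aeval v (MvPolynomial.pderiv i F) = 0 := by
  obtain ⟨g₀, g₁, h⟩ := h
  let φ : ι → Polynomial A := fun j => Polynomial.C (v j) +
    Polynomial.X * Polynomial.C (Pi.single (M := fun _ => A) i 1 j)
  have hφ : ∀ t, (fun j => (φ j).eval t) = v + t • Pi.single i 1 := by
    intro t
    ext j
    simp only [φ, Polynomial.eval_add, Polynomial.eval_mul, Polynomial.eval_C, Polynomial.eval_X,
      Pi.add_apply, Pi.smul_apply, smul_eq_mul]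
  have key : MvPolynomial.aeval φ F =
      Polynomial.X ^ 2 * (Polynomial.C g₀ + Polynomial.C g₁ * Polynomial.X) := by
    apply Polynomial.funext
    intro t
    rw [eval_aeval_polynomial, hφ, h]
    simp
  have h1 := eval_derivative_aeval_polynomial F φ 0 i fun j => by simp [φ]
  rw [hφ, zero_smul, add_zero, key] at h1
  rw [← h1]
  simp [Polynomial.derivative_mul]

/-- A cubic form is the restriction of a trilinear form to the diagonal. -/
theorem exists_aeval_eq_sum {F : MvPolynomial (Fin 4) ℝ} (hF : F.IsHomogeneous 3) :
    ∃ k : Fin 4 → Fin 4 → Fin 4 → ℝ, ∀ x : Fin 4 → ℂ,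
      MvPolynomial.aeval x F = ∑ i, ∑ j, ∑ l, (k i j l : ℂ) * (x i * x j * x l) := by
  have hm : ∀ m ∈ F.support, ∃ i j l, ∀ x : Fin 4 → ℂ,
      (m.prod fun i n => x i ^ n) = x i * x j * x l := by
    intro m hm
    have hdeg : Multiset.card (Finsupp.toMultiset m) = 3 := by
      rw [Finsupp.card_toMultiset, ← hF (MvPolynomial.mem_support_iff.1 hm), Finsupp.weight_apply]
      simp [Finsupp.sum]
    obtain ⟨i, j, l, h⟩ := Multiset.card_eq_three.1 hdeg
    refine ⟨i, j, l, fun x => ?_⟩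
    have hm' : m = Finsupp.single i 1 + Finsupp.single j 1 + Finsupp.single l 1 := by
      rw [← EmbeddingLike.apply_eq_iff_eq Multiset.toFinsupp.symm]
      change Finsupp.toMultiset _ = Finsupp.toMultiset _
      rw [h]
      simp only [map_add, Finsupp.toMultiset_single, one_smul]
      rfl
    rw [hm', Finsupp.prod_add_index', Finsupp.prod_add_index', Finsupp.prod_single_index,
      Finsupp.prod_single_index, Finsupp.prod_single_index] <;> simp [pow_add]
  have key : ∀ s ⊆ F.support, ∃ k : Fin 4 → Fin 4 → Fin 4 → ℝ, ∀ x : Fin 4 → ℂ,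
      ∑ m ∈ s, ((F.coeff m : ℝ) : ℂ) * (m.prod fun i n => x i ^ n) =
        ∑ i, ∑ j, ∑ l, (k i j l : ℂ) * (x i * x j * x l) := by
    intro s
    induction s using Finset.induction_on with
    | empty => exact fun _ => ⟨0, fun x => by simp⟩
    | insert m s hms ih =>
      intro hs
      obtain ⟨k, hk⟩ := ih fun a ha => hs (Finset.mem_insert_of_mem ha)
      obtain ⟨i, j, l, h⟩ := hm m (hs (Finset.mem_insert_self _ _))
      refine ⟨fun i' j' l' => (if i' = i then if j' = j then if l' = l then F.coeff m else 0
        else 0 else 0) + k i' j' l', fun x => ?_⟩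
      rw [Finset.sum_insert hms, hk, h]
      simp only [Complex.ofReal_add, add_mul, Finset.sum_add_distrib]
      congr 1
      simp [apply_ite Complex.ofReal, ite_mul, Finset.sum_ite_eq']
  obtain ⟨k, hk⟩ := key F.support (Finset.Subset.refl _)
  refine ⟨k, fun x => ?_⟩
  rw [← hk, MvPolynomial.aeval_def, MvPolynomial.eval₂_eq]
  rfl

/-- The complexification of a real linear automorphism. -/
def complexMap (e : (Fin 4 → ℝ) ≃ₗ[ℝ] (Fin 4 → ℝ)) : (Fin 4 → ℂ) →ₗ[ℂ] (Fin 4 → ℂ) :=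
  Fintype.linearCombination ℂ fun j => complexify (e (Pi.single j 1))

theorem complexMap_apply (e : (Fin 4 → ℝ) ≃ₗ[ℝ] (Fin 4 → ℝ)) (x : Fin 4 → ℂ) (i : Fin 4) :
    complexMap e x i = ∑ j, (e (Pi.single j 1) i : ℂ) * x j := by
  simp [complexMap, Fintype.linearCombination_apply, complexify_apply, mul_comm]

theorem complexMap_complexify (e : (Fin 4 → ℝ) ≃ₗ[ℝ] (Fin 4 → ℝ)) (v : Fin 4 → ℝ) :
    complexMap e (complexify v) = complexify (e v) := by
  ext i
  rw [complexMap_apply]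
  have h : v = ∑ j, v j • Pi.single j 1 := by
    ext i
    simp [Finset.sum_apply, Pi.single_apply]
  conv_rhs => rw [h]
  simp [complexify_apply, Finset.sum_apply, mul_comm]

theorem complexMap_complexMap_symm (e : (Fin 4 → ℝ) ≃ₗ[ℝ] (Fin 4 → ℝ)) (x : Fin 4 → ℂ) :
    complexMap e (complexMap e.symm x) = x := by
  have h : complexMap e ∘ₗ complexMap e.symm = LinearMap.id := by
    refine LinearMap.pi_ext' fun i => LinearMap.ext_ring ?_
    have h1 : (Pi.single i 1 : Fin 4 → ℂ) = complexify (Pi.single i 1) := by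
      ext j
      rw [complexify_apply, Pi.single_apply, Pi.single_apply]
      split_ifs <;> simp
    change complexMap e (complexMap e.symm (Pi.single i 1)) = Pi.single i 1
    rw [h1, complexMap_complexify, complexMap_complexify, LinearEquiv.apply_symm_apply]
  exact LinearMap.congr_fun h x

theorem exists_aeval_complexMap_eq_sum {F : MvPolynomial (Fin 4) ℝ} (hF : F.IsHomogeneous 3)
    (e : (Fin 4 → ℝ) ≃ₗ[ℝ] (Fin 4 → ℝ)) :
    ∃ k : Fin 4 → Fin 4 → Fin 4 → ℝ, ∀ x : Fin 4 → ℂ,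
      MvPolynomial.aeval (complexMap e x) F =
        ∑ i, ∑ j, ∑ l, (k i j l : ℂ) * (x i * x j * x l) := by
  let φ : Fin 4 → MvPolynomial (Fin 4) ℝ := fun i =>
    ∑ j, MvPolynomial.C (e (Pi.single j 1) i) * MvPolynomial.X j
  have hφ : (MvPolynomial.aeval φ F).IsHomogeneous 3 := by
    refine hF.aeval φ (n := 1) fun i => MvPolynomial.IsHomogeneous.sum _ _ _ fun j _ => ?_
    exact MvPolynomial.isHomogeneous_C_mul_X _ _
  obtain ⟨k, hk⟩ := exists_aeval_eq_sum hφ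
  refine ⟨k, fun x => ?_⟩
  rw [← hk, ← AlgHom.comp_apply, MvPolynomial.comp_aeval]
  congr 2
  ext i
  simp [φ, complexMap_apply]

end CubicForms

/-! ### Coordinates adapted to a node -/

section NodeCoordinates

theorem eq_mk_of_mem {p : P3} {v : Fin 4 → ℂ} (hv : v ≠ 0) (h : v ∈ p.submodule) :
    p = Projectivization.mk ℂ v hv := by
  induction p using Projectivization.ind with
  | h w hw =>
    rw [Projectivization.submodule_mk, Submodule.mem_span_singleton] at h
    obtain ⟨a, rfl⟩ := h
    rw [Projectivization.mk_eq_mk_iff']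
    have ha : a ≠ 0 := by
      rintro rfl
      exact hv (zero_smul _ _)
    exact ⟨a⁻¹, by rw [smul_smul, inv_mul_cancel₀ ha, one_smul]⟩

variable {F : MvPolynomial (Fin 4) ℝ} {p : P3}

theorem isSingularPoint_mk (hF : F.IsHomogeneous 3) {v : Fin 4 → ℂ} (hv : v ≠ 0)
    (h0 : MvPolynomial.aeval v F = 0)
    (h : ∀ i, MvPolynomial.aeval v (MvPolynomial.pderiv i F) = 0) :
    IsSingularPoint F (Projectivization.mk ℂ v hv) := by
  refine ⟨(mk_mem_hypersurface hF hv).2 h0, fun w hw i => ?_⟩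
  rw [Projectivization.submodule_mk, Submodule.mem_span_singleton] at hw
  obtain ⟨a, rfl⟩ := hw
  rw [aeval_smul_of_isHomogeneous hF.pderiv, h, mul_zero]

theorem IsNode.isSingularPoint (hF : F.IsHomogeneous 3) (hp : IsNode F p) :
    IsSingularPoint F p := by
  obtain ⟨e, f₂, f₃, hmem, h₂, h₃, h, -⟩ := hp
  have hne : e (Pi.single 0 1) ≠ 0 := e.map_ne_zero_iff.2 (by simp)
  have hline : ∀ u : Fin 4 → ℂ, ∃ g₀ g₁ : ℂ, ∀ t : ℂ,
      MvPolynomial.aeval (e (Pi.single 0 1) + t • u) F = t ^ 2 * (g₀ + g₁ * t) := by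
    intro u
    obtain ⟨u, rfl⟩ := e.surjective u
    refine ⟨MvPolynomial.eval (Fin.tail u) f₂,
      u 0 * MvPolynomial.eval (Fin.tail u) f₂ + MvPolynomial.eval (Fin.tail u) f₃, fun t => ?_⟩
    have h1 : (Pi.single 0 1 + t • u : Fin 4 → ℂ) = Fin.cons (1 + t * u 0) (t • Fin.tail u) := by
      ext i
      refine Fin.cases ?_ (fun j => ?_) i <;> simp [Fin.tail]
    rw [← map_smul, ← map_add, h1, h]
    have e2 : MvPolynomial.eval (t • Fin.tail u) f₂ = t ^ 2 * MvPolynomial.eval (Fin.tail u) f₂ :=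
      aeval_smul_of_isHomogeneous h₂ t (Fin.tail u)
    have e3 : MvPolynomial.eval (t • Fin.tail u) f₃ = t ^ 3 * MvPolynomial.eval (Fin.tail u) f₃ :=
      aeval_smul_of_isHomogeneous h₃ t (Fin.tail u)
    rw [e2, e3]
    ring
  rw [eq_mk_of_mem hne hmem]
  refine isSingularPoint_mk hF hne ?_ fun i => aeval_pderiv_eq_zero F _ i (hline _)
  obtain ⟨g₀, g₁, hg⟩ := hline 0
  simpa using hg 0

theorem aeval_star (F : MvPolynomial (Fin 4) ℝ) (v : Fin 4 → ℂ) :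
    MvPolynomial.aeval (star v) F = star (MvPolynomial.aeval v F) := by
  have := DFunLike.congr_fun (MvPolynomial.comp_aeval v Complex.conjAe.toAlgHom) F
  exact this.symm

/-- The only singular point of a real surface is real: it is invariant under complex conjugation. -/
theorem IsSingularPoint.exists_real (hp : IsSingularPoint F p)
    (huniq : ∀ x, IsSingularPoint F x → x = p) :
    ∃ v₀ : Fin 4 → ℝ, v₀ ≠ 0 ∧ p.submodule = ℂ ∙ complexify v₀ := by
  induction p using Projectivization.ind with
  | h v hv =>
    have hsv : star v ≠ 0 := star_ne_zero.2 hv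
    have h1 : IsSingularPoint F (Projectivization.mk ℂ (star v) hsv) := by
      have hmem : ∀ w ∈ (Projectivization.mk ℂ (star v) hsv).submodule,
          star w ∈ (Projectivization.mk ℂ v hv).submodule := by
        intro w hw
        rw [Projectivization.submodule_mk, Submodule.mem_span_singleton] at hw ⊢
        obtain ⟨a, rfl⟩ := hw
        exact ⟨star a, by rw [star_smul, star_star]⟩
      refine ⟨fun w hw => ?_, fun w hw i => ?_⟩
      · rw [← star_eq_zero, ← aeval_star]
        exact hp.1 _ (hmem w hw)
      · rw [← star_eq_zero, ← aeval_star]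
        exact hp.2 _ (hmem w hw) i
    obtain ⟨c, hc⟩ := (Projectivization.mk_eq_mk_iff' ℂ _ _ hsv hv).1 (huniq _ h1)
    obtain ⟨i, hi⟩ := Function.ne_iff.1 hv
    have hi' : v i ≠ 0 := hi
    have hreal : ∀ j, star (star (v i) * v j) = star (v i) * v j := by
      intro j
      have e1 : c * v i = star (v i) := congrFun hc i
      have e2 : c * v j = star (v j) := congrFun hc j
      rw [star_mul, star_star, ← e1, ← e2]
      ring
    have hcx : complexify (fun j => (star (v i) * v j).re) = star (v i) • v := by
      ext j
      exact Complex.conj_eq_iff_re.1 (hreal j)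
    have hsi : star (v i) ≠ 0 := star_ne_zero.2 hi'
    refine ⟨fun j => (star (v i) * v j).re, fun h0 => ?_, ?_⟩
    · rw [h0, map_zero] at hcx
      exact smul_ne_zero hsi hv hcx.symm
    · rw [hcx, Projectivization.submodule_mk]
      exact (Submodule.span_singleton_smul_eq hsi.isUnit v).symm

/-- The ternary quadratic form with coefficients `s`; those of the mixed terms are doubled. -/
def quadForm {K : Type*} [CommRing K] (s : Fin 6 → K) (w : Fin 3 → K) : K :=
  s 0 * w 0 ^ 2 + s 1 * w 1 ^ 2 + s 2 * w 2 ^ 2 +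
    2 * (s 3 * w 1 * w 2 + s 4 * w 0 * w 2 + s 5 * w 0 * w 1)

/-- The symmetric matrix of `quadForm s`. -/
def gramMatrix {K : Type*} (s : Fin 6 → K) : Matrix (Fin 3) (Fin 3) K :=
  !![s 0, s 5, s 4; s 5, s 1, s 3; s 4, s 3, s 2]

/-- The ternary cubic form with coefficients `k`. -/
def cubicForm {K : Type*} [CommRing K] (k : Fin 10 → K) (w : Fin 3 → K) : K :=
  k 0 * w 0 ^ 3 + k 1 * w 1 ^ 3 + k 2 * w 2 ^ 3 + k 3 * w 0 ^ 2 * w 1 + k 4 * w 0 ^ 2 * w 2 +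
    k 5 * w 0 * w 1 ^ 2 + k 6 * w 1 ^ 2 * w 2 + k 7 * w 0 * w 2 ^ 2 + k 8 * w 1 * w 2 ^ 2 +
    k 9 * w 0 * w 1 * w 2

theorem quadForm_add_smul_of_mulVec_eq_zero {K : Type*} [CommRing K] {s : Fin 6 → K}
    {w : Fin 3 → K} (hw : (gramMatrix s).mulVec w = 0) (w' : Fin 3 → K) (t : K) :
    quadForm s (w + t • w') = t ^ 2 * quadForm s w' := by
  have h0 := congrFun hw 0
  have h1 := congrFun hw 1
  have h2 := congrFun hw 2
  simp [gramMatrix, Matrix.mulVec, dotProduct, Fin.sum_univ_three] at h0 h1 h2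
  simp only [quadForm, Pi.add_apply, Pi.smul_apply, smul_eq_mul]
  linear_combination (w 0 + 2 * t * w' 0) * h0 + (w 1 + 2 * t * w' 1) * h1 +
    (w 2 + 2 * t * w' 2) * h2

/-- The expansion of a quaternary cubic by powers of the first variable. -/
theorem exists_forms_of_sum (k : Fin 4 → Fin 4 → Fin 4 → ℝ) :
    ∃ (c : ℝ) (m : Fin 3 → ℝ) (s : Fin 6 → ℝ) (k' : Fin 10 → ℝ), ∀ (u : ℂ) (w : Fin 3 → ℂ),
      (∑ i, ∑ j, ∑ l, (k i j l : ℂ) * ((Fin.cons u w : Fin 4 → ℂ) i *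
        (Fin.cons u w : Fin 4 → ℂ) j * (Fin.cons u w : Fin 4 → ℂ) l)) =
      c * u ^ 3 + (m 0 * w 0 + m 1 * w 1 + m 2 * w 2) * u ^ 2 +
        u * quadForm (fun i => (s i : ℂ)) w + cubicForm (fun i => (k' i : ℂ)) w := by
  refine ⟨k 0 0 0, ![k 0 0 1 + k 0 1 0 + k 1 0 0, k 0 0 2 + k 0 2 0 + k 2 0 0,
    k 0 0 3 + k 0 3 0 + k 3 0 0], ![k 0 1 1 + k 1 0 1 + k 1 1 0, k 0 2 2 + k 2 0 2 + k 2 2 0,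
    k 0 3 3 + k 3 0 3 + k 3 3 0,
    (k 0 2 3 + k 0 3 2 + k 2 0 3 + k 3 0 2 + k 2 3 0 + k 3 2 0) / 2,
    (k 0 1 3 + k 0 3 1 + k 1 0 3 + k 3 0 1 + k 1 3 0 + k 3 1 0) / 2,
    (k 0 1 2 + k 0 2 1 + k 1 0 2 + k 2 0 1 + k 1 2 0 + k 2 1 0) / 2],
    ![k 1 1 1, k 2 2 2, k 3 3 3, k 1 1 2 + k 1 2 1 + k 2 1 1, k 1 1 3 + k 1 3 1 + k 3 1 1,
      k 1 2 2 + k 2 1 2 + k 2 2 1, k 2 2 3 + k 2 3 2 + k 3 2 2, k 1 3 3 + k 3 1 3 + k 3 3 1,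
      k 2 3 3 + k 3 2 3 + k 3 3 2,
      k 1 2 3 + k 1 3 2 + k 2 1 3 + k 2 3 1 + k 3 1 2 + k 3 2 1], fun u w => ?_⟩
  have c1 : (Fin.cons u w : Fin 4 → ℂ) 1 = w 0 := rfl
  have c2 : (Fin.cons u w : Fin 4 → ℂ) 2 = w 1 := rfl
  have c3 : (Fin.cons u w : Fin 4 → ℂ) 3 = w 2 := rfl
  simp only [Fin.sum_univ_four, Fin.cons_zero, c1, c2, c3, quadForm, cubicForm,
    Matrix.cons_val]
  push_cast
  ring

/-- Comparison of the coefficients of `u³`, `u²` and `u`. -/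
theorem coeff_eq_of_cubic_eq_linear {c l q k α β : ℂ}
    (h : ∀ u : ℂ, c * u ^ 3 + l * u ^ 2 + u * q + k = u * α + β) :
    c = 0 ∧ l = 0 ∧ q = α := by
  have h0 := h 0
  have h1 := h 1
  have h2 := h (-1)
  have h3 := h 2
  refine ⟨?_, ?_, ?_⟩
  · linear_combination (h0 / 2 - h1 / 2 - h2 / 6 + h3 / 6)
  · linear_combination (-h0 + h1 / 2 + h2 / 2)
  · linear_combination (-h0 / 2 + h1 - h2 / 3 - h3 / 6)

/-- In suitable real coordinates the equation of the surface is `u Q(x, y, z) + K(x, y, z) = 0` with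
a non-degenerate quadratic form `Q`. The complex coordinates in the definition of a node show that
the equation is linear in `u`, and that `Q` is up to a factor the given non-singular conic. -/
theorem exists_coordinates (hF : IsOneNodalCubic F p) :
    ∃ (s : Fin 6 → ℝ) (k : Fin 10 → ℝ), (gramMatrix s).det ≠ 0 ∧
      Nonempty (Coordinates F p fun v => v 0 * quadForm s (Fin.tail v) +
        cubicForm k (Fin.tail v)) := by
  obtain ⟨v₀, hv₀, hspan⟩ :=
    (hF.node.isSingularPoint hF.homogeneous).exists_real hF.singular
  obtain ⟨e', he'⟩ := SeparatingDual.exists_continuousLinearEquiv_apply_eq (R := ℝ)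
    (x := (Pi.single 0 1 : Fin 4 → ℝ)) (y := v₀) (by simp) hv₀
  set e : (Fin 4 → ℝ) ≃ₗ[ℝ] (Fin 4 → ℝ) := e'.toLinearEquiv with he_def
  have he : e (Pi.single 0 1) = v₀ := he'
  obtain ⟨k₀, hk₀⟩ := exists_aeval_complexMap_eq_sum hF.homogeneous e
  obtain ⟨c, m, s, k, hsk⟩ := exists_forms_of_sum k₀
  obtain ⟨n, f₂, f₃, hmem, h₂, h₃, hn, hns⟩ := hF.node
  rw [hspan, Submodule.mem_span_singleton] at hmem
  obtain ⟨ν, hν⟩ := hmem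
  have hν0 : ν ≠ 0 := by
    rintro rfl
    rw [zero_smul] at hν
    have := n.map_eq_zero_iff.1 hν.symm
    simp at this
  -- the change of basis `T` between the real coordinates and the given complex ones fixes the
  -- line spanned by the first basis vector
  set T : (Fin 4 → ℂ) →ₗ[ℂ] (Fin 4 → ℂ) := n.symm.toLinearMap ∘ₗ complexMap e with hT
  have hnT : ∀ x, n (T x) = complexMap e x := fun x => n.apply_symm_apply _
  have hsingle : (Pi.single 0 1 : Fin 4 → ℂ) = complexify (Pi.single 0 1) := by
    ext j
    rw [complexify_apply, Pi.single_apply, Pi.single_apply]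
    split_ifs <;> simp
  have hT0 : T (Pi.single 0 1) = ν⁻¹ • Pi.single 0 1 := by
    apply n.injective
    rw [hnT, map_smul, ← hν, smul_smul, inv_mul_cancel₀ hν0, one_smul, hsingle,
      complexMap_complexify, he]
  have hTinj : Function.Injective T := by
    refine n.symm.injective.comp (Function.LeftInverse.injective (g := complexMap e.symm) ?_)
    exact fun x => complexMap_complexMap_symm e.symm x
  have hTsurj : Function.Surjective T := by
    refine n.symm.surjective.comp (Function.RightInverse.surjective (g := complexMap e.symm) ?_)
    exact fun x => complexMap_complexMap_symm e x
  have hcons : ∀ (u : ℂ) (w : Fin 3 → ℂ), T (Fin.cons u w) =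
      (u * ν⁻¹) • Pi.single 0 1 + T (Fin.cons 0 w) := by
    intro u w
    rw [mul_smul, ← hT0, ← map_smul, ← map_add]
    congr 1
    ext i
    refine Fin.cases ?_ (fun j => ?_) i <;> simp
  set ω : (Fin 3 → ℂ) → (Fin 3 → ℂ) := fun w => Fin.tail (T (Fin.cons 0 w)) with hω
  have htail : ∀ u w, Fin.tail (T (Fin.cons u w)) = ω w := by
    intro u w
    rw [hcons]
    ext i
    simp [hω, Fin.tail]
  have hωadd : ∀ (w w' : Fin 3 → ℂ) (t : ℂ), ω (w + t • w') = ω w + t • ω w' := by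
    intro w w' t
    have : (Fin.cons 0 (w + t • w') : Fin 4 → ℂ) = Fin.cons 0 w + t • Fin.cons 0 w' := by
      ext i
      refine Fin.cases ?_ (fun j => ?_) i <;> simp
    simp only [hω]
    rw [this, map_add, map_smul]
    rfl
  have hFT : ∀ u w, MvPolynomial.aeval (complexMap e (Fin.cons u w)) F =
      u * (ν⁻¹ * MvPolynomial.eval (ω w) f₂) + (T (Fin.cons 0 w) 0 * MvPolynomial.eval (ω w) f₂ +
        MvPolynomial.eval (ω w) f₃) := by
    intro u w
    rw [← hnT, ← Fin.cons_self_tail (T (Fin.cons u w)), hn, htail, hcons]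
    simp only [Pi.add_apply, Pi.smul_apply, Pi.single_eq_same, smul_eq_mul]
    ring
  have hcoef : ∀ w : Fin 3 → ℂ, (c : ℂ) = 0 ∧ (m 0 * w 0 + m 1 * w 1 + m 2 * w 2 : ℂ) = 0 ∧
      quadForm (fun i => (s i : ℂ)) w = ν⁻¹ * MvPolynomial.eval (ω w) f₂ := by
    intro w
    refine coeff_eq_of_cubic_eq_linear (k := cubicForm (fun i => (k i : ℂ)) w)
      (β := T (Fin.cons 0 w) 0 * MvPolynomial.eval (ω w) f₂ + MvPolynomial.eval (ω w) f₃) ?_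
    intro u
    rw [← hFT, hk₀, hsk]
  refine ⟨s, k, fun hdet => ?_, ⟨⟨e, fun v => ?_, by rw [hspan, he]⟩⟩⟩
  · have hdet' : (gramMatrix fun i => (s i : ℂ)).det = 0 := by
      have : (gramMatrix fun i => (s i : ℂ)) = (gramMatrix s).map (algebraMap ℝ ℂ) := by
        ext i j
        fin_cases i <;> fin_cases j <;> rfl
      rw [this, ← RingHom.mapMatrix_apply, ← RingHom.map_det, hdet, map_zero]
    obtain ⟨w, hw0, hw⟩ := Matrix.exists_mulVec_eq_zero_iff.2 hdet'
    have hquad : ∀ (w' : Fin 3 → ℂ) (t : ℂ), MvPolynomial.eval (ω w + t • ω w') f₂ =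
        t ^ 2 * (ν * quadForm (fun i => (s i : ℂ)) w') := by
      intro w' t
      have h1 := (hcoef (w + t • w')).2.2
      rw [quadForm_add_smul_of_mulVec_eq_zero hw, hωadd] at h1
      rw [mul_left_comm, h1, mul_inv_cancel_left₀ hν0]
    have hωw : ω w ≠ 0 := by
      intro h0
      have h1 : T (Fin.cons 0 w) = (T (Fin.cons 0 w) 0 * ν) • T (Pi.single 0 1) := by
        rw [hT0, smul_smul, mul_assoc, mul_inv_cancel₀ hν0, mul_one]
        ext i
        refine Fin.cases ?_ (fun j => ?_) i
        · simp
        · rw [Pi.smul_apply, Pi.single_eq_of_ne (Fin.succ_ne_zero j), smul_zero]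
          exact congrFun h0 j
      rw [← map_smul] at h1
      have h2 := hTinj h1
      apply hw0
      ext j
      simpa using congrFun h2 j.succ
    obtain ⟨i, hi⟩ := hns (ω w) hωw (by simpa using hquad 0 0)
    refine hi (aeval_pderiv_eq_zero (A := ℂ) f₂ (ω w) i ?_)
    obtain ⟨x, hx⟩ := hTsurj (Fin.cons 0 (Pi.single i 1))
    have hx' : ω (Fin.tail x) = Pi.single i 1 := by
      rw [← htail (x 0), Fin.cons_self_tail, hx, Fin.tail_cons]
    refine ⟨ν * quadForm (fun i => (s i : ℂ)) (Fin.tail x), 0, fun t => ?_⟩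
    rw [← hx', zero_mul, add_zero]
    exact hquad _ t
  · have h1 : complexify v = Fin.cons ((v 0 : ℝ) : ℂ) fun j => ((Fin.tail v j : ℝ) : ℂ) := by
      ext i
      refine Fin.cases ?_ (fun j => ?_) i <;> simp [complexify_apply, Fin.tail]
    rw [← complexMap_complexify, h1, hk₀, hsk, (hcoef 0).1,
      (hcoef fun j => ((Fin.tail v j : ℝ) : ℂ)).2.1]
    simp only [quadForm, cubicForm]
    push_cast
    ring

end NodeCoordinates

/-! ### Frames for a plane conic -/

section ConicFrames

open scoped Matrix

section Frames

variable {K : Type*} [Field K] {s : Fin 6 → K}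

theorem gramMatrix_mulVec (s : Fin 6 → K) (v : Fin 3 → K) : gramMatrix s *ᵥ v =
    ![s 0 * v 0 + s 5 * v 1 + s 4 * v 2, s 5 * v 0 + s 1 * v 1 + s 3 * v 2,
      s 4 * v 0 + s 3 * v 1 + s 2 * v 2] := by
  ext i
  fin_cases i <;> simp [gramMatrix, Matrix.mulVec, dotProduct, Fin.sum_univ_three]

theorem gramMatrix_det (s : Fin 6 → K) : (gramMatrix s).det =
    s 0 * s 1 * s 2 + 2 * s 3 * s 4 * s 5 - s 0 * s 3 ^ 2 - s 1 * s 4 ^ 2 - s 2 * s 5 ^ 2 := by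
  rw [Matrix.det_fin_three]
  simp only [gramMatrix, Matrix.of_apply, Matrix.cons_val]
  ring

/-- The symmetric bilinear form with `polarForm s v v = quadForm s v`. -/
def polarForm (s : Fin 6 → K) (v w : Fin 3 → K) : K := v ⬝ᵥ gramMatrix s *ᵥ w

theorem polarForm_eq (s : Fin 6 → K) (v w : Fin 3 → K) : polarForm s v w =
    v 0 * (s 0 * w 0 + s 5 * w 1 + s 4 * w 2) + v 1 * (s 5 * w 0 + s 1 * w 1 + s 3 * w 2) +
      v 2 * (s 4 * w 0 + s 3 * w 1 + s 2 * w 2) := by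
  simp [polarForm, gramMatrix_mulVec, dotProduct, Fin.sum_univ_three]

theorem quadForm_comb (s : Fin 6 → K) (a b c : Fin 3 → K) (x y z : K) :
    quadForm s (x • a + y • b + z • c) = x ^ 2 * quadForm s a + y ^ 2 * quadForm s b +
      z ^ 2 * quadForm s c + 2 * (x * y * polarForm s a b + x * z * polarForm s a c +
        y * z * polarForm s b c) := by
  simp only [quadForm, polarForm_eq, Pi.add_apply, Pi.smul_apply, smul_eq_mul]
  ring

/-- A vector orthogonal to `a` and `c` with respect to `polarForm s`, namely the cross product of
their images under the matrix of the form. -/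
def polarCross (s : Fin 6 → K) (a c : Fin 3 → K) : Fin 3 → K :=
  (gramMatrix s *ᵥ a) ⨯₃ (gramMatrix s *ᵥ c)

theorem polarForm_polarCross (s : Fin 6 → K) (a c : Fin 3 → K) :
    polarForm s a (polarCross s a c) = 0 ∧ polarForm s c (polarCross s a c) = 0 := by
  simp only [polarForm_eq, polarCross, gramMatrix_mulVec, cross_apply, Matrix.cons_val]
  constructor <;> ring

theorem polarForm_comm (s : Fin 6 → K) (a b : Fin 3 → K) : polarForm s a b = polarForm s b a := by
  simp only [polarForm_eq]
  ring

theorem quadForm_polarCross (s : Fin 6 → K) (a c : Fin 3 → K) :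
    quadForm s (polarCross s a c) =
      (gramMatrix s).det * (quadForm s a * quadForm s c - polarForm s a c ^ 2) := by
  simp only [quadForm, gramMatrix_det, polarForm_eq, polarCross, gramMatrix_mulVec, cross_apply,
    Matrix.cons_val]
  ring

/-- A non-degenerate conic with a point `a` has the equation `x z = y²` in suitable coordinates. -/
theorem exists_isotropic_frame [CharZero K] (hs : (gramMatrix s).det ≠ 0) {a : Fin 3 → K}
    (ha : a ≠ 0) (hQa : quadForm s a = 0) :
    ∃ (b c : Fin 3 → K) (κ : K), κ ≠ 0 ∧
      ∀ x y z : K, quadForm s (x • a + y • b + z • c) = κ * (x * z - y ^ 2) := by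
  obtain ⟨d, hd⟩ : ∃ d, polarForm s d a ≠ 0 := by
    by_contra! h
    refine ha (Matrix.eq_zero_of_mulVec_eq_zero hs ?_)
    ext i
    simpa [polarForm] using h (Pi.single i 1)
  set ρ := polarForm s d a with hρ
  -- `c₀` is the second isotropic vector in the plane spanned by `a` and `d`
  set c₀ := d - (quadForm s d / (2 * ρ)) • a with hc₀
  have hac : polarForm s a c₀ = ρ := by
    have : polarForm s a c₀ = polarForm s d a - quadForm s d / (2 * ρ) * quadForm s a := by
      simp only [hc₀, quadForm, polarForm_eq, Pi.sub_apply, Pi.smul_apply, smul_eq_mul]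
      ring
    rw [this, hQa, mul_zero, sub_zero]
  have hQc : quadForm s c₀ = 0 := by
    have : quadForm s c₀ = quadForm s d - 2 * (quadForm s d / (2 * ρ)) * polarForm s d a +
        (quadForm s d / (2 * ρ)) ^ 2 * quadForm s a := by
      simp only [hc₀, quadForm, polarForm_eq, Pi.sub_apply, Pi.smul_apply, smul_eq_mul]
      ring
    rw [this, hQa, ← hρ]
    field_simp
    ring
  have hQb := quadForm_polarCross s a c₀
  rw [hQa, hac] at hQb
  obtain ⟨h1, h2⟩ := polarForm_polarCross s a c₀
  refine ⟨polarCross s a c₀, ((gramMatrix s).det * ρ / 2) • c₀, (gramMatrix s).det * ρ ^ 2,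
    mul_ne_zero hs (pow_ne_zero 2 hd), fun x y z => ?_⟩
  rw [smul_smul, quadForm_comb, hQa, hQb, hQc, h1, polarForm_comm s (polarCross s a c₀) c₀, h2, hac]
  field_simp
  ring

/-- The vectors of such a frame are independent because the form `x z - y²` is non-degenerate. -/
theorem eq_zero_of_isotropic_frame {a b c : Fin 3 → K} {κ : K} (hκ : κ ≠ 0)
    (h : ∀ x y z : K, quadForm s (x • a + y • b + z • c) = κ * (x * z - y ^ 2)) (x y z : K)
    (h0 : x • a + y • b + z • c = 0) : x = 0 ∧ y = 0 ∧ z = 0 := by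
  have key : ∀ x' y' z' : K, (x + x') * (z + z') - (y + y') ^ 2 = x' * z' - y' ^ 2 := by
    intro x' y' z'
    apply mul_left_cancel₀ hκ
    rw [← h, ← h]
    congr 1
    calc (x + x') • a + (y + y') • b + (z + z') • c
        = (x • a + y • b + z • c) + (x' • a + y' • b + z' • c) := by module
      _ = x' • a + y' • b + z' • c := by rw [h0, zero_add]
  have e0 := key 0 0 0
  have e1 := key 1 0 0
  have e2 := key 0 0 1
  have hx : x = 0 := by linear_combination e2 - e0
  have hz : z = 0 := by linear_combination e1 - e0
  refine ⟨hx, ?_, hz⟩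
  rw [hx, hz] at e0
  simpa using e0

theorem exists_cubicForm_comb [CharZero K] (k : Fin 10 → K) (a b c : Fin 3 → K) :
    ∃ k' : Fin 10 → K, ∀ x y z : K,
      cubicForm k (x • a + y • b + z • c) = cubicForm k' ![x, y, z] := by
  -- the coefficients are found by polarization
  let T : (Fin 3 → K) → (Fin 3 → K) → K := fun v w =>
    (cubicForm k (v + w) - cubicForm k (v - w)) / 2 - cubicForm k w
  refine ⟨![cubicForm k a, cubicForm k b, cubicForm k c, T a b, T a c, T b a, T b c, T c a, T c b,
    cubicForm k (a + b + c) - cubicForm k (a + b) - cubicForm k (a + c) - cubicForm k (b + c) +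
      cubicForm k a + cubicForm k b + cubicForm k c], fun x y z => ?_⟩
  simp only [T, cubicForm, Pi.add_apply, Pi.sub_apply, Pi.smul_apply, smul_eq_mul, Matrix.cons_val]
  ring

/-- Over `ℂ`, a non-degenerate conic and a cubic have a common point. -/
theorem exists_common_zero {s : Fin 6 → ℂ} (hs : (gramMatrix s).det ≠ 0) (k : Fin 10 → ℂ) :
    ∃ ζ : Fin 3 → ℂ, ζ ≠ 0 ∧ quadForm s ζ = 0 ∧ cubicForm k ζ = 0 := by
  obtain ⟨a, ha, hQa⟩ : ∃ a : Fin 3 → ℂ, a ≠ 0 ∧ quadForm s a = 0 := by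
    by_cases h0 : s 0 = 0
    · exact ⟨![1, 0, 0], fun h => one_ne_zero (congrFun h 0), by simp [quadForm, h0]⟩
    · obtain ⟨r, hr⟩ := IsAlgClosed.exists_pow_nat_eq (s 5 ^ 2 - s 0 * s 1) two_pos
      refine ⟨![(r - s 5) / s 0, 1, 0], fun h => one_ne_zero (congrFun h 1), ?_⟩
      simp only [quadForm, Matrix.cons_val]
      field_simp
      linear_combination hr
  obtain ⟨b, c, κ, hκ, hQ⟩ := exists_isotropic_frame hs ha hQa
  obtain ⟨k', hk'⟩ := exists_cubicForm_comb k a b c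
  by_cases h0 : k' 0 = 0
  · refine ⟨a, ha, hQa, ?_⟩
    have := hk' 1 0 0
    simpa [cubicForm, h0] using this
  · -- the conic is parametrized by `s² a + s b + c`, on which the cubic has degree six in `s`
    let P : Polynomial ℂ := .C (k' 0) * .X ^ 6 + .C (k' 3) * .X ^ 5 +
      .C (k' 4 + k' 5) * .X ^ 4 + .C (k' 1 + k' 9) * .X ^ 3 + .C (k' 6 + k' 7) * .X ^ 2 +
      .C (k' 8) * .X + .C (k' 2)
    have hP : P.natDegree = 6 := by
      simp only [P]
      compute_degree!
    obtain ⟨r, hr⟩ := IsAlgClosed.exists_root P (by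
      intro h
      rw [Polynomial.natDegree_eq_of_degree_eq_some (n := 0) h] at hP
      exact absurd hP (by norm_num))
    refine ⟨r ^ 2 • a + r • b + (1 : ℂ) • c, fun h => ?_, ?_, ?_⟩
    · exact one_ne_zero (eq_zero_of_isotropic_frame hκ hQ _ _ _ h).2.2
    · rw [hQ]
      ring
    · rw [hk']
      simp only [Polynomial.IsRoot, P, Polynomial.eval_add, Polynomial.eval_mul, Polynomial.eval_C,
        Polynomial.eval_pow, Polynomial.eval_X] at hr
      simp only [cubicForm, Matrix.cons_val]
      linear_combination hr

end Frames

/-- The change of coordinates given by a basis of the last three coordinates and a shear `l` of the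
first one. -/
theorem exists_equiv_of_frame {a b c : Fin 3 → ℝ}
    (h : ∀ x y z : ℝ, x • a + y • b + z • c = 0 → x = 0 ∧ y = 0 ∧ z = 0) {κ : ℝ} (hκ : κ ≠ 0)
    (l : Fin 3 → ℝ) : ∃ M : (Fin 4 → ℝ) ≃ₗ[ℝ] (Fin 4 → ℝ), ∀ v, M v =
      Fin.cons ((v 0 + l 0 * v 1 + l 1 * v 2 + l 2 * v 3) / κ) (v 1 • a + v 2 • b + v 3 • c) := by
  let N : (Fin 4 → ℝ) →ₗ[ℝ] (Fin 4 → ℝ) :=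
    { toFun := fun v => Fin.cons ((v 0 + l 0 * v 1 + l 1 * v 2 + l 2 * v 3) / κ)
        (v 1 • a + v 2 • b + v 3 • c)
      map_add' := fun v w => by
        ext i
        refine Fin.cases ?_ (fun j => ?_) i
        · simp only [Fin.cons_zero, Pi.add_apply]
          ring
        · simp only [Fin.cons_succ, Pi.add_apply, Pi.smul_apply, smul_eq_mul]
          ring
      map_smul' := fun r v => by
        ext i
        refine Fin.cases ?_ (fun j => ?_) i
        · simp only [Fin.cons_zero, Pi.smul_apply, smul_eq_mul, RingHom.id_apply]
          ring
        · simp only [Fin.cons_succ, Pi.add_apply, Pi.smul_apply, smul_eq_mul, RingHom.id_apply]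
          ring }
  have hN : Function.Injective N := by
    rw [← LinearMap.ker_eq_bot, LinearMap.ker_eq_bot']
    intro v hv
    have hv0 : (v 0 + l 0 * v 1 + l 1 * v 2 + l 2 * v 3) / κ = 0 := congrFun hv 0
    have hv1 : v 1 • a + v 2 • b + v 3 • c = 0 := by
      ext j
      simpa [N] using congrFun hv j.succ
    obtain ⟨h1, h2, h3⟩ := h _ _ _ hv1
    rw [h1, h2, h3, div_eq_zero_iff, or_iff_left hκ] at hv0
    ext i
    fin_cases i
    · simpa using hv0
    · exact h1
    · exact h2
    · exact h3
  exact ⟨LinearEquiv.ofInjectiveEndo N hN, fun v => rfl⟩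

namespace Coordinates

variable {F : MvPolynomial (Fin 4) ℝ} {p : P3} {f f' : (Fin 4 → ℝ) → ℝ}

/-- A further real change of coordinates which fixes the first coordinate axis. -/
def trans (E : Coordinates F p f) (M : (Fin 4 → ℝ) ≃ₗ[ℝ] (Fin 4 → ℝ)) {r : ℝ} (hr : r ≠ 0)
    (hM : M (Pi.single 0 1) = r • Pi.single 0 1) (hf : ∀ v, f (M v) = f' v) :
    Coordinates F p f' where
  equiv := M.trans E.equiv
  aeval_complexify v := by rw [LinearEquiv.trans_apply, E.aeval_complexify, hf]
  basepoint := by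
    rw [LinearEquiv.trans_apply, hM, map_smul, map_smulₛₗ, E.basepoint]
    exact (Submodule.span_singleton_smul_eq (by simpa using hr) _).symm

theorem aeval_complexify_eq_ofReal (G : MvPolynomial (Fin 4) ℝ) (v : Fin 4 → ℝ) :
    MvPolynomial.aeval (complexify v) G = ((MvPolynomial.aeval v G : ℝ) : ℂ) :=
  MvPolynomial.aeval_algebraMap_apply ℂ v G

/-- The surface has no singular point other than `p`: at no other real point does its equation
vanish to second order along all lines. -/
theorem not_forall_order_two (E : Coordinates F p f) (hF : IsOneNodalCubic F p) {v : Fin 4 → ℝ}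
    (hv : v 1 ≠ 0 ∨ v 2 ≠ 0 ∨ v 3 ≠ 0) :
    ¬ ∀ w : Fin 4 → ℝ, ∃ g₀ g₁ : ℝ, ∀ t : ℝ, f (v + t • w) = t ^ 2 * (g₀ + g₁ * t) := by
  intro h
  have hfv : f v = 0 := by
    obtain ⟨g₀, g₁, hg⟩ := h 0
    simpa using hg 0
  have hmem : v ∈ puncturedCone f := ⟨hfv, hv⟩
  have hv0 := ne_zero_of_mem_puncturedCone hmem
  have h1 := (E.mk_mem_iff hF.homogeneous hv0).2 hmem
  rw [realLocus, Set.mem_preimage, toComplex_mk] at h1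
  refine h1.2 (hF.singular _ (isSingularPoint_mk hF.homogeneous _ ?_ fun i => ?_))
  · rw [E.aeval_complexify, hfv, Complex.ofReal_zero]
  · rw [aeval_complexify_eq_ofReal, Complex.ofReal_eq_zero]
    apply aeval_pderiv_eq_zero
    obtain ⟨g₀, g₁, hg⟩ := h (E.equiv.symm (Pi.single i 1))
    refine ⟨g₀, g₁, fun t => ?_⟩
    rw [← hg, ← Complex.ofReal_inj, ← E.aeval_complexify, aeval_complexify_eq_ofReal, map_add,
      map_smul, LinearEquiv.apply_symm_apply]

end Coordinates

end ConicFrames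

/-! ### The two normal forms -/

section NormalForms

/-- Irreducible real polynomials have degree at most two. -/
theorem exists_dvd_natDegree_eq_two {P : Polynomial ℝ} (hP : 3 ≤ P.natDegree) :
    ∃ Q : Polynomial ℝ, Q.natDegree = 2 ∧ Q ∣ P := by
  have hfac : ∀ R : Polynomial ℝ, 1 ≤ R.natDegree →
      ∃ q, q ∣ R ∧ (q.natDegree = 1 ∨ q.natDegree = 2) := by
    intro R hR
    obtain ⟨q, hq, hqR⟩ := WfDvdMonoid.exists_irreducible_factor
      (Polynomial.not_isUnit_of_natDegree_pos R hR) (Polynomial.ne_zero_of_natDegree_gt hR)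
    have h1 := hq.natDegree_le_two
    have h2 := hq.natDegree_pos
    exact ⟨q, hqR, by omega⟩
  obtain ⟨q, ⟨R, rfl⟩, h | h⟩ := hfac P (by omega)
  · have hne : q * R ≠ 0 := Polynomial.ne_zero_of_natDegree_gt hP
    have hR := Polynomial.natDegree_mul (left_ne_zero_of_mul hne) (right_ne_zero_of_mul hne)
    obtain ⟨q', hq', h' | h'⟩ := hfac R (by omega)
    · refine ⟨q * q', ?_, mul_dvd_mul_left q hq'⟩
      rw [Polynomial.natDegree_mul (left_ne_zero_of_mul hne)
        (ne_zero_of_dvd_ne_zero (right_ne_zero_of_mul hne) hq'), h, h']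
    · exact ⟨q', h', hq'.mul_left q⟩
  · exact ⟨q, h, dvd_mul_right q R⟩

/-- A real quintic `a₅ s⁵ + … + a₀` is the product of `s² - m s - n` and
`a₅ s³ + b₂ s² + b₁ s + b₀`. -/
theorem exists_quadratic_factor {a : Fin 6 → ℝ} (ha : a 5 ≠ 0) :
    ∃ m n b₀ b₁ b₂ : ℝ, a 4 = b₂ - m * a 5 ∧ a 3 = b₁ - m * b₂ - n * a 5 ∧
      a 2 = b₀ - m * b₁ - n * b₂ ∧ a 1 = -m * b₀ - n * b₁ ∧ a 0 = -n * b₀ := by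
  let P : Polynomial ℝ := .C (a 5) * .X ^ 5 + .C (a 4) * .X ^ 4 + .C (a 3) * .X ^ 3 +
    .C (a 2) * .X ^ 2 + .C (a 1) * .X + .C (a 0)
  have hP : P.natDegree = 5 := by
    simp only [P]
    compute_degree!
  obtain ⟨Q, hQ, R, hR⟩ := exists_dvd_natDegree_eq_two (P := P) (by omega)
  have hne : Q * R ≠ 0 := by
    rw [← hR]
    exact Polynomial.ne_zero_of_natDegree_gt (n := 0) (by omega)
  have hR3 : R.natDegree = 3 := by
    have := Polynomial.natDegree_mul (left_ne_zero_of_mul hne) (right_ne_zero_of_mul hne)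
    rw [← hR] at this
    omega
  have hq : Q.coeff 2 ≠ 0 := by
    rw [← hQ]
    exact Polynomial.leadingCoeff_ne_zero.2 (left_ne_zero_of_mul hne)
  have zq : ∀ n, 2 < n → Q.coeff n = 0 := fun n hn =>
    Polynomial.coeff_eq_zero_of_natDegree_lt (by omega)
  have zr : ∀ n, 3 < n → R.coeff n = 0 := fun n hn =>
    Polynomial.coeff_eq_zero_of_natDegree_lt (by omega)
  have hc : ∀ n, P.coeff n =
      ∑ x ∈ Finset.HasAntidiagonal.antidiagonal n, Q.coeff x.1 * R.coeff x.2 := by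
    intro n
    rw [hR, Polynomial.coeff_mul]
  have c0 := hc 0
  have c1 := hc 1
  have c2 := hc 2
  have c3 := hc 3
  have c4 := hc 4
  have c5 := hc 5
  simp [P, Finset.Nat.antidiagonal_succ, Polynomial.coeff_X, Polynomial.coeff_C, zq, zr]
    at c0 c1 c2 c3 c4 c5
  refine ⟨-Q.coeff 1 / Q.coeff 2, -Q.coeff 0 / Q.coeff 2, Q.coeff 2 * R.coeff 0,
    Q.coeff 2 * R.coeff 1, Q.coeff 2 * R.coeff 2, ?_, ?_, ?_, ?_, ?_⟩
  · rw [c4, c5]; field_simp; ring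
  · rw [c3, c5]; field_simp; ring
  · rw [c2]; field_simp; ring
  · rw [c1]; field_simp; ring
  · rw [c0]; field_simp

variable {F : MvPolynomial (Fin 4) ℝ} {p : P3}

theorem Coordinates.span_eq_top_of_split {a : Fin 6 → ℝ} (E : Coordinates F p (splitCubic a))
    (hF : IsOneNodalCubic F p) :
    Submodule.span (ZMod 2) (realLineClasses (hypersurface F \ {p})) = ⊤ := by
  -- otherwise the point `(-a₄ : 1 : 0 : 0)` is singular
  have ha : a 5 ≠ 0 := by
    intro h5
    refine E.not_forall_order_two hF (v := ![-a 4, 1, 0, 0]) (by simp) fun w =>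
      ⟨(splitCubic a (![-a 4, 1, 0, 0] + w) + splitCubic a (![-a 4, 1, 0, 0] - w)) / 2 -
        splitCubic a ![-a 4, 1, 0, 0], splitCubic a w, fun t => ?_⟩
    simp only [splitCubic, Pi.add_apply, Pi.sub_apply, Pi.smul_apply, smul_eq_mul, Matrix.cons_val,
      h5]
    ring
  -- a multiple root `r` yields a singular point on the line through the node and `(r² : r : 1)`;
  -- in the certificate for the order of vanishing, `f(v + t w)` is a cubic polynomial in `t`
  have hsimple : ∀ r, quintic a r = 0 → quinticDeriv a r ≠ 0 := by
    intro r hr hr'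
    set v : Fin 4 → ℝ := ![-quinticLin a r, r ^ 2, r, 1] with hv
    refine E.not_forall_order_two hF (v := v) (by simp [hv]) fun w =>
      ⟨(splitCubic a (v + w) + splitCubic a (v - w)) / 2 - splitCubic a v, splitCubic a w,
        fun t => ?_⟩
    simp only [quintic, quinticDeriv] at hr hr'
    simp only [splitCubic, hv, quinticLin, Pi.add_apply, Pi.sub_apply, Pi.smul_apply, smul_eq_mul,
      Matrix.cons_val]
    linear_combination (1 + 3 * t * w 3) * hr + (t * w 2 - t * r * w 3) * hr'
  obtain ⟨m, n, b₀, b₁, b₂, h4, h3, h2, h1, h0⟩ := exists_quadratic_factor ha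
  refine E.span_realLineClasses_eq_top hF.homogeneous ⟨![0, 1, 0, 0], ?_, by simp⟩ fun Φ c hc =>
    exists_isPotentialOn_univ_of_split Φ ha hsimple h4 h3 h2 h1 h0 hc
  simp [splitCubic]

theorem Coordinates.span_eq_top_of_pointless {τ : ℝ} {b : Fin 6 → ℝ}
    (E : Coordinates F p (pointlessCubic τ b)) (hF : F.IsHomogeneous 3) (hτ : τ ≠ 0)
    (hpt : ∀ v : Fin 4 → ℝ, (v 1 ≠ 0 ∨ v 2 ≠ 0 ∨ v 3 ≠ 0) → coneForm τ v = 0 → baseForm b v ≠ 0) :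
    Submodule.span (ZMod 2) (realLineClasses (hypersurface F \ {p})) = ⊤ := by
  refine E.span_realLineClasses_eq_top hF ⟨![0, 1, 0, 0], ?_, by simp⟩ fun Φ c hc =>
    exists_isPotentialOn_univ_of_pointless Φ hτ hpt hc
  simp [pointlessCubic, baseForm]

section NormalForm

variable {s : Fin 6 → ℝ} {k : Fin 10 → ℝ}

/-- If the conic `Q` and the cubic `K` have a common real point, the surface has the split normal
form. -/
theorem exists_splitCubic
    (E : Coordinates F p fun v => v 0 * quadForm s (Fin.tail v) + cubicForm k (Fin.tail v))
    (hs : (gramMatrix s).det ≠ 0) {a : Fin 3 → ℝ} (ha : a ≠ 0) (hQ : quadForm s a = 0)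
    (hK : cubicForm k a = 0) : ∃ a' : Fin 6 → ℝ, Nonempty (Coordinates F p (splitCubic a')) := by
  obtain ⟨b, c, κ, hκ, h⟩ := exists_isotropic_frame hs ha hQ
  obtain ⟨k', hk'⟩ := exists_cubicForm_comb k a b c
  have h0 : k' 0 = 0 := by
    have h1 := hk' 1 0 0
    rw [one_smul, zero_smul, zero_smul, add_zero, add_zero, hK] at h1
    simpa [cubicForm] using h1.symm
  -- the monomials `x y²`, `y³`, `y² z` are removed by adding a multiple of `x z - y²`
  obtain ⟨M, hM⟩ := exists_equiv_of_frame (eq_zero_of_isotropic_frame hκ h) hκ ![k' 5, k' 1, k' 6]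
  refine ⟨![k' 2, k' 8, k' 7 + k' 6, k' 9 + k' 1, k' 4 + k' 5, k' 3],
    ⟨E.trans M (inv_ne_zero hκ) ?_ fun v => ?_⟩⟩
  · rw [hM]
    ext i
    refine Fin.cases ?_ (fun j => ?_) i <;> simp
  · simp only [hM, Fin.cons_zero, Fin.tail_cons, h, hk']
    simp only [cubicForm, splitCubic, Matrix.cons_val, h0]
    field_simp
    ring

theorem cubicForm_add_I_smul (k : Fin 10 → ℝ) (a b : Fin 3 → ℝ) :
    cubicForm (fun i => (k i : ℂ)) (fun i => (a i : ℂ) + b i * Complex.I) =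
      ((2 * cubicForm k a - (cubicForm k (a + b) + cubicForm k (a - b)) / 2 : ℝ) : ℂ) +
      (((cubicForm k (a + b) - cubicForm k (a - b)) / 2 - 2 * cubicForm k b : ℝ) : ℂ) *
        Complex.I := by
  have hI := Complex.I_sq
  have hI3 : Complex.I ^ 3 = -Complex.I := Complex.I_pow_three
  simp only [cubicForm, Pi.add_apply, Pi.sub_apply]
  push_cast
  ring_nf
  rw [hI, hI3]
  ring

theorem quadForm_add_I_smul (s : Fin 6 → ℝ) (a b : Fin 3 → ℝ) :
    quadForm (fun i => (s i : ℂ)) (fun i => (a i : ℂ) + b i * Complex.I) =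
      ((quadForm s a - quadForm s b : ℝ) : ℂ) + ((2 * polarForm s a b : ℝ) : ℂ) * Complex.I := by
  have hI := Complex.I_sq
  simp only [quadForm, polarForm_eq]
  push_cast
  ring_nf
  rw [hI]
  ring

/-- A non-degenerate ternary quadratic form has no totally isotropic plane. -/
theorem exists_smul_eq_of_isotropic (hs : (gramMatrix s).det ≠ 0) {a b : Fin 3 → ℝ} (ha : a ≠ 0)
    (hQa : quadForm s a = 0) (hQb : quadForm s b = 0) (hab : polarForm s a b = 0) :
    ∃ x : ℝ, b = x • a := by
  obtain ⟨d, c, κ, hκ, h⟩ := exists_isotropic_frame hs ha hQa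
  obtain ⟨M, hM⟩ := exists_equiv_of_frame (eq_zero_of_isotropic_frame hκ h) hκ 0
  obtain ⟨v, hv⟩ := M.surjective (Fin.cons 0 b)
  rw [hM] at hv
  have hb : v 1 • a + v 2 • d + v 3 • c = b := (Fin.cons_injective2 hv).2
  have e0 := h (v 1) (v 2) (v 3)
  have e1 := h (v 1 + 1) (v 2) (v 3)
  rw [hb, hQb] at e0
  have hsum : (v 1 + 1) • a + v 2 • d + v 3 • c = (1 : ℝ) • a + (1 : ℝ) • b + (0 : ℝ) • b := by
    rw [← hb]
    module
  rw [hsum, quadForm_comb, hQa, hQb, hab] at e1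
  have h3 : v 3 = 0 := by
    apply mul_left_cancel₀ hκ
    linear_combination e0 - e1
  have h2 : v 2 = 0 := by
    rw [h3, mul_zero, zero_sub, zero_eq_mul, or_iff_right hκ] at e0
    simpa using e0
  refine ⟨v 1, ?_⟩
  rw [← hb, h2, h3, zero_smul, zero_smul, add_zero, add_zero]

/-- If the conic `Q` and the cubic `K` have no common real point, the surface has the pointless
normal form: they still have a pair of conjugate common points `a ± i b`, and the vectors `a`, `b`
are orthogonal with `Q a = Q b ≠ 0`. -/
theorem exists_pointlessCubic
    (E : Coordinates F p fun v => v 0 * quadForm s (Fin.tail v) + cubicForm k (Fin.tail v))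
    (hs : (gramMatrix s).det ≠ 0)
    (hno : ∀ a : Fin 3 → ℝ, a ≠ 0 → quadForm s a = 0 → cubicForm k a ≠ 0) :
    ∃ (τ : ℝ) (b' : Fin 6 → ℝ), τ ≠ 0 ∧ Nonempty (Coordinates F p (pointlessCubic τ b')) ∧
      ∀ v : Fin 4 → ℝ, (v 1 ≠ 0 ∨ v 2 ≠ 0 ∨ v 3 ≠ 0) → coneForm τ v = 0 → baseForm b' v ≠ 0 := by
  obtain ⟨ζ, hζ, hQζ, hKζ⟩ := exists_common_zero (s := fun i => (s i : ℂ)) (by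
    have : (gramMatrix fun i => (s i : ℂ)) = (gramMatrix s).map (algebraMap ℝ ℂ) := by
      ext i j
      fin_cases i <;> fin_cases j <;> rfl
    rw [this, ← RingHom.mapMatrix_apply, ← RingHom.map_det]
    simpa using hs) fun i => (k i : ℂ)
  obtain ⟨a, b, rfl⟩ : ∃ a b : Fin 3 → ℝ, ζ = fun i => (a i : ℂ) + b i * Complex.I :=
    ⟨fun i => (ζ i).re, fun i => (ζ i).im, funext fun i => (Complex.re_add_im _).symm⟩
  rw [quadForm_add_I_smul, ← Complex.mk_eq_add_mul_I, Complex.ext_iff] at hQζ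
  rw [cubicForm_add_I_smul, ← Complex.mk_eq_add_mul_I, Complex.ext_iff] at hKζ
  simp only [Complex.zero_re, Complex.zero_im] at hQζ hKζ
  obtain ⟨hQab, hab⟩ := hQζ
  obtain ⟨hK1, hK2⟩ := hKζ
  have hab : polarForm s a b = 0 := by linarith
  set κ := quadForm s a with hκdef
  have hQb : quadForm s b = κ := by linarith
  -- otherwise `a` and `b` span a totally isotropic subspace, so `a + i b` is a multiple of a real
  -- vector, which would be a common real point
  have hκ : κ ≠ 0 := by
    intro h0
    by_cases ha : a = 0
    · subst ha
      refine hno b (fun hb => hζ ?_) (hQb.trans h0) ?_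
      · ext i
        simp [hb]
      · have e : cubicForm k (0 + b) - cubicForm k (0 - b) = 2 * cubicForm k b := by
          simp only [cubicForm, Pi.add_apply, Pi.sub_apply, Pi.zero_apply]
          ring
        linarith
    · obtain ⟨x, rfl⟩ := exists_smul_eq_of_isotropic hs ha h0 (hQb.trans h0) hab
      have e1 : 2 * cubicForm k a - (cubicForm k (a + x • a) + cubicForm k (a - x • a)) / 2 =
          (1 - 3 * x ^ 2) * cubicForm k a := by
        simp only [cubicForm, Pi.add_apply, Pi.sub_apply, Pi.smul_apply, smul_eq_mul]
        ring
      have e2 : (cubicForm k (a + x • a) - cubicForm k (a - x • a)) / 2 - 2 * cubicForm k (x • a) =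
          (3 * x - x ^ 3) * cubicForm k a := by
        simp only [cubicForm, Pi.add_apply, Pi.sub_apply, Pi.smul_apply, smul_eq_mul]
        ring
      rw [e1] at hK1
      rw [e2] at hK2
      -- `(1 + i x)³` does not vanish
      have h3 := hno a ha h0
      have h4 := (mul_eq_zero.1 hK1).resolve_right h3
      have h5 := (mul_eq_zero.1 hK2).resolve_right h3
      have h6 : (8 : ℝ) / 9 = 0 := by linear_combination x * h5 + (8 / 9 - x ^ 2 / 3) * h4
      norm_num at h6
  set c := polarCross s a b with hc
  obtain ⟨hac, hbc⟩ := polarForm_polarCross s a b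
  set τ := (gramMatrix s).det * κ with hτdef
  have hτ : τ ≠ 0 := mul_ne_zero hs hκ
  have hQc : quadForm s c = κ * τ := by
    rw [hc, quadForm_polarCross, hab, hQb, ← hκdef, hτdef]
    ring
  have hQ : ∀ x y z : ℝ, quadForm s (x • a + y • b + z • c) =
      κ * (x ^ 2 + y ^ 2 + τ * z ^ 2) := by
    intro x y z
    rw [quadForm_comb, hab, hac, hbc, hQb, hQc, ← hκdef]
    ring
  have hfr : ∀ x y z : ℝ, x • a + y • b + z • c = 0 → x = 0 ∧ y = 0 ∧ z = 0 := by
    intro x y z h0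
    have key : ∀ x' y' z' : ℝ, (x + x') ^ 2 + (y + y') ^ 2 + τ * (z + z') ^ 2 =
        x' ^ 2 + y' ^ 2 + τ * z' ^ 2 := by
      intro x' y' z'
      apply mul_left_cancel₀ hκ
      rw [← hQ, ← hQ]
      congr 1
      calc (x + x') • a + (y + y') • b + (z + z') • c
          = (x • a + y • b + z • c) + (x' • a + y' • b + z' • c) := by module
        _ = x' • a + y' • b + z' • c := by rw [h0, zero_add]
    have e0 := key 0 0 0
    have e1 := key 1 0 0
    have e2 := key 0 1 0
    have e3 := key 0 0 1
    refine ⟨by linear_combination (e1 - e0) / 2, by linear_combination (e2 - e0) / 2, ?_⟩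
    have : τ * z = 0 := by linear_combination (e3 - e0) / 2
    exact (mul_eq_zero.1 this).resolve_left hτ
  obtain ⟨k', hk'⟩ := exists_cubicForm_comb k a b c
  -- as `K` vanishes at `a + i b`, its restriction to the plane of `a` and `b` is divisible by
  -- `x² + y²`
  have hk5 : k' 5 = k' 0 ∧ k' 3 = k' 1 := by
    have e1 := hk' 1 0 0
    have e2 := hk' 0 1 0
    have e3 := hk' 1 1 0
    have e4 := hk' 1 (-1) 0
    simp only [one_smul, zero_smul, neg_smul, add_zero, zero_add, ← sub_eq_add_neg] at e1 e2 e3 e4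
    rw [e1, e3, e4] at hK1
    rw [e2, e3, e4] at hK2
    simp only [cubicForm, Matrix.cons_val] at hK1 hK2
    constructor <;> linarith
  obtain ⟨M, hM⟩ := exists_equiv_of_frame hfr hκ ![-k' 0, -k' 1, 0]
  refine ⟨τ, ![k' 4, k' 6, k' 2, k' 9, k' 7 - τ * k' 0, k' 8 - τ * k' 1], hτ,
    ⟨E.trans M (inv_ne_zero hκ) ?_ fun v => ?_⟩, fun v hv hcone hbase => ?_⟩
  · rw [hM]
    ext i
    refine Fin.cases ?_ (fun j => ?_) i <;> simp
  · simp only [hM, Fin.cons_zero, Fin.tail_cons, hQ, hk']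
    simp only [cubicForm, pointlessCubic, coneForm, baseForm, Matrix.cons_val, hk5.1, hk5.2]
    field_simp
    ring
  · refine hno (v 1 • a + v 2 • b + v 3 • c) (fun h0 => ?_) ?_ ?_
    · obtain ⟨h1, h2, h3⟩ := hfr _ _ _ h0
      simp [h1, h2, h3] at hv
    · rw [hQ]
      rw [coneForm] at hcone
      rw [hcone, mul_zero]
    · rw [hk']
      simp only [coneForm, baseForm, Matrix.cons_val] at hcone hbase
      simp only [cubicForm, Matrix.cons_val, hk5.1, hk5.2]
      linear_combination (k' 0 * v 1 + k' 1 * v 2) * hcone + hbase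

end NormalForm

end NormalForms

end RealCubic

end

theorem mainTheorem3 (F : MvPolynomial (Fin 4) ℝ) (p : RealCubic.P3)
    (hF : RealCubic.IsOneNodalCubic F p) :
    Submodule.span (ZMod 2)
      (RealCubic.realLineClasses (RealCubic.hypersurface F \ {p})) = ⊤ := by
  obtain ⟨s, k, hs, ⟨E⟩⟩ := RealCubic.exists_coordinates hF
  by_cases h : ∃ a : Fin 3 → ℝ, a ≠ 0 ∧ RealCubic.quadForm s a = 0 ∧ RealCubic.cubicForm k a = 0
  · obtain ⟨a, ha, hQ, hK⟩ := h
    obtain ⟨a', ⟨E'⟩⟩ := RealCubic.exists_splitCubic E hs ha hQ hK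
    exact E'.span_eq_top_of_split hF
  · push Not at h
    obtain ⟨τ, b, hτ, ⟨E'⟩, hpt⟩ := RealCubic.exists_pointlessCubic E hs h
    exact E'.span_eq_top_of_pointless hF.homogeneous hτ hpt
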